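/- \textbf{Setting.} Let $T\subset\mathbb R$ be compact, let $\rho$ be a finite Borel measure on $T$ (for instance Lebesgue measure), and write $L^2(T)=L^2(T,\rho)$. Let $X=(X(t))_{t\in T}$ be a jointly measurable real stochastic process with mean function $\mu_0(t)=\mathbb E[X(t)]$, and let $X_1,X_2,\dots$ be i.i.d. copies of $X$, realised as $X_i(t)=X(t,\xi_i)$, where $\xi_1,\xi_2,\dots$ are i.i.d. random elements whose law is that of the probability space on which $X$ is defined. For $n\ge 1$ and $m_1,\dots,m_n\ge 1$ one observes $$Y_{ij}=X_i(t_{ij})+\epsilon_{ij},\qquad 1\le j\le m_i,\ 1\le i\le n,$$ where the $t_{ij}$ are i.i.d. with law $\rho/\rho(T)$, the $\epsilon_{ij}$ are i.i.d. with mean zero and finite variance, and all $\xi_i$, $t_{ij}$, $\epsilon_{ij}$ are mutually independent. Let $m=\big(\frac1n\sum_{i=1}^n\frac1{m_i}\big)^{-1}$. Let $\mathcal H$ be an RKHS of real functions on $T$ with continuous kernel $k$, let $J:\mathcal H\to L^2(T)$ be the inclusion, and let $\Lambda=JJ^*$, i.e. $\Lambda f=\int_T k(s,\cdot)f(s)\,d\rho(s)$.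 Let $(\lambda_i,\psi_i)_{i\ge1}$ be the eigenvalue-eigenvector pairs of $\Lambda$, that is, $\lambda_i>0$, $(\psi_i)$ is orthonormal and $\Lambda=\sum_i\lambda_i\langle\cdot,\psi_i\rangle\psi_i$; put $\Lambda^{\alpha}=\sum_i\lambda_i^{\alpha}\langle\cdot,\psi_i\rangle\psi_i$. Let $a>0$ satisfy $\sup_{t\in T}k(t,t)\le a$, and let $g_\lambda:[0,a]\to\mathbb R$, $0<\lambda\le a$, be a regularization family: there are constants $a_1,a_2,a_3>0$ with $|\sigma g_\lambda(\sigma)|\le a_1$, $|g_\lambda(\sigma)|\le a_2/\lambda$ and $|1-\sigma g_\lambda(\sigma)|\le a_3$ for all $\lambda,\sigma\in(0,a]$. Its qualification $\nu\in[0,\infty]$ is the maximal $p$ for which there is a constant $\omega_p$ with $|1-\sigma g_\lambda(\sigma)|\sigma^p\le\omega_p\lambda^p$ for all $\lambda,\sigma\in(0,a]$ ($\nu=\infty$ if this holds for all $p\ge 0$). Assume $\nu\ge1$. The estimator is $$\hat\mu_\lambda=g_\lambda(\hat S_n)V,\quad \hat S_n=\frac1n\sum_{i=1}^n\frac1{m_i}\sum_{j=1}^{m_i}k(t_{ij},\cdot)\otimes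 k(t_{ij},\cdot),\quad V=\frac1n\sum_{i=1}^n\frac1{m_i}\sum_{j=1}^{m_i}Y_{ij}\,k(t_{ij},\cdot),$$ with $g_\lambda(\hat S_n)$ given by the spectral calculus of the finite-rank self-adjoint operator $\hat S_n$ on $\mathcal H$. \textbf{Assumptions.} (1) $\mu_0=\Lambda^{\alpha}h$ in $L^2(T)$ for some $h\in L^2(T)$ and some $\alpha>0$. (2) $\sup_{s\in T}\mathbb E[X(s)^2]<\infty$, and there are finite constants $C,C_1$ with $\mathbb E[X(s)^4]\le C(\mathbb E[X(s)^2])^2$ for all $s\in T$ and $\mathbb E[\langle X,f\rangle_{L^2(T)}^4]\le C_1(\mathbb E[\langle X,f\rangle_{L^2(T)}^2])^2$ for all $f\in L^2(T)$. (3) There are $b>1$ and $c,c'>0$ with $c\,i^{-b}\le\lambda_i\le c'\,i^{-b}$ for all $i\ge1$. \textbf{Theorem.} Under (1)--(3), let $r=\min\{\alpha,\nu\}$ and $\lambda=(mn)^{-\frac{b}{1+2rb}}$. If $\alpha\ge\frac12$, then for every $\delta\in(0,1)$ there is a constant $K_\delta<\infty$, not depending on $n$ or $(m_1,\dots,m_n)$,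 such that for all $n$ and $(m_1,\dots,m_n)$ with $\lambda\le a$ (so that $g_\lambda$ is defined), with probability at least $\delta$, $$\|\hat\mu_\lambda-\mu_0\|_{L^2(T)}\le K_\delta\Big(\frac1{\sqrt n}+(mn)^{-\frac{rb}{1+2rb}}\Big).$$ If $0<\alpha\le\frac12$ and, in addition, there is a constant $Z>0$ such that $\big\|\sum_i a_i\lambda_i^{\alpha}\psi_i\big\|_{L^\infty(T)}\le Z\big(\sum_i a_i^2\big)^{1/2}$ for all $(a_i)\in\ell^2$ (that is, the power space $[\mathcal H]^\alpha$ embeds continuously into $L^\infty(T)$), then in the same sense $$\|\hat\mu_\lambda-\mu_0\|_{L^2(T)}\le K_\delta\Big(\frac1{\sqrt n}+(mn)^{-\frac{\alpha b}{1+2\alpha b}}\Big).$$ -/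

import Mathlib

open MeasureTheory ProbabilityTheory Filter Topology
open scoped ENNReal NNReal InnerProductSpace

noncomputable section

namespace FDA

/-! ### The reproducing kernel Hilbert space and its integral operator -/

section Kernel

variable {𝕋 : Type*} (H : Type*) [NormedAddCommGroup H] [InnerProductSpace ℝ H] [CompleteSpace H]
  [RKHS ℝ H 𝕋 ℝ]

/-- The scalar reproducing kernel `k(s, t)` of a real RKHS. -/
def kern (s t : 𝕋) : ℝ := RKHS.kernel H s t 1

/-- The kernel section `k(t, ·)`, as an element of the RKHS. -/
def kernSec (t : 𝕋) : H := RKHS.kerFun H t 1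

variable {H}

lemma inner_kernSec (f : H) (t : 𝕋) : ⟪f, kernSec H t⟫_ℝ = f t := by
  simp [kernSec]

lemma inner_kernSec_kernSec (s t : 𝕋) : ⟪kernSec H s, kernSec H t⟫_ℝ = kern H t s := by
  rw [inner_kernSec, kernSec, RKHS.kerFun_apply, kern]

variable [TopologicalSpace 𝕋]

lemma continuous_kernSec (hk : Continuous fun p : 𝕋 × 𝕋 => kern H p.1 p.2) :
    Continuous (kernSec H : 𝕋 → H) := by
  have key : ∀ (K : 𝕋 → 𝕋 → ℝ) (u : 𝕋 → H), Continuous (fun p : 𝕋 × 𝕋 => K p.1 p.2) →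
      (∀ s t, ⟪u s, u t⟫_ℝ = K t s) → Continuous u := by
    intro K u hK hu
    rw [continuous_iff_continuousAt]
    intro t
    rw [ContinuousAt, tendsto_iff_norm_sub_tendsto_zero]
    have e : ∀ s : 𝕋, ‖u s - u t‖ = √(K s s - 2 * K t s + K t t) := by
      intro s
      rw [← hu s s, ← hu s t, ← hu t t, real_inner_self_eq_norm_sq, real_inner_self_eq_norm_sq,
        ← norm_sub_sq_real, Real.sqrt_sq (norm_nonneg _)]
    have h1 : Continuous fun s : 𝕋 => K s s := hK.comp (continuous_id.prodMk continuous_id)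
    have h3 : Continuous fun s : 𝕋 => K t s := hK.comp (continuous_const.prodMk continuous_id)
    have hc : Continuous fun s : 𝕋 => √(K s s - 2 * K t s + K t t) := by fun_prop
    have hl := hc.tendsto t
    simp only [e]
    convert hl using 2
    rw [show K t t - 2 * K t t + K t t = 0 by ring, Real.sqrt_zero]
  exact key (kern H) (kernSec H) hk inner_kernSec_kernSec

lemma continuous_coe (hk : Continuous fun p : 𝕋 × 𝕋 => kern H p.1 p.2) (f : H) :
    Continuous (f : 𝕋 → ℝ) := by
  have h : (f : 𝕋 → ℝ) = fun t => ⟪f, kernSec H t⟫_ℝ := by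
    funext t
    rw [inner_kernSec]
  rw [h]
  exact continuous_const.inner (continuous_kernSec hk)

variable [CompactSpace 𝕋]

/-- The RKHS of a continuous kernel on a compact space sits inside the continuous functions. -/
def toContinuous (hk : Continuous fun p : 𝕋 × 𝕋 => kern H p.1 p.2) : H →ₗ[ℝ] C(𝕋, ℝ) where
  toFun f := ⟨f, continuous_coe hk f⟩
  map_add' f g := by ext; simp
  map_smul' c f := by ext; simp

lemma exists_norm_toContinuous_le (hk : Continuous fun p : 𝕋 × 𝕋 => kern H p.1 p.2) :
    ∃ C : ℝ, ∀ f : H, ‖toContinuous hk f‖ ≤ C * ‖f‖ := by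
  obtain ⟨C, hC⟩ := (isCompact_range (continuous_kernSec hk)).isBounded.exists_norm_le
  refine ⟨max C 0, fun f => ?_⟩
  rw [ContinuousMap.norm_le _ (by positivity)]
  intro t
  have h1 : toContinuous hk f t = ⟪f, kernSec H t⟫_ℝ := (inner_kernSec f t).symm
  rw [h1, mul_comm]
  refine (norm_inner_le_norm _ _).trans ?_
  gcongr
  exact (hC _ ⟨t, rfl⟩).trans (le_max_left _ _)

variable [MeasurableSpace 𝕋] [BorelSpace 𝕋]

/-- The inclusion operator `J : H → L²(ρ)`, `f ↦ f`. -/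
def inclusion (hk : Continuous fun p : 𝕋 × 𝕋 => kern H p.1 p.2) (ρ : Measure 𝕋)
    [IsFiniteMeasure ρ] : H →L[ℝ] Lp ℝ 2 ρ :=
  (ContinuousMap.toLp 2 ρ ℝ : C(𝕋, ℝ) →L[ℝ] Lp ℝ 2 ρ) ∘L
    (toContinuous hk).mkContinuousOfExistsBound (exists_norm_toContinuous_le hk)

/-- The integral operator `Λ = J J*` on `L²(ρ)`, that is `Λ f = ∫ k(s, ·) f(s) dρ(s)`. -/
def integralOp (hk : Continuous fun p : 𝕋 × 𝕋 => kern H p.1 p.2) (ρ : Measure 𝕋)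
    [IsFiniteMeasure ρ] : Lp ℝ 2 ρ →L[ℝ] Lp ℝ 2 ρ :=
  inclusion hk ρ ∘L ContinuousLinearMap.adjoint (inclusion hk ρ)

end Kernel

/-! ### Eigensystems, powers, power spaces -/

section Spectral

variable {E : Type*} [NormedAddCommGroup E] [InnerProductSpace ℝ E]

/-- `(ev i, ψ i)` are the eigenvalue-eigenvector pairs of `A`, the (infinitely many) nonzero
eigenvalues being listed with multiplicity: `A = ∑ i, ev i ⟪·, ψ i⟫ ψ i`, `ψ` orthonormal. -/
structure IsEigensystem (A : E →L[ℝ] E) (ev : ℕ → ℝ) (ψ : ℕ → E) : Prop where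
  orthonormal : Orthonormal ℝ ψ
  pos : ∀ i, 0 < ev i
  hasSum : ∀ f : E, HasSum (fun i => (ev i * ⟪ψ i, f⟫_ℝ) • ψ i) (A f)

/-- `f = A ^ α h`, where `A` has the eigensystem `(ev, ψ)`. -/
def IsPowerImage (ev : ℕ → ℝ) (ψ : ℕ → E) (α : ℝ) (h f : E) : Prop :=
  HasSum (fun i => (ev i ^ α * ⟪ψ i, h⟫_ℝ) • ψ i) f

/-- Polynomial eigenvalue decay `i ^ (-b) ≲ ev_i ≲ i ^ (-b)`, `i = 1, 2, …`. -/
def PolyDecay (ev : ℕ → ℝ) (b : ℝ) : Prop :=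
  ∃ c C : ℝ, 0 < c ∧ 0 < C ∧
    ∀ i : ℕ, c * ((i : ℝ) + 1) ^ (-b) ≤ ev i ∧ ev i ≤ C * ((i : ℝ) + 1) ^ (-b)

/-- `f = ∑ i, a_i ev_i ^ α ψ_i`: the element of the power space `[H]^α` with coefficient
sequence `a ∈ ℓ²`; its power norm is `‖a‖`. -/
def IsPowerSpaceElement (ev : ℕ → ℝ) (ψ : ℕ → E) (α : ℝ) (a : lp (fun _ : ℕ => ℝ) 2) (f : E) :
    Prop :=
  HasSum (fun i => (a i * ev i ^ α) • ψ i) f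

/-- The embedding `[H]^α ↪ L_∞(ρ)` is bounded. -/
def PowerEmbedding {𝕋 : Type*} [MeasurableSpace 𝕋] {ρ : Measure 𝕋} (ev : ℕ → ℝ)
    (ψ : ℕ → Lp ℝ 2 ρ) (α : ℝ) : Prop :=
  ∃ Z : ℝ, 0 < Z ∧ ∀ (a : lp (fun _ : ℕ => ℝ) 2) (f : Lp ℝ 2 ρ),
    IsPowerSpaceElement ev ψ α a f → eLpNorm f ∞ ρ ≤ ENNReal.ofReal (Z * ‖a‖)

variable [CompleteSpace E]

/-- Spectral calculus `φ(A) v = ∑ σ, φ(σ) P_σ v` for a finite-rank self-adjoint operator `A`,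
where `P_σ` is the orthogonal projection onto `ker (A - σ)`
(zero unless `σ` is one of the finitely many eigenvalues of `A`). -/
def specApply (φ : ℝ → ℝ) (A : E →L[ℝ] E) (v : E) : E :=
  ∑ᶠ σ : ℝ, φ σ • (A - σ • ContinuousLinearMap.id ℝ E).ker.starProjection v

end Spectral

/-! ### Regularization families -/

/-- The bounds defining a regularization family `g_l : [0, a] → ℝ`, `0 < l ≤ a`. -/
structure IsRegularizationFamily (a : ℝ) (g : ℝ → ℝ → ℝ) : Prop where
  bound_mul : ∃ a₁ : ℝ, 0 < a₁ ∧
    ∀ l ∈ Set.Ioc 0 a, ∀ σ ∈ Set.Ioc 0 a, |σ * g l σ| ≤ a₁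
  bound : ∃ a₂ : ℝ, 0 < a₂ ∧
    ∀ l ∈ Set.Ioc 0 a, ∀ σ ∈ Set.Ioc 0 a, |g l σ| ≤ a₂ / l
  bound_residual : ∃ a₃ : ℝ, 0 < a₃ ∧
    ∀ l ∈ Set.Ioc 0 a, ∀ σ ∈ Set.Ioc 0 a, |1 - g l σ * σ| ≤ a₃

/-- The property `sup_σ |1 - g_l(σ) σ| σ ^ p ≤ ω_p l ^ p`, with `ω_p` independent of `l`. -/
def QualifiesAt (a : ℝ) (g : ℝ → ℝ → ℝ) (p : ℝ) : Prop :=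
  ∃ ω : ℝ, ∀ l ∈ Set.Ioc 0 a, ∀ σ ∈ Set.Ioc 0 a, |1 - g l σ * σ| * σ ^ p ≤ ω * l ^ p

/-- `ν ∈ [0, ∞]` is the qualification: the maximal exponent `p` for which the family qualifies
(`∞` if it qualifies at every exponent). -/
def IsQualification (a : ℝ) (g : ℝ → ℝ → ℝ) (ν : ℝ≥0∞) : Prop :=
  ∀ p : ℝ≥0, QualifiesAt a g p ↔ (p : ℝ≥0∞) ≤ ν

/-! ### The process and the observation model -/

section Model

variable {𝕋 S Ω : Type*} [MeasurableSpace 𝕋] [MeasurableSpace S] [MeasurableSpace Ω]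

/-- Mean function of the process `X` defined on the probability space `(S, Q)`. -/
def meanFun (Q : Measure S) (X : 𝕋 → S → ℝ) (t : 𝕋) : ℝ := ∫ x, X t x ∂Q

/-- The moment assumptions on the process `X`. -/
structure MomentConditions (ρ : Measure 𝕋) (Q : Measure S) (X : 𝕋 → S → ℝ) : Prop where
  second : ∃ M : ℝ≥0, ∀ s, ∫⁻ x, ‖X s x‖ₑ ^ 2 ∂Q ≤ M
  fourth : ∃ C : ℝ≥0, ∀ s, ∫⁻ x, ‖X s x‖ₑ ^ 4 ∂Q ≤ C * (∫⁻ x, ‖X s x‖ₑ ^ 2 ∂Q) ^ 2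
  functional : ∃ C₁ : ℝ≥0, ∀ f : Lp ℝ 2 ρ,
    ∫⁻ x, ‖∫ s, X s x * f s ∂ρ‖ₑ ^ 4 ∂Q ≤ C₁ * (∫⁻ x, ‖∫ s, X s x * f s ∂ρ‖ₑ ^ 2 ∂Q) ^ 2

/-- The sources of randomness: `ξ i` are i.i.d. with law `Q` (the `i`-th copy of the process is
`X_i(t) = X t (ξ i)`), the sampling points `t i j` are i.i.d. with law `π`, the measurement errors
`ε i j` are i.i.d. with law `η`, and all these variables are mutually independent. -/
structure IsSample (Q : Measure S) (π : Measure 𝕋) (η : Measure ℝ) (P : Measure Ω)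
    (ξ : ℕ → Ω → S) (t : ℕ → ℕ → Ω → 𝕋) (ε : ℕ → ℕ → Ω → ℝ) : Prop where
  measurable_path : ∀ i, Measurable (ξ i)
  measurable_point : ∀ i j, Measurable (t i j)
  measurable_error : ∀ i j, Measurable (ε i j)
  law_path : ∀ i, P.map (ξ i) = Q
  law_point : ∀ i j, P.map (t i j) = π
  law_error : ∀ i j, P.map (ε i j) = η
  indep : iIndep (fun s : ℕ ⊕ (ℕ × ℕ) ⊕ (ℕ × ℕ) => match s with
    | .inl i => MeasurableSpace.comap (ξ i) inferInstance
    | .inr (.inl p) => MeasurableSpace.comap (t p.1 p.2) inferInstance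
    | .inr (.inr p) => MeasurableSpace.comap (ε p.1 p.2) inferInstance) P

/-- The observations `Y_ij = X_i(t_ij) + ε_ij`. -/
def response (X : 𝕋 → S → ℝ) (ξ : ℕ → Ω → S) (t : ℕ → ℕ → Ω → 𝕋) (ε : ℕ → ℕ → Ω → ℝ)
    (ω : Ω) (i j : ℕ) : ℝ :=
  X (t i j ω) (ξ i ω) + ε i j ω

end Model

/-- A sampling scheme: `n ≥ 1` curves, the `i`-th one observed at `m_i ≥ 1` points. -/
structure Design where
  n : ℕ
  n_pos : 0 < n
  m : Fin n → ℕ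
  m_pos : ∀ i, 0 < m i

/-- The harmonic mean of the sample frequencies. -/
def Design.harmonicMean (D : Design) : ℝ :=
  ((D.n : ℝ)⁻¹ * ∑ i, ((D.m i : ℝ))⁻¹)⁻¹

/-- `m n`, with `m` the harmonic mean of the sample frequencies. -/
def Design.size (D : Design) : ℝ := D.harmonicMean * D.n

/-! ### The estimator -/

section Estimator

variable {𝕋 : Type*} (H : Type*) [NormedAddCommGroup H] [InnerProductSpace ℝ H] [CompleteSpace H]
  [RKHS ℝ H 𝕋 ℝ]

/-- `Ŝ_n = n⁻¹ ∑ i, m_i⁻¹ ∑ j, k(t_ij, ·) ⊗ k(t_ij, ·)`. -/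
def empiricalOp (D : Design) (t : ℕ → ℕ → 𝕋) : H →L[ℝ] H :=
  (D.n : ℝ)⁻¹ • ∑ i : Fin D.n, (D.m i : ℝ)⁻¹ • ∑ j : Fin (D.m i),
    InnerProductSpace.rankOne ℝ (kernSec H (t i j)) (kernSec H (t i j))

/-- `V = n⁻¹ ∑ i, m_i⁻¹ ∑ j, Y_ij k(t_ij, ·)`. -/
def empiricalVec (D : Design) (t : ℕ → ℕ → 𝕋) (y : ℕ → ℕ → ℝ) : H :=
  (D.n : ℝ)⁻¹ • ∑ i : Fin D.n, (D.m i : ℝ)⁻¹ • ∑ j : Fin (D.m i), y i j • kernSec H (t i j)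

/-- The spectral regularized estimator `g_l(Ŝ_n) V`. -/
def meanEstimator (g : ℝ → ℝ → ℝ) (l : ℝ) (D : Design) (t : ℕ → ℕ → 𝕋) (y : ℕ → ℕ → ℝ) : H :=
  specApply (g l) (empiricalOp H D t) (empiricalVec H D t y)

end Estimator

/-- `χ_D ≲_p e_D` for `D ∈ I`: for every confidence level `δ < 1` there is a constant `K`, the same
for all `D ∈ I`, such that `χ_D ≤ K e_D` with probability at least `δ` (stated as an upper bound
for the outer measure of the complementary event). -/
def BoundedInProb {Ω ι : Type*} [MeasurableSpace Ω] (P : Measure Ω) (I : Set ι)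
    (χ : ι → Ω → ℝ≥0∞) (e : ι → ℝ) : Prop :=
  ∀ δ : ℝ, 0 < δ → δ < 1 → ∃ K : ℝ, 0 < K ∧ ∀ D ∈ I,
    P {ω | ENNReal.ofReal (K * e D) < χ D ω} ≤ ENNReal.ofReal (1 - δ)

/-- The regularization parameter `(m n) ^ (-b / (1 + 2 r b))`. -/
def tuning (b r : ℝ) (D : Design) : ℝ := D.size ^ (-(b / (1 + 2 * r * b)))

/-- The rate `n ^ (-1/2) + (m n) ^ (-r b / (1 + 2 r b))`. -/
def rate (b r : ℝ) (D : Design) : ℝ :=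
  1 / √(D.n : ℝ) + D.size ^ (-(r * b / (1 + 2 * r * b)))

end FDA

end

/-!
The proof uses second moments only. Let `S = ρ(T)⁻¹ J* J` be the covariance operator on the RKHS
(`covOp`), with eigenvalues `σ_i = ev_i / ρ(T)` and orthonormal eigenfunctions `e_i`; it is the
population version of `Ŝ`. The target is replaced by its spectral truncation
`f_l = ∑_{σ_i > l} σ_i ^ (r - 1/2) h_i e_i` (`truncation`), which belongs to the RKHS even when the
mean function does not, at a cost `l ^ r` in `L²` (`IsEigensystem.norm_sub_truncation_sq_le`).
All operators are compared through the energies `⟪S f, f⟫ + l ‖f‖²` and `⟪Ŝ f, f⟫ + l ‖f‖²`, and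

`g_l(Ŝ) V - f_l = g_l(Ŝ) (V - Ŝ f_l) - (1 - Ŝ g_l(Ŝ)) f_l`

is estimated in the second one (`inner_estimator_sub_le`). Three facts are needed.

* *Comparison of the energies.* `S + l ≤ 2 κ (Ŝ + l)` with probability close to one. The expected
  squared Hilbert–Schmidt norm of `(S + κ l)^(-1/2) (Ŝ - S) (S + κ l)^(-1/2)` is at most a multiple
  of `(m n)⁻¹` times the leverage `sup_x ∑ e_i(x)² / (σ_i + κ l)` times the effective dimension
  `∑ σ_i / (σ_i + κ l)` (`IsSample.lintegral_empiricalOp_sub_le`). The leverage is of order `l⁻¹`, or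
  `l ^ (-2 α)` under the embedding, and the effective dimension of order `(κ l) ^ (-1 / b)`
  (`exists_effectiveDimension_le`), so Chebyshev's inequality with a large constant `κ` is enough
  and no exponential concentration is used (`IsSample.exists_energy_le`).
* *Noise.* The vector `V - Ŝ f_l` is bounded in the dual of the first energy. Its second moment
  splits into the fluctuation given the curves, of order `l ^ (-1 / b) / (m n) = l ^ (2 r)`, and the
  fluctuation of the curves, of order `1 / n` (`IsSample.lintegral_weighted_sum_sq_le`,
  `IsSample.lintegral_noise_le`); its mean is of the order of the truncation error. A duality
  argument (`norm_finCalc_sqrt_mul_le`) transports the bound through `g_l(Ŝ)`.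
* *Bias.* `(1 - Ŝ g_l(Ŝ)) f_l` has energy norm of order `l ^ r`
  (`IsEigensystem.exists_residual_truncation_le`). For `r ≤ 1` this is the same duality argument and
  qualification `1`. For `r > 1` the power `r - 1/2` is split into its integer and fractional parts;
  integer powers of `S` and `Ŝ` differ by a multiple of `‖Ŝ - S‖`, fractional ones by a power of it
  (`exists_norm_rpow_sub_le`), and `‖Ŝ - S‖` is of order `(m n)^(-1/2) ≤ l ^ r`.

The two ranges of `α` differ only in the bounds for the leverage and for `sup |f_l|`; both are
instances of `boundedInProb_of_source`.
-/

namespace FDA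

noncomputable section

/-! ### Functional calculus of a finite-rank operator -/

section FiniteCalculus

variable {E : Type*} [NormedAddCommGroup E] [InnerProductSpace ℝ E]
variable {ι : Type*} [Fintype ι] {v : ι → E} {s : ι → ℝ}

/-- The function `φ(A)` of the finite-rank operator `A = ∑ p, s p ⟪v p, ·⟫ v p`, where `v` is an
orthonormal family: it acts as `φ (s p)` on `v p` and as `φ 0` on the orthogonal complement. -/
def finCalc (v : ι → E) (s : ι → ℝ) (φ : ℝ → ℝ) : E →L[ℝ] E :=
  φ 0 • ContinuousLinearMap.id ℝ E +
    ∑ p, (φ (s p) - φ 0) • InnerProductSpace.rankOne ℝ (v p) (v p)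

lemma finCalc_apply (φ : ℝ → ℝ) (f : E) :
    finCalc v s φ f = φ 0 • f + ∑ p, ((φ (s p) - φ 0) * ⟪v p, f⟫_ℝ) • v p := by
  simp [finCalc, smul_smul]

lemma inner_finCalc (hv : Orthonormal ℝ v) (φ : ℝ → ℝ) (f : E) (p : ι) :
    ⟪v p, finCalc v s φ f⟫_ℝ = φ (s p) * ⟪v p, f⟫_ℝ := by
  rw [finCalc_apply, inner_add_right, inner_smul_right, hv.inner_right_fintype]
  ring

lemma inner_finCalc_left (φ : ℝ → ℝ) (f y : E) :
    ⟪finCalc v s φ f, y⟫_ℝ =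
      φ 0 * ⟪f, y⟫_ℝ + ∑ p, (φ (s p) - φ 0) * ⟪v p, f⟫_ℝ * ⟪v p, y⟫_ℝ := by
  simp [finCalc_apply, inner_add_left, sum_inner, inner_smul_left]

lemma finCalc_symm (φ : ℝ → ℝ) (f y : E) :
    ⟪finCalc v s φ f, y⟫_ℝ = ⟪f, finCalc v s φ y⟫_ℝ := by
  rw [inner_finCalc_left, real_inner_comm (finCalc v s φ y) f, inner_finCalc_left,
    real_inner_comm f y]
  congr 1
  exact Finset.sum_congr rfl fun p _ => by ring

lemma finCalc_finCalc (hv : Orthonormal ℝ v) (φ χ : ℝ → ℝ) (f : E) :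
    finCalc v s φ (finCalc v s χ f) = finCalc v s (fun x => φ x * χ x) f := by
  conv_lhs => rw [finCalc_apply]
  simp only [inner_finCalc hv]
  rw [finCalc_apply, finCalc_apply, smul_add, Finset.smul_sum, smul_smul, add_assoc,
    ← Finset.sum_add_distrib]
  congr 1
  refine Finset.sum_congr rfl fun p _ => ?_
  rw [smul_smul, ← add_smul]
  ring_nf

lemma finCalc_add (φ χ : ℝ → ℝ) (f : E) :
    finCalc v s (fun x => φ x + χ x) f = finCalc v s φ f + finCalc v s χ f := by
  simp only [finCalc_apply]
  rw [add_add_add_comm, ← add_smul, ← Finset.sum_add_distrib]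
  congr 1
  refine Finset.sum_congr rfl fun p _ => ?_
  rw [← add_smul]
  ring_nf

lemma finCalc_sub (φ χ : ℝ → ℝ) (f : E) :
    finCalc v s (fun x => φ x - χ x) f = finCalc v s φ f - finCalc v s χ f := by
  rw [eq_sub_iff_add_eq, ← finCalc_add]
  simp

lemma finCalc_const (c : ℝ) (f : E) : finCalc v s (fun _ => c) f = c • f := by
  simp [finCalc_apply]

lemma finCalc_id (f : E) : finCalc v s (fun x => x) f = ∑ p, (s p * ⟪v p, f⟫_ℝ) • v p := by
  simp [finCalc_apply]

lemma inner_finCalc_self_mono (hv : Orthonormal ℝ v) {φ χ : ℝ → ℝ} (h0 : φ 0 ≤ χ 0)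
    (h : ∀ p, φ (s p) ≤ χ (s p)) (f : E) :
    ⟪finCalc v s φ f, f⟫_ℝ ≤ ⟪finCalc v s χ f, f⟫_ℝ := by
  have key : ∀ φ : ℝ → ℝ, ⟪finCalc v s φ f, f⟫_ℝ =
      φ 0 * (‖f‖ ^ 2 - ∑ p, ⟪v p, f⟫_ℝ ^ 2) + ∑ p, φ (s p) * ⟪v p, f⟫_ℝ ^ 2 := by
    intro φ
    rw [inner_finCalc_left, real_inner_self_eq_norm_sq, mul_sub, Finset.mul_sum, sub_add,
      ← Finset.sum_sub_distrib, sub_eq_add_neg, ← Finset.sum_neg_distrib]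
    congr 1
    exact Finset.sum_congr rfl fun p _ => by ring
  rw [key, key]
  have hb : ∑ p, ⟪v p, f⟫_ℝ ^ 2 ≤ ‖f‖ ^ 2 := by
    simpa using hv.sum_inner_products_le (s := Finset.univ) f
  exact add_le_add (mul_le_mul_of_nonneg_right h0 (by linarith))
    (Finset.sum_le_sum fun p _ => mul_le_mul_of_nonneg_right (h p) (sq_nonneg _))

lemma norm_finCalc_sq (hv : Orthonormal ℝ v) (φ : ℝ → ℝ) (f : E) :
    ‖finCalc v s φ f‖ ^ 2 = ⟪finCalc v s (fun x => φ x ^ 2) f, f⟫_ℝ := by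
  rw [← real_inner_self_eq_norm_sq, ← finCalc_symm, finCalc_finCalc hv]
  simp only [sq]

lemma norm_finCalc_le (hv : Orthonormal ℝ v) {φ : ℝ → ℝ} {B : ℝ} (h0 : |φ 0| ≤ B)
    (h : ∀ p, |φ (s p)| ≤ B) (f : E) : ‖finCalc v s φ f‖ ≤ B * ‖f‖ := by
  have hB : 0 ≤ B := (abs_nonneg _).trans h0
  have hsq : ‖finCalc v s φ f‖ ^ 2 ≤ (B * ‖f‖) ^ 2 := by
    rw [norm_finCalc_sq hv]
    have h1 := inner_finCalc_self_mono hv (s := s) (φ := fun x => φ x ^ 2) (χ := fun _ => B ^ 2)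
      (sq_le_sq' (abs_le.1 h0).1 (abs_le.1 h0).2)
      (fun p => sq_le_sq' (abs_le.1 (h p)).1 (abs_le.1 (h p)).2) f
    rw [finCalc_const, inner_smul_left, real_inner_self_eq_norm_sq] at h1
    rw [mul_pow]
    exact h1
  exact (pow_le_pow_iff_left₀ (norm_nonneg _) (by positivity) two_ne_zero).1 hsq

lemma finCalc_eigenvector (hv : Orthonormal ℝ v) (φ : ℝ → ℝ) (p : ι) :
    finCalc v s φ (v p) = φ (s p) • v p := by
  classical
  rw [finCalc_apply, Finset.sum_eq_single p]
  · rw [← add_smul, real_inner_self_eq_norm_sq, hv.1]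
    congr 1
    ring
  · intro q _ hq
    rw [hv.2 hq]
    simp
  · simp

lemma finCalc_congr_of_mem_span (hv : Orthonormal ℝ v) {φ χ : ℝ → ℝ}
    (h : ∀ p, φ (s p) = χ (s p)) {f : E} (hf : f ∈ Submodule.span ℝ (Set.range v)) :
    finCalc v s φ f = finCalc v s χ f := by
  induction hf using Submodule.span_induction with
  | mem x hx =>
    obtain ⟨p, rfl⟩ := hx
    rw [finCalc_eigenvector hv, finCalc_eigenvector hv, h]
  | zero => simp
  | add x y _ _ hx hy => rw [map_add, map_add, hx, hy]
  | smul c x _ hx => rw [map_smul, map_smul, hx]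

/-- On the span of the eigenvectors the sum over spectral projections is the explicit
calculus, whatever value `φ` takes at `0`. -/
lemma specApply_eq_finCalc [CompleteSpace E] (hv : Orthonormal ℝ v) {A : E →L[ℝ] E}
    (hA : ∀ f, A f = ∑ p, (s p * ⟪v p, f⟫_ℝ) • v p) (φ : ℝ → ℝ) {f : E}
    (hf : f ∈ Submodule.span ℝ (Set.range v)) :
    specApply φ A f = finCalc v s φ f := by
  classical
  have hA' : ∀ f, A f = finCalc v s (fun x => x) f := fun f => by rw [hA, finCalc_id]
  have hAv : ∀ p, A (v p) = s p • v p := fun p => by rw [hA', finCalc_eigenvector hv]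
  have hproj : ∀ (σ : ℝ) (p : ι),
      (A - σ • ContinuousLinearMap.id ℝ E).ker.starProjection (v p) =
        if s p = σ then v p else 0 := by
    intro σ p
    split_ifs with h
    · rw [Submodule.starProjection_eq_self_iff]
      simp [LinearMap.mem_ker, hAv, h]
    · rw [Submodule.starProjection_apply_eq_zero_iff, Submodule.mem_orthogonal]
      intro u hu
      have hu' : A u = σ • u := by
        have := LinearMap.mem_ker.1 hu
        simpa [sub_eq_zero] using this
      have h1 : ⟪A u, v p⟫_ℝ = ⟪u, A (v p)⟫_ℝ := by rw [hA', hA', finCalc_symm]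
      rw [hu', hAv, inner_smul_left, inner_smul_right] at h1
      have h2 : (s p - σ) * ⟪u, v p⟫_ℝ = 0 := by
        simp only [RCLike.conj_to_real] at h1
        linarith
      exact (mul_eq_zero.1 h2).resolve_left (sub_ne_zero.2 h)
  have hfin : ∀ g ∈ Submodule.span ℝ (Set.range v), ∀ σ ∉ Finset.univ.image s,
      (A - σ • ContinuousLinearMap.id ℝ E).ker.starProjection g = 0 := by
    intro g hg σ hσ
    induction hg using Submodule.span_induction with
    | mem x hx =>
      obtain ⟨p, rfl⟩ := hx
      rw [hproj, if_neg]
      rintro rfl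
      exact hσ (by simp)
    | zero => simp
    | add x y _ _ hx hy => rw [map_add, hx, hy, add_zero]
    | smul c x _ hx => rw [map_smul, hx, smul_zero]
  have hsum : ∀ g ∈ Submodule.span ℝ (Set.range v), specApply φ A g =
      ∑ σ ∈ Finset.univ.image s,
        φ σ • (A - σ • ContinuousLinearMap.id ℝ E).ker.starProjection g := by
    intro g hg
    refine finsum_eq_sum_of_support_subset _ fun σ hσ => ?_
    by_contra hcon
    exact hσ (by simp only [hfin g hg σ (by simpa using hcon), smul_zero])
  rw [hsum f hf]
  clear hsum
  induction hf using Submodule.span_induction with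
  | mem x hx =>
    obtain ⟨p, rfl⟩ := hx
    rw [finCalc_eigenvector hv, Finset.sum_eq_single (s p)]
    · rw [hproj, if_pos rfl]
    · intro σ _ hσ
      rw [hproj, if_neg hσ.symm, smul_zero]
    · simp
  | zero => simp
  | add x y _ _ hx hy =>
    rw [map_add, ← hx, ← hy, ← Finset.sum_add_distrib]
    simp only [map_add, smul_add]
  | smul c x _ hx =>
    rw [map_smul, ← hx, Finset.smul_sum]
    simp only [map_smul, smul_comm c]

/-- Eigendecomposition of a weighted sample covariance operator `∑ p, w p (k p ⊗ k p)`. The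
eigenvalues are positive because the operator is injective on the span of the `k p`. -/
lemma exists_eigendecomposition {κ : Type*} [Fintype κ] (w : κ → ℝ) (hw : ∀ p, 0 < w p)
    (hw1 : ∑ p, w p = 1) (k : κ → E) {a : ℝ} (hk : ∀ p, ‖k p‖ ^ 2 ≤ a) {A : E →L[ℝ] E}
    (hA : ∀ f, A f = ∑ p, (w p * ⟪k p, f⟫_ℝ) • k p) :
    ∃ (d : ℕ) (v : Fin d → E) (s : Fin d → ℝ), Orthonormal ℝ v ∧
      (∀ p, s p ∈ Set.Ioc 0 a) ∧ (∀ f, A f = ∑ p, (s p * ⟪v p, f⟫_ℝ) • v p) ∧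
      ∀ p, k p ∈ Submodule.span ℝ (Set.range v) := by
  -- `A` maps into the finite-dimensional span `U` of the `k p` and is diagonalized there.
  set U := Submodule.span ℝ (Set.range k) with hU
  have hkU : ∀ p, k p ∈ U := fun p => Submodule.subset_span ⟨p, rfl⟩
  have : FiniteDimensional ℝ U := FiniteDimensional.span_of_finite ℝ (Set.finite_range k)
  have hAU : ∀ f, A f ∈ U := fun f => by
    rw [hA]
    exact Submodule.sum_mem _ fun p _ => Submodule.smul_mem _ _ (hkU p)
  have hAinner : ∀ f y, ⟪A f, y⟫_ℝ = ∑ p, w p * ⟪k p, f⟫_ℝ * ⟪k p, y⟫_ℝ := fun f y => by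
    simp [hA, sum_inner, inner_smul_left]
  have hAsymm : ∀ f y, ⟪A f, y⟫_ℝ = ⟪f, A y⟫_ℝ := fun f y => by
    rw [hAinner, real_inner_comm, hAinner]
    exact Finset.sum_congr rfl fun p _ => by ring
  let T : U →ₗ[ℝ] U := (A : E →ₗ[ℝ] E).restrict fun f _ => hAU f
  have hT : T.IsSymmetric := fun x y => by
    simpa [T, LinearMap.restrict_apply] using hAsymm x y
  let b := hT.eigenvectorBasis rfl
  let s := hT.eigenvalues rfl
  have hbs : ∀ i, A (b i : E) = s i • (b i : E) := fun i => by
    have := congrArg Subtype.val (hT.apply_eigenvectorBasis rfl i)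
    simpa [T, LinearMap.restrict_apply] using this
  have hb1 : Orthonormal ℝ fun i => (b i : E) :=
    b.orthonormal.comp_linearIsometry U.subtypeₗᵢ
  have hs : ∀ i, s i = ∑ p, w p * ⟪k p, (b i : E)⟫_ℝ ^ 2 := fun i => by
    have h1 := hAinner (b i) (b i)
    rw [hbs, inner_smul_left, real_inner_self_eq_norm_sq, hb1.1 i] at h1
    simp only [RCLike.conj_to_real, one_pow, mul_one] at h1
    rw [h1]
    exact Finset.sum_congr rfl fun p _ => by ring
  have hbU : ∀ u ∈ U, u = ∑ i, ⟪(b i : E), u⟫_ℝ • (b i : E) := fun u hu => by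
    have := congrArg Subtype.val (b.sum_repr' ⟨u, hu⟩)
    simpa using this.symm
  refine ⟨_, fun i => (b i : E), s, hb1, fun i => ⟨?_, ?_⟩, fun f => ?_, fun p => ?_⟩
  · have h0 : 0 ≤ s i := by
      rw [hs]
      exact Finset.sum_nonneg fun p _ => mul_nonneg (hw p).le (sq_nonneg _)
    refine h0.lt_of_ne fun h => ?_
    have h1 : ∀ p, ⟪k p, (b i : E)⟫_ℝ = 0 := by
      rw [hs, eq_comm, Finset.sum_eq_zero_iff_of_nonneg
        fun p _ => mul_nonneg (hw p).le (sq_nonneg _)] at h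
      intro p
      have := (mul_eq_zero.1 (h p (Finset.mem_univ p))).resolve_left (hw p).ne'
      exact pow_eq_zero_iff two_ne_zero |>.1 this
    have h2 : ∀ u ∈ U, ⟪u, (b i : E)⟫_ℝ = 0 := by
      intro u hu
      induction hu using Submodule.span_induction with
      | mem x hx => obtain ⟨p, rfl⟩ := hx; exact h1 p
      | zero => simp
      | add x y _ _ hx hy => rw [inner_add_left, hx, hy, add_zero]
      | smul c x _ hx => rw [inner_smul_left, hx, mul_zero]
    have h3 := h2 (b i) (b i).2
    rw [real_inner_self_eq_norm_sq, hb1.1 i] at h3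
    norm_num at h3
  · rw [hs]
    calc _ ≤ ∑ p, w p * a := Finset.sum_le_sum fun p _ => by
          refine mul_le_mul_of_nonneg_left ?_ (hw p).le
          refine le_trans ?_ (hk p)
          have := abs_real_inner_le_norm (k p) (b i : E)
          rw [hb1.1 i, mul_one] at this
          exact sq_le_sq' (abs_le.1 this).1 (abs_le.1 this).2
      _ = a := by rw [← Finset.sum_mul, hw1, one_mul]
  · rw [hbU (A f) (hAU f)]
    refine Finset.sum_congr rfl fun i _ => ?_
    rw [real_inner_comm, hAsymm, hbs, inner_smul_right, real_inner_comm]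
  · rw [hbU (k p) (hkU p)]
    exact Submodule.sum_mem _ fun i _ => Submodule.smul_mem _ _ (Submodule.subset_span ⟨i, rfl⟩)

end FiniteCalculus

/-! ### Perturbation estimates in the energy norm -/

section Perturbation

variable {E : Type*} [NormedAddCommGroup E] [InnerProductSpace ℝ E]

lemma norm_finCalc_sqrt_sq {d : ℕ} {v : Fin d → E} {s : Fin d → ℝ} (hv : Orthonormal ℝ v)
    (hs : ∀ p, 0 ≤ s p) {A : E →L[ℝ] E} (hA : ∀ f, A f = ∑ p, (s p * ⟪v p, f⟫_ℝ) • v p)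
    {l : ℝ} (hl : 0 ≤ l) (f : E) :
    ‖finCalc v s (fun x => √(x + l)) f‖ ^ 2 = ⟪A f, f⟫_ℝ + l * ‖f‖ ^ 2 := by
  have h1 : ⟪A f, f⟫_ℝ + l * ‖f‖ ^ 2 = ⟪finCalc v s (fun x => x + l) f, f⟫_ℝ := by
    rw [finCalc_add (fun x => x) (fun _ => l), finCalc_id, ← hA, finCalc_const, inner_add_left,
      inner_smul_left, real_inner_self_eq_norm_sq]
    rfl
  rw [h1, norm_finCalc_sq hv]
  refine le_antisymm (inner_finCalc_self_mono hv ?_ (fun p => ?_) f)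
    (inner_finCalc_self_mono hv ?_ (fun p => ?_) f)
  · simp [Real.sq_sqrt hl]
  · simp [Real.sq_sqrt (add_nonneg (hs p) hl)]
  · simp [Real.sq_sqrt hl]
  · simp [Real.sq_sqrt (add_nonneg (hs p) hl)]

/-- Duality estimate: a vector that is bounded, as a functional, by the energy norm
`√(⟪A f, f⟫ + l ‖f‖²)` is mapped by `φ(A)` to a vector of energy norm at most `M B` when
`(x + l) |φ x| ≤ B`. Applied with a bound by the energy of
another operator `S`, it does the work of a bound for `(A + l)^(-1/2) (S + l)^(1/2)` without any
square root of `S`. -/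
lemma norm_finCalc_sqrt_mul_le {d : ℕ} {v : Fin d → E} {s : Fin d → ℝ} (hv : Orthonormal ℝ v)
    (hs : ∀ p, 0 ≤ s p) {A : E →L[ℝ] E} (hA : ∀ f, A f = ∑ p, (s p * ⟪v p, f⟫_ℝ) • v p)
    {l M B : ℝ} (hl : 0 < l) (hM : 0 ≤ M) (hB : 0 ≤ B) {w : E}
    (hw : ∀ f, ⟪w, f⟫_ℝ ^ 2 ≤ M ^ 2 * (⟪A f, f⟫_ℝ + l * ‖f‖ ^ 2)) {φ : ℝ → ℝ}
    (h0 : l * |φ 0| ≤ B) (hφ : ∀ p, (s p + l) * |φ (s p)| ≤ B) :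
    ‖finCalc v s (fun x => √(x + l) * φ x) w‖ ≤ M * B := by
  set T : ℝ → ℝ := fun x => √(x + l)
  -- The squared norm `Z` is the functional `⟪w, ·⟫` evaluated at `z`, whose energy is at most
  -- `B² Z`.
  set Z := ‖finCalc v s (fun x => √(x + l) * φ x) w‖ ^ 2 with hZ
  set z := finCalc v s (fun x => (√(x + l) * φ x) ^ 2) w with hz
  have hZz : Z = ⟪w, z⟫_ℝ := by rw [hZ, norm_finCalc_sq hv, real_inner_comm]
  have h1 : Z ^ 2 ≤ M ^ 2 * ‖finCalc v s T z‖ ^ 2 := by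
    rw [norm_finCalc_sqrt_sq hv hs hA hl.le, hZz]
    exact hw z
  have h2 : ‖finCalc v s T z‖ ^ 2 ≤ B ^ 2 * Z := by
    have h3 : finCalc v s T z =
        finCalc v s (fun x => (x + l) * φ x) (finCalc v s (fun x => √(x + l) * φ x) w) := by
      rw [hz, finCalc_finCalc hv, finCalc_finCalc hv]
      have key : ∀ x, 0 ≤ x → √(x + l) * (√(x + l) * φ x) ^ 2
          = (x + l) * φ x * (√(x + l) * φ x) := by
        intro x hx
        have := Real.mul_self_sqrt (add_nonneg hx hl.le)
        linear_combination √(x + l) * φ x ^ 2 * this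
      rw [finCalc_apply, finCalc_apply]
      simp only [T]
      rw [key 0 le_rfl]
      simp only [key _ (hs _)]
    rw [h3, hZ, ← mul_pow]
    refine pow_le_pow_left₀ (norm_nonneg _) (norm_finCalc_le hv ?_ (fun p => ?_) _) 2
    · rw [zero_add, abs_mul, abs_of_pos hl]
      exact h0
    · rw [abs_mul, abs_of_nonneg (add_nonneg (hs p) hl.le)]
      exact hφ p
  have h4 : Z ^ 2 ≤ (M * B) ^ 2 * Z := by
    calc _ ≤ _ := h1
      _ ≤ M ^ 2 * (B ^ 2 * Z) := by gcongr
      _ = _ := by ring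
  have hZ0 : 0 ≤ Z := sq_nonneg _
  have h5 : Z ≤ (M * B) ^ 2 := by
    rcases hZ0.eq_or_lt with h | h
    · rw [← h]; positivity
    · rw [sq] at h4
      exact le_of_mul_le_mul_right h4 h
  exact (pow_le_pow_iff_left₀ (norm_nonneg _) (by positivity) two_ne_zero).1 h5

lemma norm_sum_smul_sq {e : ℕ → E} (he : Orthonormal ℝ e) (F : Finset ℕ) (c : ℕ → ℝ) :
    ‖∑ i ∈ F, c i • e i‖ ^ 2 = ∑ i ∈ F, c i ^ 2 := by
  rw [← real_inner_self_eq_norm_sq, he.inner_sum]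
  exact Finset.sum_congr rfl fun i _ => by simp [sq]

lemma norm_sum_smul_le {e : ℕ → E} (he : Orthonormal ℝ e) (F : Finset ℕ) {c c' : ℕ → ℝ}
    {B : ℝ} (hB : 0 ≤ B) (h : ∀ i, |c i| ≤ B * |c' i|) :
    ‖∑ i ∈ F, c i • e i‖ ≤ B * ‖∑ i ∈ F, c' i • e i‖ := by
  refine (pow_le_pow_iff_left₀ (norm_nonneg _) (by positivity) two_ne_zero).1 ?_
  rw [mul_pow, norm_sum_smul_sq he, norm_sum_smul_sq he, Finset.mul_sum]
  refine Finset.sum_le_sum fun i _ => ?_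
  rw [← sq_abs (c i), ← sq_abs (c' i), ← mul_pow]
  exact pow_le_pow_left₀ (abs_nonneg _) (h i) 2

/-- Resolvent identity: `(A + t)⁻¹ u - (S + t)⁻¹ u = (A + t)⁻¹ (S - A) (S + t)⁻¹ u`. -/
lemma norm_resolvent_sub_le {d : ℕ} {v : Fin d → E} {s : Fin d → ℝ} (hv : Orthonormal ℝ v)
    (hs : ∀ p, 0 ≤ s p) {A S : E →L[ℝ] E} (hA : ∀ f, A f = ∑ p, (s p * ⟪v p, f⟫_ℝ) • v p)
    {e : ℕ → E} (he : Orthonormal ℝ e) {σ : ℕ → ℝ} (hσ : ∀ i, 0 ≤ σ i)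
    (hS : ∀ i, S (e i) = σ i • e i) {δ : ℝ} (hδ : ‖A - S‖ ≤ δ) (F : Finset ℕ) (h : ℕ → ℝ)
    {t : ℝ} (ht : 0 < t) :
    ‖finCalc v s (fun x => (t + x)⁻¹) (∑ i ∈ F, h i • e i)
        - ∑ i ∈ F, ((t + σ i)⁻¹ * h i) • e i‖ ≤
      δ / t ^ 2 * ‖∑ i ∈ F, h i • e i‖ := by
  have hδ0 : 0 ≤ δ := (norm_nonneg _).trans hδ
  set u := ∑ i ∈ F, h i • e i with hu
  set y := ∑ i ∈ F, ((t + σ i)⁻¹ * h i) • e i with hy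
  have h1 : S y + t • y = u := by
    rw [hy, map_sum, Finset.smul_sum, ← Finset.sum_add_distrib]
    refine Finset.sum_congr rfl fun i _ => ?_
    rw [map_smul, hS, smul_smul, smul_smul, ← add_smul]
    congr 1
    have : t + σ i ≠ 0 := (add_pos_of_pos_of_nonneg ht (hσ i)).ne'
    field_simp
    ring
  have h2 : finCalc v s (fun x => (t + x)⁻¹) (A y + t • y) = y := by
    have : A y + t • y = finCalc v s (fun x => x + t) y := by
      rw [finCalc_add (fun x => x) (fun _ => t), finCalc_id, ← hA, finCalc_const]
    rw [this, finCalc_finCalc hv]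
    have key : ∀ x, 0 ≤ x → (t + x)⁻¹ * (x + t) = 1 := fun x hx => by
      rw [add_comm x]; exact inv_mul_cancel₀ (add_pos_of_pos_of_nonneg ht hx).ne'
    rw [finCalc_apply]
    simp only [key _ (hs _), key 0 le_rfl]
    simp
  have h3 : finCalc v s (fun x => (t + x)⁻¹) u - y =
      finCalc v s (fun x => (t + x)⁻¹) (-((A - S) y)) := by
    calc _ = finCalc v s (fun x => (t + x)⁻¹) u
          - finCalc v s (fun x => (t + x)⁻¹) (A y + t • y) := by rw [h2]
      _ = _ := by
        rw [← map_sub, ← h1]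
        congr 1
        simp
  have hinv : ∀ x, 0 ≤ x → |(t + x)⁻¹| ≤ t⁻¹ := fun x hx => by
    rw [abs_of_nonneg (by positivity)]
    gcongr
    linarith
  have hy1 : ‖y‖ ≤ t⁻¹ * ‖u‖ := norm_sum_smul_le he F (by positivity) fun i => by
    rw [abs_mul]
    gcongr
    exact hinv _ (hσ i)
  rw [h3]
  calc _ ≤ t⁻¹ * ‖-((A - S) y)‖ :=
        norm_finCalc_le (φ := fun x => (t + x)⁻¹) hv (hinv 0 le_rfl) (fun p => hinv _ (hs p)) _
    _ ≤ t⁻¹ * (δ * (t⁻¹ * ‖u‖)) := by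
        rw [norm_neg]
        gcongr
        exact ((A - S).le_opNorm y).trans (by gcongr)
    _ = _ := by field_simp

/-- The envelope of the resolvent difference integrates to a multiple of `δ ^ p`. -/
lemma integral_min_rpow_le {p : ℝ} (hp : p ∈ Set.Ioo (0 : ℝ) 1) {δ : ℝ} (hδ : 0 < δ)
    {D : ℝ → ℝ} (h1 : ∀ t, 0 < t → |D t| ≤ 2 * t ^ (p - 1))
    (h2 : ∀ t, 0 < t → |D t| ≤ δ * t ^ (p - 2)) :
    |∫ t in Set.Ioi 0, D t| ≤ (2 / p + 1 / (1 - p)) * δ ^ p := by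
  have hp1 : 0 < 1 - p := by linarith [hp.2]
  -- The two bounds cross at `t ≈ δ`, so the envelope switches there.
  set G : ℝ → ℝ := (Set.Ioc 0 δ).indicator (fun t => 2 * t ^ (p - 1)) +
    (Set.Ioi δ).indicator (fun t => δ * t ^ (p - 2))
  have i1 : IntegrableOn (fun t : ℝ => 2 * t ^ (p - 1)) (Set.Ioc 0 δ) := by
    have := (intervalIntegral.intervalIntegrable_rpow' (a := 0) (b := δ) (r := p - 1)
      (by linarith [hp.1])).const_mul 2
    rwa [intervalIntegrable_iff_integrableOn_Ioc_of_le hδ.le] at this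
  have i2 : IntegrableOn (fun t : ℝ => δ * t ^ (p - 2)) (Set.Ioi δ) :=
    (integrableOn_Ioi_rpow_of_lt (by linarith) hδ).const_mul δ
  have iG1 : Integrable ((Set.Ioc 0 δ).indicator fun t : ℝ => 2 * t ^ (p - 1))
      (volume.restrict (Set.Ioi 0)) :=
    ((integrable_indicator_iff measurableSet_Ioc).2 i1).restrict
  have iG2 : Integrable ((Set.Ioi δ).indicator fun t : ℝ => δ * t ^ (p - 2))
      (volume.restrict (Set.Ioi 0)) :=
    ((integrable_indicator_iff measurableSet_Ioi).2 i2).restrict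
  have hle : ∀ᵐ t ∂(volume.restrict (Set.Ioi (0 : ℝ))), ‖D t‖ ≤ G t := by
    refine (ae_restrict_iff' measurableSet_Ioi).2 (ae_of_all _ fun t ht => ?_)
    have ht' : 0 < t := ht
    rcases le_or_gt t δ with h | h
    · have : G t = 2 * t ^ (p - 1) := by
        simp [G, Set.indicator, ht', h]
      rw [this]; exact h1 t ht'
    · have : G t = δ * t ^ (p - 2) := by
        simp [G, Set.indicator, h]
      rw [this]; exact h2 t ht'
  have hG : ∫ t in Set.Ioi 0, G t = (2 / p + 1 / (1 - p)) * δ ^ p := by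
    rw [integral_add' iG1 iG2, setIntegral_indicator measurableSet_Ioc,
      setIntegral_indicator measurableSet_Ioi,
      Set.inter_eq_right.2 Set.Ioc_subset_Ioi_self,
      Set.inter_eq_right.2 (Set.Ioi_subset_Ioi hδ.le), integral_const_mul, integral_const_mul,
      integral_Ioi_rpow_of_lt (by linarith) hδ, ← intervalIntegral.integral_of_le hδ.le,
      integral_rpow (Or.inl (by linarith [hp.1]))]
    have e1 : p - 1 + 1 = p := by ring
    have e2 : p - 2 + 1 = p - 1 := by ring
    rw [e1, e2, Real.zero_rpow hp.1.ne', Real.rpow_sub_one hδ.ne']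
    have : p - 1 ≠ 0 := by linarith
    have := hp.1.ne'
    have := hp1.ne'
    field_simp
    ring
  rw [← hG]
  exact norm_integral_le_of_norm_le (iG1.add iG2) hle

/-- Hölder continuity of fractional powers in operator norm, `‖A ^ p - S ^ p‖ ≲ ‖A - S‖ ^ p`
(on finite combinations of eigenvectors of `S`), from the integral representation of `x ^ p`
by resolvents. -/
lemma exists_norm_rpow_sub_le {p : ℝ} (hp : p ∈ Set.Ico (0 : ℝ) 1) :
    ∃ C : ℝ, 0 ≤ C ∧ ∀ {d : ℕ} {v : Fin d → E} {s : Fin d → ℝ}, Orthonormal ℝ v →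
      (∀ p, 0 ≤ s p) → ∀ {A S : E →L[ℝ] E}, (∀ f, A f = ∑ p, (s p * ⟪v p, f⟫_ℝ) • v p) →
      ∀ {e : ℕ → E}, Orthonormal ℝ e → ∀ {σ : ℕ → ℝ}, (∀ i, 0 ≤ σ i) →
      (∀ i, S (e i) = σ i • e i) → ∀ {δ : ℝ}, 0 < δ → ‖A - S‖ ≤ δ →
      ∀ (F : Finset ℕ) (h : ℕ → ℝ),
      ‖finCalc v s (fun x => x ^ p) (∑ i ∈ F, h i • e i) - ∑ i ∈ F, (σ i ^ p * h i) • e i‖ ≤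
        C * δ ^ p * ‖∑ i ∈ F, h i • e i‖ := by
  rcases hp.1.eq_or_lt with rfl | hp0
  · refine ⟨0, le_rfl, ?_⟩
    intro d v s hv hs A S hA e he σ hσ hS δ hδ hAS F h
    simp [finCalc_const]
  have hp' : p ∈ Set.Ioo (0 : ℝ) 1 := ⟨hp0, hp.2⟩
  set c := ∫ t in Set.Ioi 0, Real.rpowIntegrand₀₁ p t 1 with hc
  have hc0 : 0 < c := Real.integral_rpowIntegrand₀₁_one_pos hp'
  have hp1 : 0 < 1 - p := by linarith [hp.2]
  refine ⟨(2 / p + 1 / (1 - p)) / c, by positivity, ?_⟩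
  intro d v s hv hs A S hA e he σ hσ hS δ hδ hAS F h
  set u := ∑ i ∈ F, h i • e i with hu
  -- the difference of the two sides for a general function `φ`, tested against `z`
  set Δ : (ℝ → ℝ) → E := fun φ => finCalc v s φ u - ∑ i ∈ F, (φ (σ i) * h i) • e i with hΔ
  have hinner : ∀ (φ : ℝ → ℝ) (z : E), ⟪Δ φ, z⟫_ℝ = φ 0 * ⟪u, z⟫_ℝ
      + ∑ p, (φ (s p) - φ 0) * (⟪v p, u⟫_ℝ * ⟪v p, z⟫_ℝ)
      - ∑ i ∈ F, φ (σ i) * (h i * ⟪e i, z⟫_ℝ) := by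
    intro φ z
    simp only [hΔ]
    rw [inner_sub_left, inner_finCalc_left, sum_inner F (fun i => (φ (σ i) * h i) • e i)]
    simp only [inner_smul_left, RCLike.conj_to_real, mul_assoc]
  set z := Δ fun x => x ^ p with hz
  set r : ℝ → ℝ → ℝ := fun t x => Real.rpowIntegrand₀₁ p t x with hr
  have hrint : ∀ x, 0 ≤ x → Integrable (fun t => r t x) (volume.restrict (Set.Ioi 0)) :=
    fun x hx => Real.integrableOn_rpowIntegrand₀₁_Ioi hp' hx
  have hrval : ∀ x, 0 ≤ x → ∫ t in Set.Ioi 0, r t x = x ^ p * c := fun x hx =>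
    Real.integral_rpowIntegrand₀₁_eq_rpow_mul_const hp' hx
  have hint : ∫ t in Set.Ioi 0, ⟪Δ (r t), z⟫_ℝ = c * ⟪z, z⟫_ℝ := by
    simp only [hinner]
    rw [integral_sub, integral_add, integral_mul_const, integral_finsetSum, integral_finsetSum,
      hrval 0 le_rfl]
    · simp only [integral_mul_const]
      rw [hz, hinner, mul_sub, mul_add, Finset.mul_sum, Finset.mul_sum]
      congr 1
      · congr 1
        · ring
        · refine Finset.sum_congr rfl fun q _ => ?_
          rw [integral_sub (hrint _ (hs q)) (hrint _ le_rfl), hrval _ (hs q), hrval _ le_rfl]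
          ring
      · refine Finset.sum_congr rfl fun i _ => ?_
        rw [hrval _ (hσ i)]
        ring
    · exact fun i _ => (hrint _ (hσ i)).mul_const _
    · exact fun q _ => ((hrint _ (hs q)).sub (hrint _ le_rfl)).mul_const _
    · exact (hrint _ le_rfl).mul_const _
    · exact integrable_finsetSum _ fun q _ =>
        ((hrint _ (hs q)).sub (hrint _ le_rfl)).mul_const _
    · exact ((hrint _ le_rfl).mul_const _).add (integrable_finsetSum _ fun q _ =>
        ((hrint _ (hs q)).sub (hrint _ le_rfl)).mul_const _)
    · exact integrable_finsetSum _ fun i _ => (hrint _ (hσ i)).mul_const _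
  have hres : ∀ t, 0 < t → Δ (r t) = -(t ^ p) • (finCalc v s (fun x => (t + x)⁻¹) u
      - ∑ i ∈ F, ((t + σ i)⁻¹ * h i) • e i) := by
    intro t ht
    have e1 : finCalc v s (r t) u =
        t ^ p • (t⁻¹ • u - finCalc v s (fun x => (t + x)⁻¹) u) := by
      have : r t = fun x => (fun _ => t ^ p) x * ((fun _ => t⁻¹) x - (fun x => (t + x)⁻¹) x) := rfl
      rw [this, ← finCalc_finCalc hv, finCalc_const, finCalc_sub, finCalc_const]
    have e2 : ∑ i ∈ F, (r t (σ i) * h i) • e i =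
        t ^ p • (t⁻¹ • u - ∑ i ∈ F, ((t + σ i)⁻¹ * h i) • e i) := by
      rw [hu, Finset.smul_sum, ← Finset.sum_sub_distrib, Finset.smul_sum]
      refine Finset.sum_congr rfl fun i _ => ?_
      rw [smul_smul, ← sub_smul, smul_smul, hr]
      congr 1
      simp only [Real.rpowIntegrand₀₁]
      ring
    rw [hΔ]
    simp only
    rw [e1, e2, ← smul_sub, neg_smul, ← smul_neg]
    congr 1
    abel
  have hinv : ∀ t : ℝ, 0 < t → ∀ x : ℝ, 0 ≤ x → |(t + x)⁻¹| ≤ t⁻¹ := fun t ht x hx => by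
    rw [abs_of_nonneg (by positivity)]
    gcongr
    linarith
  rcases eq_or_ne u 0 with hu0 | hu0
  · have := norm_sum_smul_sq he F h
    rw [← hu, hu0, norm_zero, zero_pow two_ne_zero, eq_comm,
      Finset.sum_eq_zero_iff_of_nonneg fun i _ => sq_nonneg _] at this
    have h0 : ∀ i ∈ F, h i = 0 := fun i hi => pow_eq_zero_iff two_ne_zero |>.1 (this i hi)
    rw [hu0, Finset.sum_eq_zero fun i hi => by rw [h0 i hi]; simp]
    simp
  have hupos : 0 < ‖u‖ := norm_pos_iff.2 hu0
  rcases eq_or_ne z 0 with hz0 | hz0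
  · rw [hz] at hz0
    simp only [hΔ] at hz0
    rw [hz0, norm_zero]
    positivity
  have hzpos : 0 < ‖z‖ := norm_pos_iff.2 hz0
  have hkey := integral_min_rpow_le hp' hδ (D := fun t => ⟪Δ (r t), z⟫_ℝ / (‖u‖ * ‖z‖)) ?_ ?_
  · rw [integral_div, hint, real_inner_self_eq_norm_sq, abs_of_nonneg (by positivity),
      div_le_iff₀ (by positivity)] at hkey
    have h5 : c * ‖z‖ ≤ (2 / p + 1 / (1 - p)) * δ ^ p * ‖u‖ := by
      refine le_of_mul_le_mul_right ?_ hzpos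
      calc _ = c * ‖z‖ ^ 2 := by ring
        _ ≤ _ := hkey
        _ = _ := by ring
    change ‖z‖ ≤ _
    calc ‖z‖ = c * ‖z‖ / c := by field_simp
      _ ≤ (2 / p + 1 / (1 - p)) * δ ^ p * ‖u‖ / c := by gcongr
      _ = _ := by ring
  · intro t ht
    rw [abs_div, abs_of_pos (mul_pos hupos hzpos), div_le_iff₀ (by positivity)]
    refine (abs_real_inner_le_norm _ _).trans ?_
    rw [← mul_assoc]
    gcongr
    rw [hres t ht, norm_smul, norm_neg, Real.norm_of_nonneg (by positivity),
      Real.rpow_sub_one ht.ne']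
    have b1 := norm_finCalc_le hv (φ := fun x => (t + x)⁻¹) (hinv t ht 0 le_rfl)
      (fun q => hinv t ht _ (hs q)) u
    have b2 : ‖∑ i ∈ F, ((t + σ i)⁻¹ * h i) • e i‖ ≤ t⁻¹ * ‖u‖ :=
      norm_sum_smul_le he F (by positivity) fun i => by
        rw [abs_mul]
        gcongr
        exact hinv t ht _ (hσ i)
    calc _ ≤ t ^ p * (t⁻¹ * ‖u‖ + t⁻¹ * ‖u‖) := by
          gcongr
          exact (norm_sub_le _ _).trans (add_le_add b1 b2)
      _ = _ := by ring
  · intro t ht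
    rw [abs_div, abs_of_pos (mul_pos hupos hzpos), div_le_iff₀ (by positivity)]
    refine (abs_real_inner_le_norm _ _).trans ?_
    rw [← mul_assoc]
    gcongr
    rw [hres t ht, norm_smul, norm_neg, Real.norm_of_nonneg (by positivity)]
    calc _ ≤ t ^ p * (δ / t ^ 2 * ‖u‖) := by
          gcongr
          exact norm_resolvent_sub_le hv hs hA he hσ hS hAS F h ht
      _ = _ := by
          rw [Real.rpow_sub ht, Real.rpow_two]
          ring

/-- Residual of a smooth target: if the target is `S ^ (k + θ) u` with `k` an integer and
`θ ∈ [0, 1)`, then replacing `S ^ k` and `S ^ θ` by the same powers of `A` costs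
`√l δ` and `l ^ (k + 1/2) δ ^ θ`, and the remaining term is controlled by the qualification. -/
lemma exists_norm_residual_le {a : ℝ} (ha : 0 < a) (k : ℕ) {θ : ℝ} (hθ : θ ∈ Set.Ico (0 : ℝ) 1)
    {B : ℝ} (hB : 0 ≤ B) :
    ∃ C : ℝ, 0 ≤ C ∧ ∀ {d : ℕ} {v : Fin d → E} {s : Fin d → ℝ}, Orthonormal ℝ v →
      (∀ p, s p ∈ Set.Ioc 0 a) → ∀ {A S : E →L[ℝ] E},
      (∀ f, A f = ∑ p, (s p * ⟪v p, f⟫_ℝ) • v p) → ‖S‖ ≤ a →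
      ∀ {e : ℕ → E}, Orthonormal ℝ e → ∀ {σ : ℕ → ℝ}, (∀ i, 0 ≤ σ i) → (∀ i, σ i ≤ a) →
      (∀ i, S (e i) = σ i • e i) → ∀ {δ : ℝ}, 0 < δ → ‖A - S‖ ≤ δ →
      ∀ {l : ℝ}, 0 ≤ l → ∀ {ρ : ℝ → ℝ},
      (∀ p : ℝ, (p = 0 ∨ p = k ∨ p = k + θ) → ∀ x ∈ Set.Icc 0 a,
        √(x + l) * |ρ x| * x ^ p ≤ B * l ^ (p + 1 / 2)) →
      ∀ (F : Finset ℕ) (h : ℕ → ℝ),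
      ‖finCalc v s (fun x => √(x + l) * ρ x) (∑ i ∈ F, (σ i ^ ((k : ℝ) + θ) * h i) • e i)‖ ≤
        C * (l ^ ((1 : ℝ) / 2) * δ + l ^ ((k : ℝ) + 1 / 2) * δ ^ θ + l ^ ((k : ℝ) + θ + 1 / 2)) *
          ‖∑ i ∈ F, h i • e i‖ := by
  obtain ⟨C₁, hC₁, hold⟩ := exists_norm_rpow_sub_le (E := E) hθ
  have hpow : ∃ C₂ : ℝ, 0 ≤ C₂ ∧ ∀ A S : E →L[ℝ] E, ‖A‖ ≤ a → ‖S‖ ≤ a →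
      ‖A ^ k - S ^ k‖ ≤ C₂ * ‖A - S‖ := by
    clear hold
    induction k with
    | zero => exact ⟨0, le_rfl, fun A S _ _ => by simp⟩
    | succ k ih =>
      obtain ⟨C, hC, ih⟩ := ih
      refine ⟨a ^ k + C * a, by positivity, fun A S hA hS => ?_⟩
      have e1 : A ^ (k + 1) - S ^ (k + 1) = A ^ k * (A - S) + (A ^ k - S ^ k) * S := by
        rw [pow_succ, pow_succ, mul_sub, sub_mul]
        abel
      have hAk : ‖A ^ k‖ ≤ a ^ k := by
        rcases Nat.eq_zero_or_pos k with rfl | hk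
        · exact (ContinuousLinearMap.norm_id_le (𝕜 := ℝ) (E := E)).trans (pow_zero a).ge
        · exact (norm_pow_le' A hk).trans (pow_le_pow_left₀ (norm_nonneg _) hA k)
      rw [e1]
      calc _ ≤ ‖A ^ k‖ * ‖A - S‖ + ‖A ^ k - S ^ k‖ * ‖S‖ :=
            (norm_add_le _ _).trans (add_le_add (norm_mul_le _ _) (norm_mul_le _ _))
        _ ≤ a ^ k * ‖A - S‖ + C * ‖A - S‖ * a := by
            gcongr
            exact ih A S hA hS
        _ = _ := by ring
  obtain ⟨C₂, hC₂, hpow⟩ := hpow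
  refine ⟨B * (C₂ * a ^ θ + C₁ + 1), by have := hθ.1; positivity, ?_⟩
  intro d v s hv hs A S hA hSa e he σ hσ hσa hS δ hδ hAS l hl ρ hρ F h
  have hs0 : ∀ p, 0 ≤ s p := fun p => (hs p).1.le
  have hsI : ∀ p, s p ∈ Set.Icc 0 a := fun p => ⟨(hs p).1.le, (hs p).2⟩
  have hAc : ∀ f, A f = finCalc v s (fun x => x) f := fun f => by rw [hA, finCalc_id]
  have hAk : ∀ (j : ℕ) f, (A ^ j) f = finCalc v s (fun x => x ^ j) f := by
    intro j
    induction j with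
    | zero => intro f; simp [finCalc_const]
    | succ j ih =>
      intro f
      rw [pow_succ, mul_apply_eq_comp, ih, hAc, finCalc_finCalc hv]
      rfl
  have hAa : ‖A‖ ≤ a := ContinuousLinearMap.opNorm_le_bound _ ha.le fun f => by
    rw [hAc]
    exact norm_finCalc_le hv (by simpa using ha.le)
      (fun p => by rw [abs_of_nonneg (hs0 p)]; exact (hs p).2) f
  have hSk : ∀ (j : ℕ) i, (S ^ j) (e i) = σ i ^ j • e i := by
    intro j
    induction j with
    | zero => intro i; simp
    | succ j ih =>
      intro i
      rw [pow_succ, mul_apply_eq_comp, hS, map_smul, ih, smul_smul, pow_succ, mul_comm]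
  set u := ∑ i ∈ F, h i • e i with hu
  set uθ := ∑ i ∈ F, (σ i ^ θ * h i) • e i with huθ
  set f := ∑ i ∈ F, (σ i ^ ((k : ℝ) + θ) * h i) • e i with hf
  have hfS : f = (S ^ k) uθ := by
    rw [huθ, map_sum]
    refine Finset.sum_congr rfl fun i _ => ?_
    rw [map_smul, hSk, smul_smul, Real.rpow_add_of_nonneg (hσ i) (Nat.cast_nonneg k) hθ.1,
      Real.rpow_natCast]
    congr 1
    ring
  have huθn : ‖uθ‖ ≤ a ^ θ * ‖u‖ := norm_sum_smul_le he F (by positivity) fun i => by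
    rw [abs_mul, abs_of_nonneg (Real.rpow_nonneg (hσ i) θ)]
    gcongr
    · exact hσ i
    · exact hθ.1
    · exact hσa i
  have hdec : f = ((S ^ k) uθ - (A ^ k) uθ)
      + ((A ^ k) (uθ - finCalc v s (fun x => x ^ θ) u)
        + (A ^ k) (finCalc v s (fun x => x ^ θ) u)) := by
    rw [hfS, ← map_add]
    simp
  set T : E →L[ℝ] E := finCalc v s (fun x => √(x + l) * ρ x) with hT
  have b1 : ‖T ((S ^ k) uθ - (A ^ k) uθ)‖ ≤ B * l ^ ((1 : ℝ) / 2) * (C₂ * δ * (a ^ θ * ‖u‖)) := by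
    have hb : ∀ x ∈ Set.Icc 0 a, |√(x + l) * ρ x| ≤ B * l ^ ((1 : ℝ) / 2) := fun x hx => by
      have := hρ 0 (Or.inl rfl) x hx
      rw [Real.rpow_zero, mul_one, zero_add] at this
      rwa [abs_mul, abs_of_nonneg (Real.sqrt_nonneg _)]
    refine (norm_finCalc_le hv (hb 0 ⟨le_rfl, ha.le⟩) (fun p => hb (s p) (hsI p)) _).trans ?_
    gcongr
    rw [← sub_apply]
    refine (ContinuousLinearMap.le_opNorm _ _).trans ?_
    gcongr
    rw [norm_sub_rev]
    exact (hpow A S hAa hSa).trans (by gcongr)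
  have b2 : ‖T ((A ^ k) (uθ - finCalc v s (fun x => x ^ θ) u))‖ ≤
      B * l ^ ((k : ℝ) + 1 / 2) * (C₁ * δ ^ θ * ‖u‖) := by
    have hb : ∀ x ∈ Set.Icc 0 a, |√(x + l) * ρ x * x ^ k| ≤ B * l ^ ((k : ℝ) + 1 / 2) :=
      fun x hx => by
        have := hρ k (Or.inr (Or.inl rfl)) x hx
        rw [Real.rpow_natCast] at this
        rwa [abs_mul, abs_mul, abs_of_nonneg (Real.sqrt_nonneg _),
          abs_of_nonneg (pow_nonneg hx.1 k)]
    rw [hAk, hT, finCalc_finCalc hv]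
    refine (norm_finCalc_le hv (hb 0 ⟨le_rfl, ha.le⟩) (fun p => hb (s p) (hsI p)) _).trans ?_
    gcongr
    rw [norm_sub_rev]
    exact hold hv hs0 hA he hσ hS hδ hAS F h
  have b3 : ‖T ((A ^ k) (finCalc v s (fun x => x ^ θ) u))‖ ≤
      B * l ^ ((k : ℝ) + θ + 1 / 2) * ‖u‖ := by
    have hb : ∀ x ∈ Set.Icc 0 a,
        |√(x + l) * ρ x * x ^ k * x ^ θ| ≤ B * l ^ ((k : ℝ) + θ + 1 / 2) :=
      fun x hx => by
        have := hρ (k + θ) (Or.inr (Or.inr rfl)) x hx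
        rw [Real.rpow_add_of_nonneg hx.1 (Nat.cast_nonneg k) hθ.1, Real.rpow_natCast] at this
        rwa [mul_assoc _ (x ^ k), abs_mul, abs_mul, abs_of_nonneg (Real.sqrt_nonneg _), abs_of_nonneg
          (mul_nonneg (pow_nonneg hx.1 k) (Real.rpow_nonneg hx.1 θ))]
    rw [hAk, hT, finCalc_finCalc hv, finCalc_finCalc hv]
    exact norm_finCalc_le hv (hb 0 ⟨le_rfl, ha.le⟩) (fun p => hb (s p) (hsI p)) _
  rw [hdec, map_add, map_add]
  have hl1 : 0 ≤ l ^ ((1 : ℝ) / 2) := Real.rpow_nonneg hl _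
  have hl2 : 0 ≤ l ^ ((k : ℝ) + 1 / 2) := Real.rpow_nonneg hl _
  have hl3 : 0 ≤ l ^ ((k : ℝ) + θ + 1 / 2) := Real.rpow_nonneg hl _
  have hδθ : 0 ≤ δ ^ θ := Real.rpow_nonneg hδ.le _
  have haθ : 0 ≤ a ^ θ := Real.rpow_nonneg ha.le _
  calc _ ≤ _ := (norm_add_le _ _).trans (add_le_add b1 ((norm_add_le _ _).trans (add_le_add b2 b3)))
    _ = B * ‖u‖ * (C₂ * a ^ θ * (l ^ ((1 : ℝ) / 2) * δ) + C₁ * (l ^ ((k : ℝ) + 1 / 2) * δ ^ θ)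
          + 1 * l ^ ((k : ℝ) + θ + 1 / 2)) := by ring
    _ ≤ B * ‖u‖ * ((C₂ * a ^ θ + C₁ + 1) * (l ^ ((1 : ℝ) / 2) * δ)
          + (C₂ * a ^ θ + C₁ + 1) * (l ^ ((k : ℝ) + 1 / 2) * δ ^ θ)
          + (C₂ * a ^ θ + C₁ + 1) * l ^ ((k : ℝ) + θ + 1 / 2)) := by
        have : 0 ≤ C₂ * a ^ θ := by positivity
        gcongr <;> linarith
    _ = _ := by ring

end Perturbation

/-! ### Weights of a sampling design -/

section Weights

/-- The index set of the observations of a design. -/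
abbrev Design.Index (D : Design) : Type := Σ i : Fin D.n, Fin (D.m i)

/-- The weight `1 / (n m_i)` of an observation of the `i`-th curve. -/
def Design.weight (D : Design) (p : D.Index) : ℝ := (D.n : ℝ)⁻¹ * (D.m p.1 : ℝ)⁻¹

variable (D : Design)

lemma Design.n_pos' : (0 : ℝ) < D.n := Nat.cast_pos.2 D.n_pos

lemma Design.m_pos' (i : Fin D.n) : (0 : ℝ) < D.m i := Nat.cast_pos.2 (D.m_pos i)

lemma Design.weight_pos (p : D.Index) : 0 < D.weight p :=
  mul_pos (inv_pos.2 D.n_pos') (inv_pos.2 (D.m_pos' _))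

lemma Design.sum_weight_mul (c : Fin D.n → ℝ) :
    ∑ p : D.Index, D.weight p * c p.1 = ∑ i, (D.n : ℝ)⁻¹ * c i := by
  rw [Fintype.sum_sigma]
  refine Finset.sum_congr rfl fun i _ => ?_
  have := (D.m_pos' i).ne'
  simp only [Design.weight, Finset.sum_const, Finset.card_univ, Fintype.card_fin, nsmul_eq_mul]
  field_simp

lemma Design.sum_weight : ∑ p : D.Index, D.weight p = 1 := by
  have h := D.sum_weight_mul fun _ => 1
  have := D.n_pos'.ne'
  simp only [mul_one] at h
  rw [h]
  simp [this]

lemma Design.inv_size : D.size⁻¹ = (D.n : ℝ)⁻¹ * ((D.n : ℝ)⁻¹ * ∑ i, ((D.m i : ℝ))⁻¹) := by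
  rw [Design.size, Design.harmonicMean, mul_inv, inv_inv, mul_comm]

/-- The variance factor of the weighted average is the inverse of the effective sample size `m n`. -/
lemma Design.sum_weight_sq : ∑ p : D.Index, D.weight p ^ 2 = D.size⁻¹ := by
  rw [D.inv_size, Fintype.sum_sigma, Finset.mul_sum, Finset.mul_sum]
  refine Finset.sum_congr rfl fun i _ => ?_
  have := (D.m_pos' i).ne'
  simp only [Design.weight, Finset.sum_const, Finset.card_univ, Fintype.card_fin, nsmul_eq_mul]
  field_simp

lemma Design.inv_size_le : D.size⁻¹ ≤ (D.n : ℝ)⁻¹ := by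
  rw [D.inv_size]
  have h0 := D.n_pos'
  have h1 : ∑ i, ((D.m i : ℝ))⁻¹ ≤ ∑ _i : Fin D.n, (1 : ℝ) := Finset.sum_le_sum fun i _ =>
    inv_le_one_of_one_le₀ (by exact_mod_cast D.m_pos i)
  simp only [Finset.sum_const, Finset.card_univ, Fintype.card_fin, nsmul_eq_mul, mul_one] at h1
  calc _ ≤ (D.n : ℝ)⁻¹ * ((D.n : ℝ)⁻¹ * D.n) := by gcongr
    _ = _ := by field_simp

lemma Design.one_le_size : 1 ≤ D.size := by
  have h0 : 0 < D.size := by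
    have h : 0 < D.size⁻¹ := by
      rw [← D.sum_weight_sq]
      have : Nonempty D.Index := ⟨⟨⟨0, D.n_pos⟩, ⟨0, D.m_pos _⟩⟩⟩
      exact Finset.sum_pos (fun p _ => pow_pos (D.weight_pos p) 2) Finset.univ_nonempty
    exact inv_pos.1 h
  have h1 : D.size⁻¹ ≤ 1 := D.inv_size_le.trans
    (inv_le_one_of_one_le₀ (by exact_mod_cast D.n_pos))
  exact (inv_le_one₀ h0).1 h1

end Weights

/-! ### Sums of orthogonal square-integrable variables -/

section Orthogonal

lemma enorm_sq_eq_ofReal (x : ℝ) : ‖x‖ₑ ^ 2 = ENNReal.ofReal (x ^ 2) := by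
  rw [Real.enorm_eq_ofReal_abs, ← ENNReal.ofReal_pow (abs_nonneg x), sq_abs]

lemma enorm_add_sq_le (x y : ℝ) : ‖x + y‖ₑ ^ 2 ≤ 2 * (‖x‖ₑ ^ 2 + ‖y‖ₑ ^ 2) := by
  simp only [enorm_sq_eq_ofReal]
  rw [← ENNReal.ofReal_add (sq_nonneg x) (sq_nonneg y),
    show (2 : ℝ≥0∞) = ENNReal.ofReal 2 by simp, ← ENNReal.ofReal_mul zero_le_two]
  exact ENNReal.ofReal_le_ofReal (by nlinarith [sq_nonneg (x - y)])

lemma memLp_two_iff_lintegral_lt_top {β : Type*} [MeasurableSpace β] {μ : Measure β} {f : β → ℝ}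
    (hf : AEStronglyMeasurable f μ) : MemLp f 2 μ ↔ ∫⁻ x, ‖f x‖ₑ ^ 2 ∂μ < ∞ := by
  rw [MemLp, eLpNorm_lt_top_iff_lintegral_rpow_enorm_lt_top two_ne_zero ENNReal.ofNat_ne_top]
  simp [hf]

lemma lintegral_enorm_sq_eq {β : Type*} [MeasurableSpace β] {μ : Measure β} {f : β → ℝ}
    (hf : MemLp f 2 μ) : ∫⁻ x, ‖f x‖ₑ ^ 2 ∂μ = ENNReal.ofReal (∫ x, f x ^ 2 ∂μ) := by
  rw [ofReal_integral_eq_lintegral_ofReal hf.integrable_sq (ae_of_all _ fun _ => sq_nonneg _)]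
  exact lintegral_congr fun x => enorm_sq_eq_ofReal _

variable {Ω : Type*} [MeasurableSpace Ω] {P : Measure Ω}

lemma integral_sq_sum_of_orthogonal {ι : Type*} [Fintype ι] {Z : ι → Ω → ℝ}
    (hZ : ∀ p, MemLp (Z p) 2 P) (ho : ∀ p q, p ≠ q → ∫ ω, Z p ω * Z q ω ∂P = 0) (w : ι → ℝ) :
    ∫ ω, (∑ p, w p * Z p ω) ^ 2 ∂P = ∑ p, w p ^ 2 * ∫ ω, Z p ω ^ 2 ∂P := by
  have hint : ∀ p q, Integrable (fun ω => Z p ω * Z q ω) P := fun p q =>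
    (hZ p).integrable_mul (hZ q)
  have e1 : ∀ ω, (∑ p, w p * Z p ω) ^ 2 = ∑ p, ∑ q, w p * w q * (Z p ω * Z q ω) := by
    intro ω
    rw [sq, Finset.sum_mul_sum]
    exact Finset.sum_congr rfl fun p _ => Finset.sum_congr rfl fun q _ => by ring
  simp only [e1]
  rw [integral_finsetSum _ fun p _ => integrable_finsetSum _ fun q _ => (hint p q).const_mul _]
  refine Finset.sum_congr rfl fun p _ => ?_
  rw [integral_finsetSum _ fun q _ => (hint p q).const_mul _, Finset.sum_eq_single p]
  · rw [integral_const_mul, ← sq]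
    simp only [sq]
  · intro q _ hq
    rw [integral_const_mul, ho p q hq.symm, mul_zero]
  · simp

end Orthogonal

/-! ### Second moments of weighted averages over a sample -/

section Sample

variable {𝕋 S Ω : Type*} [MeasurableSpace 𝕋] [MeasurableSpace S] [MeasurableSpace Ω]
variable {Q : Measure S} {π : Measure 𝕋} {η : Measure ℝ} {P : Measure Ω}
variable {ξ : ℕ → Ω → S} {t : ℕ → ℕ → Ω → 𝕋} {ε : ℕ → ℕ → Ω → ℝ}

lemma IsSample.measurable_pair (h : IsSample Q π η P ξ t ε) (i j : ℕ) :
    Measurable fun ω => (t i j ω, ε i j ω) :=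
  (h.measurable_point i j).prodMk (h.measurable_error i j)

/-- A sampling point together with its error is independent of all the other variables. -/
lemma IsSample.indepFun_pair (h : IsSample Q π η P ξ t ε) {β : Type*} [MeasurableSpace β]
    (i j : ℕ) {f : Ω → β} (hf : ∀ m' : MeasurableSpace Ω, (∀ i', Measurable[m'] (ξ i')) →
      (∀ i' j', (i', j') ≠ (i, j) → Measurable[m'] (t i' j')) →
      (∀ i' j', (i', j') ≠ (i, j) → Measurable[m'] (ε i' j')) → Measurable[m'] f) :
    IndepFun (fun ω => (t i j ω, ε i j ω)) f P := by
  set A : Set (ℕ ⊕ (ℕ × ℕ) ⊕ (ℕ × ℕ)) := {.inr (.inl (i, j)), .inr (.inr (i, j))} with hA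
  have hind := indep_iSup_of_disjoint ?_ h.indep (disjoint_compl_right : Disjoint A Aᶜ)
  · rw [IndepFun_iff_Indep]
    refine indep_of_indep_of_le_left (indep_of_indep_of_le_right hind ?_) ?_
    · rw [← measurable_iff_comap_le]
      refine hf _ (fun i' => ?_) (fun i' j' hne => ?_) (fun i' j' hne => ?_)
      · rw [measurable_iff_comap_le]
        exact le_iSup₂_of_le (Sum.inl i') (by simp [hA]) le_rfl
      · rw [measurable_iff_comap_le]
        exact le_iSup₂_of_le (Sum.inr (Sum.inl (i', j'))) (by simpa [hA] using hne) le_rfl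
      · rw [measurable_iff_comap_le]
        exact le_iSup₂_of_le (Sum.inr (Sum.inr (i', j'))) (by simpa [hA] using hne) le_rfl
    · rw [← measurable_iff_comap_le]
      refine Measurable.prodMk ?_ ?_
      · rw [measurable_iff_comap_le]
        exact le_iSup₂_of_le (Sum.inr (Sum.inl (i, j))) (by simp [hA]) le_rfl
      · rw [measurable_iff_comap_le]
        exact le_iSup₂_of_le (Sum.inr (Sum.inr (i, j))) (by simp [hA]) le_rfl
  · rintro (i' | p | p)
    · exact (h.measurable_path i').comap_le
    · exact (h.measurable_point p.1 p.2).comap_le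
    · exact (h.measurable_error p.1 p.2).comap_le

lemma IsSample.measurePreserving_path (h : IsSample Q π η P ξ t ε) (i : ℕ) :
    MeasurePreserving (ξ i) P Q :=
  ⟨h.measurable_path i, h.law_path i⟩

variable [IsProbabilityMeasure P]

lemma IsSample.map_pair (h : IsSample Q π η P ξ t ε) (i j : ℕ) :
    P.map (fun ω => (t i j ω, ε i j ω)) = π.prod η := by
  have hind : IndepFun (t i j) (ε i j) P := by
    rw [IndepFun_iff_Indep]
    exact h.indep.indep (i := .inr (.inl (i, j))) (j := .inr (.inr (i, j))) (by simp)
  rw [(indepFun_iff_map_prod_eq_prod_map_map (h.measurable_point i j).aemeasurable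
    (h.measurable_error i j).aemeasurable).1 hind, h.law_point, h.law_error]

lemma IsSample.map_triple (h : IsSample Q π η P ξ t ε) (i j : ℕ) :
    P.map (fun ω => (ξ i ω, (t i j ω, ε i j ω))) = Q.prod (π.prod η) := by
  have hind : IndepFun (ξ i) (fun ω => (t i j ω, ε i j ω)) P :=
    (h.indepFun_pair i j fun m' h1 _ _ => h1 i).symm
  rw [(indepFun_iff_map_prod_eq_prod_map_map (h.measurable_path i).aemeasurable
    (h.measurable_pair i j).aemeasurable).1 hind, h.law_path, h.map_pair]

lemma IsSample.measurePreserving_triple (h : IsSample Q π η P ξ t ε) (i j : ℕ) :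
    MeasurePreserving (fun ω => (ξ i ω, (t i j ω, ε i j ω))) P (Q.prod (π.prod η)) :=
  ⟨(h.measurable_path i).prodMk (h.measurable_pair i j), h.map_triple i j⟩

/-- Two observations are uncorrelated as soon as the first has mean zero given its curve. This
covers observations of the same curve as well as of different ones. -/
lemma IsSample.integral_mul_eq_zero (h : IsSample Q π η P ξ t ε)
    {F G : S × 𝕋 × ℝ → ℝ} (hF : Measurable F) (hG : Measurable G)
    (hF2 : MemLp F 2 (Q.prod (π.prod η))) (hG2 : MemLp G 2 (Q.prod (π.prod η)))
    (hF0 : ∀ᵐ x ∂Q, ∫ u, F (x, u) ∂(π.prod η) = 0) {i j i' j' : ℕ} (hne : (i, j) ≠ (i', j')) :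
    ∫ ω, F (ξ i ω, (t i j ω, ε i j ω)) * G (ξ i' ω, (t i' j' ω, ε i' j' ω)) ∂P = 0 := by
  have hπη : IsProbabilityMeasure (π.prod η) := by
    rw [← h.map_pair i j]
    exact Measure.isProbabilityMeasure_map (h.measurable_pair i j).aemeasurable
  set V : Ω → S × S × 𝕋 × ℝ := fun ω => (ξ i ω, (ξ i' ω, (t i' j' ω, ε i' j' ω))) with hV
  have hVm : Measurable V := (h.measurable_path i).prodMk
    ((h.measurable_path i').prodMk (h.measurable_pair i' j'))
  have hind : IndepFun (fun ω => (t i j ω, ε i j ω)) V P :=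
    h.indepFun_pair i j fun m' h1 h2 h3 => (h1 i).prodMk
      ((h1 i').prodMk ((h2 i' j' hne.symm).prodMk (h3 i' j' hne.symm)))
  have hmap : P.map (fun ω => ((t i j ω, ε i j ω), V ω)) = (π.prod η).prod (P.map V) := by
    rw [(indepFun_iff_map_prod_eq_prod_map_map (h.measurable_pair i j).aemeasurable
      hVm.aemeasurable).1 hind, h.map_pair]
  have hprob : IsProbabilityMeasure (P.map V) :=
    Measure.isProbabilityMeasure_map hVm.aemeasurable
  set K : (𝕋 × ℝ) × (S × S × 𝕋 × ℝ) → ℝ := fun z => F (z.2.1, z.1) * G z.2.2 with hK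
  have hKm : Measurable K := by fun_prop
  have hm : Measurable fun ω => ((t i j ω, ε i j ω), V ω) := (h.measurable_pair i j).prodMk hVm
  have e1 : ∫ ω, F (ξ i ω, (t i j ω, ε i j ω)) * G (ξ i' ω, (t i' j' ω, ε i' j' ω)) ∂P
      = ∫ z, K z ∂((π.prod η).prod (P.map V)) := by
    rw [← hmap, integral_map hm.aemeasurable hKm.aestronglyMeasurable]
  have hKint : Integrable K ((π.prod η).prod (P.map V)) := by
    rw [← hmap, integrable_map_measure hKm.aestronglyMeasurable hm.aemeasurable]
    exact (hF2.comp_measurePreserving (h.measurePreserving_triple i j)).integrable_mul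
      (hG2.comp_measurePreserving (h.measurePreserving_triple i' j'))
  rw [e1, integral_prod_symm _ hKint]
  have hae : ∀ᵐ y ∂(P.map V), ∫ u, F (y.1, u) ∂(π.prod η) = 0 := by
    have hfst : MeasurePreserving Prod.fst (P.map V) Q := by
      refine ⟨measurable_fst, ?_⟩
      rw [Measure.map_map measurable_fst hVm, ← h.law_path i]
      rfl
    exact hfst.quasiMeasurePreserving.ae hF0
  rw [integral_eq_zero_of_ae]
  filter_upwards [hae] with y hy
  simp only [hK, integral_mul_const, hy, zero_mul, Pi.zero_apply]

/-- The conditional mean of an observation given its curve. -/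
def curveMean (π : Measure 𝕋) (η : Measure ℝ) (φ : S × 𝕋 × ℝ → ℝ) (x : S) : ℝ :=
  ∫ u, φ (x, u) ∂(π.prod η)

lemma measurable_curveMean [SFinite π] [SFinite η] {φ : S × 𝕋 × ℝ → ℝ} (hφ : Measurable φ) :
    Measurable (curveMean π η φ) :=
  (hφ.stronglyMeasurable.integral_prod_right' (ν := π.prod η)).measurable

section Centering

variable [IsProbabilityMeasure π] [IsProbabilityMeasure η]

lemma lintegral_sub_curveMean_le [SFinite Q] {φ : S × 𝕋 × ℝ → ℝ} (hφ : Measurable φ)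
    (hφ2 : MemLp φ 2 (Q.prod (π.prod η))) :
    ∫⁻ z, ‖φ z - curveMean π η φ z.1‖ₑ ^ 2 ∂(Q.prod (π.prod η)) ≤
      ∫⁻ z, ‖φ z‖ₑ ^ 2 ∂(Q.prod (π.prod η)) := by
  have hB := measurable_curveMean (π := π) (η := η) hφ
  rw [lintegral_prod _ (by fun_prop), lintegral_prod _ (by fun_prop)]
  have hfin : ∫⁻ x, ∫⁻ u, ‖φ (x, u)‖ₑ ^ 2 ∂(π.prod η) ∂Q ≠ ∞ := by
    rw [← lintegral_prod (fun z => ‖φ z‖ₑ ^ 2) (by fun_prop)]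
    exact ((memLp_two_iff_lintegral_lt_top hφ2.1).1 hφ2).ne
  have hae := ae_lt_top (by fun_prop) hfin
  refine lintegral_mono_ae ?_
  filter_upwards [hae] with x hx
  have hφx : Measurable fun u => φ (x, u) := by fun_prop
  have hx2 : MemLp (fun u => φ (x, u)) 2 (π.prod η) :=
    (memLp_two_iff_lintegral_lt_top hφx.aestronglyMeasurable).2 hx
  have h1 : ∫⁻ u, ‖φ (x, u) - curveMean π η φ x‖ₑ ^ 2 ∂(π.prod η) =
      evariance (fun u => φ (x, u)) (π.prod η) := rfl
  rw [h1, ← hx2.ofReal_variance_eq, lintegral_enorm_sq_eq hx2]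
  exact ENNReal.ofReal_le_ofReal (variance_le_expectation_sq hx2.aestronglyMeasurable)

variable [IsProbabilityMeasure Q]

lemma memLp_curveMean {φ : S × 𝕋 × ℝ → ℝ} (hφ : Measurable φ)
    (hφ2 : MemLp φ 2 (Q.prod (π.prod η))) :
    MemLp (fun z => φ z - curveMean π η φ z.1) 2 (Q.prod (π.prod η)) ∧
      MemLp (curveMean π η φ) 2 Q := by
  have hB := measurable_curveMean (π := π) (η := η) hφ
  have h1 : MemLp (fun z => φ z - curveMean π η φ z.1) 2 (Q.prod (π.prod η)) := by
    rw [memLp_two_iff_lintegral_lt_top (by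
      exact (hφ.sub (hB.comp measurable_fst)).aestronglyMeasurable)]
    exact (lintegral_sub_curveMean_le hφ hφ2).trans_lt
      ((memLp_two_iff_lintegral_lt_top hφ2.1).1 hφ2)
  refine ⟨h1, ?_⟩
  have h2 : MemLp (curveMean π η φ ∘ Prod.fst) 2 (Q.prod (π.prod η)) := by
    have := hφ2.sub h1
    refine this.ae_eq (ae_of_all _ fun z => ?_)
    simp
  have hfst : MeasurePreserving (Prod.fst : S × 𝕋 × ℝ → S) (Q.prod (π.prod η)) Q :=
    measurePreserving_fst
  rw [← hfst.map_eq]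
  exact (memLp_map_measure_iff hB.aestronglyMeasurable hfst.measurable.aemeasurable).2 h2

/-- Variance of a weighted average over all observations. The fluctuation given the curves is an
orthogonal sum over all observations and contributes `1 / (m n)`; the fluctuation of the curve
means is an orthogonal sum over the curves and contributes `1 / n`. -/
lemma IsSample.lintegral_weighted_sum_sq_le (h : IsSample Q π η P ξ t ε) (D : Design)
    {φ : S × 𝕋 × ℝ → ℝ} (hφ : Measurable φ) (hφ2 : MemLp φ 2 (Q.prod (π.prod η))) :
    ∫⁻ ω, ‖∑ p : D.Index, D.weight p *
        φ (ξ p.1 ω, (t p.1 p.2 ω, ε p.1 p.2 ω)) - ∫ x, curveMean π η φ x ∂Q‖ₑ ^ 2 ∂P ≤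
      2 * (ENNReal.ofReal D.size⁻¹ * ∫⁻ z, ‖φ z‖ₑ ^ 2 ∂(Q.prod (π.prod η)) +
        ENNReal.ofReal (D.n : ℝ)⁻¹ *
          ∫⁻ x, ‖curveMean π η φ x - ∫ y, curveMean π η φ y ∂Q‖ₑ ^ 2 ∂Q) := by
  set B := curveMean π η φ with hBdef
  set m := ∫ x, B x ∂Q with hm
  have hB : Measurable B := measurable_curveMean hφ
  obtain ⟨hF2, hB2⟩ := memLp_curveMean hφ hφ2
  -- `F` is the fluctuation of an observation given its curve, with conditional mean zero.
  set F : S × 𝕋 × ℝ → ℝ := fun z => φ z - B z.1 with hF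
  have hFm : Measurable F := hφ.sub (hB.comp measurable_fst)
  have hF0 : ∀ᵐ x ∂Q, ∫ u, F (x, u) ∂(π.prod η) = 0 := by
    have hint := (hφ2.integrable one_le_two).prod_right_ae
    filter_upwards [hint] with x hx
    simp only [hF]
    rw [integral_sub hx (integrable_const _), integral_const]
    simp [hBdef, curveMean]
  set Z : D.Index → Ω → ℝ := fun p ω => F (ξ p.1 ω, (t p.1 p.2 ω, ε p.1 p.2 ω)) with hZ
  have hZ2 : ∀ p, MemLp (Z p) 2 P := fun p =>
    hF2.comp_measurePreserving (h.measurePreserving_triple p.1 p.2)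
  have hZsq : ∀ p, ∫ ω, Z p ω ^ 2 ∂P = ∫ z, F z ^ 2 ∂(Q.prod (π.prod η)) := fun p => by
    rw [← h.map_triple p.1 p.2,
      integral_map (h.measurePreserving_triple _ _).measurable.aemeasurable
        (hFm.pow_const 2).aestronglyMeasurable]
  have hZo : ∀ p q, p ≠ q → ∫ ω, Z p ω * Z q ω ∂P = 0 := fun p q hpq => by
    refine h.integral_mul_eq_zero hFm hFm hF2 hF2 hF0 fun heq => hpq ?_
    obtain ⟨i, j⟩ := p
    obtain ⟨i', j'⟩ := q
    simp only [Prod.mk.injEq] at heq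
    obtain rfl : i = i' := Fin.ext heq.1
    obtain rfl : j = j' := Fin.ext heq.2
    rfl
  set W : Fin D.n → Ω → ℝ := fun i ω => B (ξ i ω) - m with hW
  have hBm2 : MemLp (fun x => B x - m) 2 Q := hB2.sub (memLp_const m)
  have hW2 : ∀ i, MemLp (W i) 2 P := fun i =>
    hBm2.comp_measurePreserving (h.measurePreserving_path i)
  have hWsq : ∀ i, ∫ ω, W i ω ^ 2 ∂P = ∫ x, (B x - m) ^ 2 ∂Q := fun i => by
    rw [← h.law_path i, integral_map (h.measurable_path i).aemeasurable
      ((hB.sub_const m).pow_const 2).aestronglyMeasurable]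
  have hWo : ∀ i i', i ≠ i' → ∫ ω, W i ω * W i' ω ∂P = 0 := fun i i' hne => by
    have hind : IndepFun (ξ i) (ξ i') P := by
      rw [IndepFun_iff_Indep]
      exact h.indep.indep (i := .inl (i : ℕ)) (j := .inl (i' : ℕ))
        (by simpa [Fin.ext_iff] using hne)
    have hind' : IndepFun (W i) (W i') P :=
      hind.comp (hB.sub_const m) (hB.sub_const m)
    rw [hind'.integral_fun_mul_eq_mul_integral (hW2 i).1 (hW2 i').1]
    have h0 : ∫ ω, W i ω ∂P = 0 := by
      have : ∫ ω, W i ω ∂P = ∫ x, (B x - m) ∂Q := by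
        rw [← h.law_path i, integral_map (h.measurable_path i).aemeasurable
          (hB.sub_const m).aestronglyMeasurable]
      rw [this, integral_sub (hB2.integrable one_le_two) (integrable_const _)]
      simp [hm, hBdef]
    rw [h0, zero_mul]
  have hdec : ∀ ω, ∑ p : D.Index, D.weight p * φ (ξ p.1 ω, (t p.1 p.2 ω, ε p.1 p.2 ω)) - m =
      ∑ p, D.weight p * Z p ω + ∑ i, (D.n : ℝ)⁻¹ * W i ω := fun ω => by
    have e1 := D.sum_weight_mul fun i => W i ω
    rw [← e1, ← Finset.sum_add_distrib]
    have e2 : m = ∑ p : D.Index, D.weight p * m := by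
      rw [← Finset.sum_mul, D.sum_weight, one_mul]
    nth_rewrite 1 [e2]
    rw [← Finset.sum_sub_distrib]
    refine Finset.sum_congr rfl fun p _ => ?_
    simp only [hZ, hF, hW]
    ring
  have hsumZ : MemLp (fun ω => ∑ p, D.weight p * Z p ω) 2 P :=
    memLp_finsetSum _ fun p _ => (hZ2 p).const_mul _
  have hsumW : MemLp (fun ω => ∑ i, (D.n : ℝ)⁻¹ * W i ω) 2 P :=
    memLp_finsetSum _ fun i _ => (hW2 i).const_mul _
  have hn := D.n_pos'
  have hs : 0 ≤ D.size⁻¹ := inv_nonneg.2 (zero_le_one.trans D.one_le_size)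
  simp only [hdec]
  calc _ ≤ ∫⁻ ω, 2 * (‖∑ p, D.weight p * Z p ω‖ₑ ^ 2 + ‖∑ i, (D.n : ℝ)⁻¹ * W i ω‖ₑ ^ 2) ∂P :=
        lintegral_mono fun ω => enorm_add_sq_le _ _
    _ = 2 * (∫⁻ ω, ‖∑ p, D.weight p * Z p ω‖ₑ ^ 2 ∂P +
          ∫⁻ ω, ‖∑ i, (D.n : ℝ)⁻¹ * W i ω‖ₑ ^ 2 ∂P) := by
        rw [lintegral_const_mul' _ _ (by simp), lintegral_add_left' (hsumZ.1.enorm.pow_const 2)]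
    _ ≤ _ := by
        rw [lintegral_enorm_sq_eq hsumZ, lintegral_enorm_sq_eq hsumW,
          integral_sq_sum_of_orthogonal hZ2 hZo, integral_sq_sum_of_orthogonal hW2 hWo]
        simp only [hZsq, hWsq]
        rw [← Finset.sum_mul, D.sum_weight_sq, ← Finset.sum_mul, ENNReal.ofReal_mul hs]
        gcongr
        · rw [← lintegral_enorm_sq_eq hF2]
          exact lintegral_sub_curveMean_le hφ hφ2
        · rw [lintegral_enorm_sq_eq hBm2, ← ENNReal.ofReal_mul (by positivity)]
          refine ENNReal.ofReal_le_ofReal (mul_le_mul_of_nonneg_right (le_of_eq ?_)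
            (integral_nonneg fun _ => sq_nonneg _))
          simp only [Finset.sum_const, Finset.card_univ, Fintype.card_fin, nsmul_eq_mul]
          field_simp

end Centering

end Sample

/-! ### Coordinates in an orthonormal sequence -/

section Coordinates

variable {E : Type*} [NormedAddCommGroup E] [InnerProductSpace ℝ E] [CompleteSpace E]
variable {e : ℕ → E}

/-- The closed span is the double orthogonal complement. -/
lemma mem_closure_span_iff {w : E} :
    w ∈ (Submodule.span ℝ (Set.range e)).topologicalClosure ↔
      ∀ y, (∀ i, ⟪e i, y⟫_ℝ = 0) → ⟪w, y⟫_ℝ = 0 := by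
  rw [← Submodule.orthogonal_orthogonal_eq_closure, Submodule.mem_orthogonal']
  refine forall_congr' fun y => ?_
  have : y ∈ (Submodule.span ℝ (Set.range e))ᗮ ↔ ∀ i, ⟪e i, y⟫_ℝ = 0 := by
    rw [Submodule.mem_orthogonal]
    refine ⟨fun h i => h _ (Submodule.subset_span ⟨i, rfl⟩), fun h u hu => ?_⟩
    induction hu using Submodule.span_induction with
    | mem x hx => obtain ⟨i, rfl⟩ := hx; exact h i
    | zero => simp
    | add x y _ _ hx hy => rw [inner_add_left, hx, hy, add_zero]
    | smul c x _ hx => rw [inner_smul_left, hx, mul_zero]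
  rw [this]

lemma hasSum_inner_of_mem_closure_span (he : Orthonormal ℝ e) {w : E}
    (hw : w ∈ (Submodule.span ℝ (Set.range e)).topologicalClosure) (f : E) :
    HasSum (fun i => ⟪e i, w⟫_ℝ * ⟪e i, f⟫_ℝ) ⟪w, f⟫_ℝ := by
  have hsum : Summable fun i => ⟪e i, w⟫_ℝ • e i := by
    have h1 := he.orthogonalFamily.summable_iff_norm_sq_summable (fun i => ⟪e i, w⟫_ℝ)
    refine h1.2 ?_
    simpa using he.inner_products_summable (x := w)
  obtain ⟨y, hy⟩ := hsum
  have hyi : ∀ i, ⟪e i, y⟫_ℝ = ⟪e i, w⟫_ℝ := fun i => by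
    have h1 := hy.mapL (innerSL ℝ (e i))
    have h2 : HasSum (fun l => (innerSL ℝ (e i)) (⟪e l, w⟫_ℝ • e l)) ⟪e i, w⟫_ℝ := by
      convert hasSum_ite_eq i ⟪e i, w⟫_ℝ using 2 with l
      rw [innerSL_apply_apply, inner_smul_right, orthonormal_iff_ite.1 he]
      by_cases h : l = i
      · subst h; simp
      · simp [h, Ne.symm h]
    exact h1.unique h2
  have hyw : y = w := by
    have hyK : y ∈ (Submodule.span ℝ (Set.range e)).topologicalClosure := by
      refine (Submodule.isClosed_topologicalClosure _).mem_of_tendsto hy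
        (Eventually.of_forall fun s => Submodule.sum_mem _ fun i _ => Submodule.smul_mem _ _
          (Submodule.le_topologicalClosure _ (Submodule.subset_span ⟨i, rfl⟩)))
    have h1 := mem_closure_span_iff.1 (Submodule.sub_mem _ hyK hw) (y - w) fun i => by
      rw [inner_sub_right, hyi, sub_self]
    exact sub_eq_zero.1 (inner_self_eq_zero.1 h1)
  rw [hyw] at hy
  have h2 := hy.mapL (innerSL ℝ f)
  rw [innerSL_apply_apply, real_inner_comm] at h2
  have e1 : ∀ i, (innerSL ℝ f) (⟪e i, w⟫_ℝ • e i) = ⟪e i, w⟫_ℝ * ⟪e i, f⟫_ℝ := fun i => by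
    rw [innerSL_apply_apply, inner_smul_right, real_inner_comm f]
  simpa only [e1] using h2

/-- Weighted Cauchy–Schwarz in coordinates. -/
lemma sum_mul_sq_le_weighted (s : Finset ℕ) {c : ℕ → ℝ} (hc : ∀ i, 0 < c i) (x y : ℕ → ℝ) :
    (∑ i ∈ s, x i * y i) ^ 2 ≤ (∑ i ∈ s, c i * x i ^ 2) * ∑ i ∈ s, (c i)⁻¹ * y i ^ 2 := by
  have h := Finset.sum_mul_sq_le_sq_mul_sq s (fun i => √(c i) * x i) (fun i => (√(c i))⁻¹ * y i)
  have e1 : ∀ i, √(c i) * x i * ((√(c i))⁻¹ * y i) = x i * y i := fun i => by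
    have := (Real.sqrt_pos.2 (hc i)).ne'
    field_simp
  have e2 : ∀ i, (√(c i) * x i) ^ 2 = c i * x i ^ 2 := fun i => by
    rw [mul_pow, Real.sq_sqrt (hc i).le]
  have e3 : ∀ i, ((√(c i))⁻¹ * y i) ^ 2 = (c i)⁻¹ * y i ^ 2 := fun i => by
    rw [mul_pow, inv_pow, Real.sq_sqrt (hc i).le]
  simpa only [e1, e2, e3] using h

/-- A bound for the weighted coordinates of `w` bounds the functional `⟪w, ·⟫` in the dual norm. -/
lemma inner_sq_le_of_coordinates (he : Orthonormal ℝ e) {w : E}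
    (hw : w ∈ (Submodule.span ℝ (Set.range e)).topologicalClosure) {c : ℕ → ℝ}
    (hc : ∀ i, 0 < c i) {q G : ℝ} (hq : ∀ s : Finset ℕ, ∑ i ∈ s, c i * ⟪e i, w⟫_ℝ ^ 2 ≤ q)
    {f : E} (hf : ∀ s : Finset ℕ, ∑ i ∈ s, (c i)⁻¹ * ⟪e i, f⟫_ℝ ^ 2 ≤ G) :
    ⟪w, f⟫_ℝ ^ 2 ≤ q * G := by
  have h1 := (hasSum_inner_of_mem_closure_span he hw f).pow 2
  have hq0 : 0 ≤ q := by simpa using hq ∅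
  refine le_of_tendsto h1 (Eventually.of_forall fun s => ?_)
  refine (sum_mul_sq_le_weighted s hc _ _).trans (mul_le_mul (hq s) (hf s) ?_ hq0)
  exact Finset.sum_nonneg fun i _ => mul_nonneg (inv_nonneg.2 (hc i).le) (sq_nonneg _)

/-- A weighted Hilbert–Schmidt bound for the matrix of a symmetric operator bounds its bilinear
form. -/
lemma inner_apply_sq_le_of_coordinates (he : Orthonormal ℝ e) {Δ : E →L[ℝ] E}
    (hsymm : ∀ f y, ⟪Δ f, y⟫_ℝ = ⟪f, Δ y⟫_ℝ)
    (hΔ : ∀ f, Δ f ∈ (Submodule.span ℝ (Set.range e)).topologicalClosure) {c : ℕ → ℝ}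
    (hc : ∀ i, 0 < c i) {q F G : ℝ}
    (hq : ∀ s s' : Finset ℕ, ∑ i ∈ s, ∑ l ∈ s', c i * c l * ⟪Δ (e i), e l⟫_ℝ ^ 2 ≤ q)
    {f y : E} (hf : ∀ s : Finset ℕ, ∑ i ∈ s, (c i)⁻¹ * ⟪e i, f⟫_ℝ ^ 2 ≤ F)
    (hy : ∀ s : Finset ℕ, ∑ i ∈ s, (c i)⁻¹ * ⟪e i, y⟫_ℝ ^ 2 ≤ G) :
    ⟪Δ f, y⟫_ℝ ^ 2 ≤ q * F * G := by
  refine inner_sq_le_of_coordinates he (hΔ f) hc (fun s => ?_) hy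
  have hF : 0 ≤ F := by simpa using hf ∅
  have hlim : Tendsto (fun s' : Finset ℕ => ∑ i ∈ s, c i *
      (∑ l ∈ s', ⟪e l, Δ (e i)⟫_ℝ * ⟪e l, f⟫_ℝ) ^ 2) atTop
      (𝓝 (∑ i ∈ s, c i * ⟪Δ (e i), f⟫_ℝ ^ 2)) :=
    tendsto_finsetSum _ fun i _ =>
      ((hasSum_inner_of_mem_closure_span he (hΔ (e i)) f).pow 2).const_mul _
  have e1 : ∑ i ∈ s, c i * ⟪e i, Δ f⟫_ℝ ^ 2 = ∑ i ∈ s, c i * ⟪Δ (e i), f⟫_ℝ ^ 2 := by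
    simp only [hsymm]
  rw [e1]
  refine le_of_tendsto hlim (Eventually.of_forall fun s' => ?_)
  calc _ ≤ ∑ i ∈ s, c i * ((∑ l ∈ s', c l * ⟪e l, Δ (e i)⟫_ℝ ^ 2) * F) := by
        refine Finset.sum_le_sum fun i _ => mul_le_mul_of_nonneg_left ?_ (hc i).le
        refine (sum_mul_sq_le_weighted s' hc _ _).trans ?_
        refine mul_le_mul_of_nonneg_left (hf s') ?_
        exact Finset.sum_nonneg fun l _ => mul_nonneg (hc l).le (sq_nonneg _)
    _ = (∑ i ∈ s, ∑ l ∈ s', c i * c l * ⟪Δ (e i), e l⟫_ℝ ^ 2) * F := by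
        rw [Finset.sum_mul]
        refine Finset.sum_congr rfl fun i _ => ?_
        rw [← mul_assoc, Finset.mul_sum]
        congr 1
        exact Finset.sum_congr rfl fun l _ => by rw [real_inner_comm, mul_assoc]
    _ ≤ q * F := mul_le_mul_of_nonneg_right (hq s s') hF

end Coordinates

/-! ### The covariance operator and its eigenfunctions -/

section Covariance

variable {𝕋 : Type*} {H : Type*} [NormedAddCommGroup H] [InnerProductSpace ℝ H] [CompleteSpace H]
  [RKHS ℝ H 𝕋 ℝ]

lemma norm_kernSec_sq (s : 𝕋) : ‖kernSec H s‖ ^ 2 = kern H s s := by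
  rw [← real_inner_self_eq_norm_sq, inner_kernSec_kernSec]

lemma abs_apply_le {a : ℝ} (ha : 0 ≤ a) (hka : ∀ s : 𝕋, kern H s s ≤ a) (f : H) (s : 𝕋) :
    |f s| ≤ √a * ‖f‖ := by
  rw [← inner_kernSec]
  refine (abs_real_inner_le_norm _ _).trans ?_
  rw [mul_comm]
  gcongr
  rw [Real.le_sqrt (norm_nonneg _) ha, norm_kernSec_sq]
  exact hka s

variable [TopologicalSpace 𝕋] [CompactSpace 𝕋] [MeasurableSpace 𝕋] [BorelSpace 𝕋]
variable (hk : Continuous fun p : 𝕋 × 𝕋 => kern H p.1 p.2) (ρ : Measure 𝕋) [IsFiniteMeasure ρ]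

lemma inclusion_ae_eq (f : H) : inclusion hk ρ f =ᵐ[ρ] (f : 𝕋 → ℝ) := by
  have h := ContinuousMap.coeFn_toLp (p := 2) (𝕜 := ℝ) ρ (toContinuous hk f)
  exact h

/-- The covariance operator `S = ρ(T)⁻¹ J* J` on the RKHS, the population version of the
empirical operator. -/
def covOp : H →L[ℝ] H :=
  (ρ.real Set.univ)⁻¹ • (ContinuousLinearMap.adjoint (inclusion hk ρ) ∘L inclusion hk ρ)

lemma inner_covOp (f y : H) :
    ⟪covOp hk ρ f, y⟫_ℝ = (ρ.real Set.univ)⁻¹ * ⟪inclusion hk ρ f, inclusion hk ρ y⟫_ℝ := by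
  simp [covOp, inner_smul_left, ContinuousLinearMap.adjoint_inner_left]

lemma covOp_symm (f y : H) : ⟪covOp hk ρ f, y⟫_ℝ = ⟪f, covOp hk ρ y⟫_ℝ := by
  rw [inner_covOp, real_inner_comm, ← inner_covOp, real_inner_comm]

lemma inner_covOp_eq_integral (f y : H) :
    ⟪covOp hk ρ f, y⟫_ℝ = ∫ s, f s * y s ∂((ρ Set.univ)⁻¹ • ρ) := by
  rw [inner_covOp, integral_smul_measure, ENNReal.toReal_inv, smul_eq_mul]
  congr 1
  rw [L2.inner_def]
  refine integral_congr_ae ?_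
  filter_upwards [inclusion_ae_eq hk ρ f, inclusion_ae_eq hk ρ y] with s h1 h2
  rw [h1, h2]
  exact mul_comm _ _

lemma norm_covOp_le {a : ℝ} (ha : 0 ≤ a) (hka : ∀ s : 𝕋, kern H s s ≤ a)
    [IsProbabilityMeasure ((ρ Set.univ)⁻¹ • ρ)] : ‖covOp hk ρ‖ ≤ a := by
  refine ContinuousLinearMap.opNorm_le_bound _ ha fun f => ?_
  have hb : ∀ y : H, |⟪covOp hk ρ f, y⟫_ℝ| ≤ a * ‖f‖ * ‖y‖ := fun y => by
    rw [inner_covOp_eq_integral]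
    have h := norm_integral_le_of_norm_le_const (μ := (ρ Set.univ)⁻¹ • ρ) (C := a * ‖f‖ * ‖y‖)
      (f := fun s => f s * y s) (ae_of_all _ fun s => ?_)
    · rwa [probReal_univ, mul_one] at h
    rw [norm_mul]
    calc _ ≤ (√a * ‖f‖) * (√a * ‖y‖) :=
          mul_le_mul (abs_apply_le ha hka f s) (abs_apply_le ha hka y s) (abs_nonneg _)
            (by positivity)
      _ = _ := by
          nth_rewrite 3 [← Real.mul_self_sqrt ha]
          ring
  have h1 := hb (covOp hk ρ f)
  rw [real_inner_self_eq_norm_sq, abs_of_nonneg (sq_nonneg _), sq] at h1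
  rcases (norm_nonneg (covOp hk ρ f)).eq_or_lt with h0 | h0
  · rw [← h0]; positivity
  · exact le_of_mul_le_mul_right h1 h0

variable (ev : ℕ → ℝ) (ψ : ℕ → Lp ℝ 2 ρ)

/-- The `H`-normalised eigenfunctions `ev_i^(-1/2) J* ψ_i` of the covariance operator. -/
def eigFun (i : ℕ) : H := (√(ev i))⁻¹ • ContinuousLinearMap.adjoint (inclusion hk ρ) (ψ i)

variable {hk ρ} {ev ψ}

lemma IsEigensystem.apply_eigenvector (heig : IsEigensystem (integralOp hk ρ) ev ψ) (i : ℕ) :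
    integralOp hk ρ (ψ i) = ev i • ψ i := by
  refine (heig.hasSum (ψ i)).unique ?_
  convert hasSum_ite_eq i (ev i • ψ i) using 2 with l
  rw [orthonormal_iff_ite.1 heig.orthonormal]
  by_cases h : l = i
  · subst h; simp
  · simp [h]

lemma IsEigensystem.sqrt_pos (heig : IsEigensystem (integralOp hk ρ) ev ψ) (i : ℕ) :
    0 < √(ev i) :=
  Real.sqrt_pos.2 (heig.pos i)

lemma IsEigensystem.inclusion_eigFun (heig : IsEigensystem (integralOp hk ρ) ev ψ) (i : ℕ) :
    inclusion hk ρ (eigFun hk ρ ev ψ i) = √(ev i) • ψ i := by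
  have h1 : inclusion hk ρ (ContinuousLinearMap.adjoint (inclusion hk ρ) (ψ i)) = ev i • ψ i :=
    heig.apply_eigenvector i
  rw [eigFun, map_smul, h1, smul_smul]
  congr 1
  have := (heig.sqrt_pos i).ne'
  have h2 := Real.mul_self_sqrt (heig.pos i).le
  field_simp
  rw [sq, h2]

lemma IsEigensystem.inner_inclusion (heig : IsEigensystem (integralOp hk ρ) ev ψ) (i : ℕ)
    (f : H) : ⟪ψ i, inclusion hk ρ f⟫_ℝ = √(ev i) * ⟪eigFun hk ρ ev ψ i, f⟫_ℝ := by
  have := (heig.sqrt_pos i).ne'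
  rw [eigFun, inner_smul_left, ContinuousLinearMap.adjoint_inner_left]
  simp only [RCLike.conj_to_real]
  field_simp

lemma IsEigensystem.orthonormal_eigFun (heig : IsEigensystem (integralOp hk ρ) ev ψ) :
    Orthonormal ℝ (eigFun hk ρ ev ψ) := by
  rw [orthonormal_iff_ite]
  intro i l
  have h1 := heig.inner_inclusion i (eigFun hk ρ ev ψ l)
  rw [heig.inclusion_eigFun, inner_smul_right, orthonormal_iff_ite.1 heig.orthonormal] at h1
  have := (heig.sqrt_pos i).ne'
  by_cases h : i = l
  · subst h
    simp only [if_true, mul_one] at h1 ⊢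
    exact (mul_left_cancel₀ this ((mul_one _).trans h1)).symm
  · simp only [h, if_false, mul_zero] at h1 ⊢
    exact (mul_eq_zero.1 h1.symm).resolve_left this

lemma IsEigensystem.covOp_eigFun (heig : IsEigensystem (integralOp hk ρ) ev ψ) (i : ℕ) :
    covOp hk ρ (eigFun hk ρ ev ψ i) = (ev i / ρ.real Set.univ) • eigFun hk ρ ev ψ i := by
  have h1 : covOp hk ρ (eigFun hk ρ ev ψ i) = (ρ.real Set.univ)⁻¹ •
      ContinuousLinearMap.adjoint (inclusion hk ρ) (inclusion hk ρ (eigFun hk ρ ev ψ i)) := rfl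
  rw [h1, heig.inclusion_eigFun, map_smul, smul_smul, eigFun, smul_smul]
  congr 1
  have := (heig.sqrt_pos i).ne'
  have h2 := Real.mul_self_sqrt (heig.pos i).le
  field_simp
  rw [sq, h2]

lemma IsEigensystem.inclusion_eq_zero (heig : IsEigensystem (integralOp hk ρ) ev ψ) {y : H}
    (hy : ∀ i, ⟪eigFun hk ρ ev ψ i, y⟫_ℝ = 0) : inclusion hk ρ y = 0 := by
  have h1 : integralOp hk ρ (inclusion hk ρ y) = 0 := by
    refine (heig.hasSum _).unique ?_
    convert hasSum_zero using 2 with i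
    rw [heig.inner_inclusion, hy]
    simp
  have h2 : ContinuousLinearMap.adjoint (inclusion hk ρ) (inclusion hk ρ y) = 0 := by
    rw [← inner_self_eq_zero (𝕜 := ℝ), ContinuousLinearMap.adjoint_inner_left]
    change ⟪_, integralOp hk ρ (inclusion hk ρ y)⟫_ℝ = 0
    rw [h1, inner_zero_right]
  rw [← inner_self_eq_zero (𝕜 := ℝ), ← ContinuousLinearMap.adjoint_inner_left, h2, inner_zero_left]

/-- The range of the covariance operator lies in the closed span of the eigenfunctions, although
these need not be complete in `H`. -/
lemma IsEigensystem.covOp_mem (heig : IsEigensystem (integralOp hk ρ) ev ψ) (f : H) :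
    covOp hk ρ f ∈
      (Submodule.span ℝ (Set.range (eigFun hk ρ ev ψ))).topologicalClosure := by
  refine mem_closure_span_iff.2 fun y hy => ?_
  rw [inner_covOp, heig.inclusion_eq_zero hy, inner_zero_right, mul_zero]

/-- Functions of the RKHS that vanish `ρ`-almost everywhere vanish on the support of `ρ`, so the
kernel sections at almost all points lie in the closed span of the eigenfunctions. -/
lemma IsEigensystem.ae_kernSec_mem [HereditarilyLindelofSpace 𝕋]
    (heig : IsEigensystem (integralOp hk ρ) ev ψ) :
    ∀ᵐ s ∂ρ, kernSec H s ∈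
      (Submodule.span ℝ (Set.range (eigFun hk ρ ev ψ))).topologicalClosure := by
  filter_upwards [Measure.support_mem_ae (μ := ρ)] with s hs
  refine mem_closure_span_iff.2 fun y hy => ?_
  rw [real_inner_comm, inner_kernSec]
  have h1 : (y : 𝕋 → ℝ) =ᵐ[ρ] 0 := by
    have h2 := inclusion_ae_eq hk ρ y
    rw [heig.inclusion_eq_zero hy] at h2
    exact h2.symm.trans (Lp.coeFn_zero ℝ 2 ρ)
  by_contra hne
  have hopen : IsOpen {s : 𝕋 | y s ≠ 0} := isOpen_ne_fun (continuous_coe hk y) continuous_const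
  have h3 := (Measure.mem_support_iff_forall s).1 hs _ (hopen.mem_nhds hne)
  exact h3.ne' (ae_iff.1 h1)

/-- Bessel's inequality for the energy `⟪S f, f⟫ + l ‖f‖²` in the eigenbasis. -/
lemma IsEigensystem.sum_energy_le (heig : IsEigensystem (integralOp hk ρ) ev ψ) {l : ℝ}
    (hl : 0 ≤ l) (f : H) (s : Finset ℕ) :
    ∑ i ∈ s, (ev i / ρ.real Set.univ + l) * ⟪eigFun hk ρ ev ψ i, f⟫_ℝ ^ 2 ≤
      ⟪covOp hk ρ f, f⟫_ℝ + l * ‖f‖ ^ 2 := by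
  have h1 : ∑ i ∈ s, ⟪ψ i, inclusion hk ρ f⟫_ℝ ^ 2 ≤ ‖inclusion hk ρ f‖ ^ 2 := by
    simpa using heig.orthonormal.sum_inner_products_le (s := s) (inclusion hk ρ f)
  have h2 : ∑ i ∈ s, ⟪eigFun hk ρ ev ψ i, f⟫_ℝ ^ 2 ≤ ‖f‖ ^ 2 := by
    simpa using heig.orthonormal_eigFun.sum_inner_products_le (s := s) f
  rw [inner_covOp, real_inner_self_eq_norm_sq]
  calc _ = (ρ.real Set.univ)⁻¹ * ∑ i ∈ s, ⟪ψ i, inclusion hk ρ f⟫_ℝ ^ 2 +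
        l * ∑ i ∈ s, ⟪eigFun hk ρ ev ψ i, f⟫_ℝ ^ 2 := by
        rw [Finset.mul_sum, Finset.mul_sum, ← Finset.sum_add_distrib]
        refine Finset.sum_congr rfl fun i _ => ?_
        rw [heig.inner_inclusion, mul_pow, Real.sq_sqrt (heig.pos i).le]
        ring
    _ ≤ _ := by
        gcongr

lemma IsEigensystem.sum_eigFun_sq_le (heig : IsEigensystem (integralOp hk ρ) ev ψ) (s : Finset ℕ)
    (x : 𝕋) : ∑ i ∈ s, eigFun hk ρ ev ψ i x ^ 2 ≤ kern H x x := by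
  rw [← norm_kernSec_sq]
  simpa [inner_kernSec] using
    heig.orthonormal_eigFun.sum_inner_products_le (s := s) (kernSec H x)

lemma IsEigensystem.integral_eigFun_sq (heig : IsEigensystem (integralOp hk ρ) ev ψ) (i : ℕ) :
    ∫ x, eigFun hk ρ ev ψ i x ^ 2 ∂((ρ Set.univ)⁻¹ • ρ) = ev i / ρ.real Set.univ := by
  simp only [sq]
  rw [← inner_covOp_eq_integral hk, heig.covOp_eigFun, inner_smul_left, real_inner_self_eq_norm_sq,
    heig.orthonormal_eigFun.1]
  simp

lemma IsEigensystem.eigFun_ae_eq (heig : IsEigensystem (integralOp hk ρ) ev ψ) (i : ℕ) :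
    ⇑(eigFun hk ρ ev ψ i : H) =ᵐ[ρ] fun x => √(ev i) * ψ i x := by
  have h1 := inclusion_ae_eq hk ρ (eigFun hk ρ ev ψ i)
  rw [heig.inclusion_eigFun] at h1
  have h3 : (√(ev i) • ψ i : Lp ℝ 2 ρ) =ᵐ[ρ] √(ev i) • (ψ i : 𝕋 → ℝ) := Lp.coeFn_smul _ _
  filter_upwards [h1, h3] with x hx1 hx3
  rw [← hx1, hx3, Pi.smul_apply, smul_eq_mul]

lemma IsEigensystem.measure_ne_zero (heig : IsEigensystem (integralOp hk ρ) ev ψ) : ρ ≠ 0 := by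
  intro h0
  have h1 := heig.orthonormal.1 0
  have h2 : ∀ s, ρ s = 0 := fun s => by rw [h0]; rfl
  have h3 : ψ 0 = 0 := Lp.ext (ae_iff.2 (h2 _))
  rw [h3, norm_zero] at h1
  exact zero_ne_one h1

end Covariance

/-! ### Effective dimension under polynomial decay -/

section EffectiveDimension

/-- Comparison of the sum with the integral of the decreasing function that equals `1` up to `L` and
`(L / x) ^ b` afterwards. -/
lemma sum_min_rpow_le {b : ℝ} (hb : 1 < b) {L : ℝ} (hL : 0 < L) (s : Finset ℕ) :
    ∑ i ∈ s, min 1 ((L / ((i : ℝ) + 1)) ^ b) ≤ (1 + 1 / (b - 1)) * L := by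
  have hb0 : 0 < b := zero_lt_one.trans hb
  have hb1 : 0 < b - 1 := by linarith
  set f : ℝ → ℝ := fun x => if x ≤ L then 1 else (L / x) ^ b with hf
  have hle1 : ∀ x, L < x → (L / x) ^ b ≤ 1 := fun x hx => Real.rpow_le_one
    (div_nonneg hL.le (hL.trans hx).le) ((div_le_one (hL.trans hx)).2 hx.le) hb0.le
  have hf0 : ∀ x, 0 ≤ f x := fun x => by
    simp only [hf]
    split_ifs with h
    · exact zero_le_one
    · exact Real.rpow_nonneg (div_nonneg hL.le (hL.trans (not_le.1 h)).le) _
  have hanti : Antitone f := by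
    intro x y hxy
    simp only [hf]
    split_ifs with h1 h2 h2
    · exact le_rfl
    · exact absurd (hxy.trans h1) h2
    · exact hle1 y (not_le.1 h1)
    · have hx : 0 < x := hL.trans (not_le.1 h2)
      have hy : 0 < y := hx.trans_le hxy
      gcongr
  obtain ⟨N, hN⟩ := s.exists_nat_subset_range
  have e1 : ∑ i ∈ s, min 1 ((L / ((i : ℝ) + 1)) ^ b) ≤ ∑ i ∈ Finset.range N, f (0 + (i + 1 : ℕ)) := by
    refine (Finset.sum_le_sum_of_subset_of_nonneg hN fun i _ _ => ?_).trans
      (Finset.sum_le_sum fun i _ => ?_)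
    · exact le_min zero_le_one (Real.rpow_nonneg (by positivity) _)
    · simp only [hf, zero_add, Nat.cast_add, Nat.cast_one]
      split_ifs with h
      · exact min_le_left _ _
      · exact min_le_right _ _
  refine e1.trans ((hanti.antitoneOn _).sum_le_integral.trans ?_)
  set G : ℝ → ℝ := (Set.Ioc 0 L).indicator (fun _ => 1) +
    (Set.Ioi L).indicator (fun x => L ^ b * x ^ (-b)) with hG
  have i1 : IntegrableOn (fun _ : ℝ => (1 : ℝ)) (Set.Ioc 0 L) := by simp
  have i2 : IntegrableOn (fun x : ℝ => L ^ b * x ^ (-b)) (Set.Ioi L) :=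
    (integrableOn_Ioi_rpow_of_lt (by linarith) hL).const_mul _
  have iG1 : Integrable ((Set.Ioc 0 L).indicator fun _ : ℝ => (1 : ℝ)) :=
    (integrable_indicator_iff measurableSet_Ioc).2 i1
  have iG2 : Integrable ((Set.Ioi L).indicator fun x : ℝ => L ^ b * x ^ (-b)) :=
    (integrable_indicator_iff measurableSet_Ioi).2 i2
  have hfG : ∀ x, 0 < x → f x = G x := by
    intro x hx
    rcases le_or_gt x L with h | h
    · simp [hf, hG, h, hx]
    · simp only [hf, hG, not_le.2 h, if_false, Pi.add_apply, Set.indicator, Set.mem_Ioc,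
        Set.mem_Ioi, h, if_true, and_false, zero_add]
      rw [Real.div_rpow hL.le hx.le, Real.rpow_neg hx.le]
      rfl
  have hG0 : ∀ x, 0 ≤ G x := by
    intro x
    refine add_nonneg (Set.indicator_nonneg (fun _ _ => zero_le_one) _)
      (Set.indicator_nonneg (fun y hy => ?_) _)
    have : 0 < y := hL.trans hy
    positivity
  rw [intervalIntegral.integral_of_le (by positivity)]
  calc _ = ∫ x in Set.Ioc 0 (0 + (N : ℝ)), G x :=
        setIntegral_congr_fun measurableSet_Ioc fun x hx => hfG x hx.1
    _ ≤ ∫ x, G x := setIntegral_le_integral (iG1.add iG2) (ae_of_all _ hG0)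
    _ = _ := by
        rw [hG, integral_add' iG1 iG2, integral_indicator measurableSet_Ioc,
          integral_indicator measurableSet_Ioi, integral_const_mul,
          integral_Ioi_rpow_of_lt (by linarith) hL]
        simp only [integral_const, MeasurableSet.univ, measureReal_restrict_apply, Set.univ_inter,
          Real.volume_real_Ioc_of_le hL.le, smul_eq_mul, mul_one, sub_zero]
        rw [Real.rpow_add hL, Real.rpow_one, Real.rpow_neg hL.le]
        have : -b + 1 ≠ 0 := by linarith
        have := hb1.ne'
        have := (Real.rpow_pos_of_pos hL b).ne'
        field_simp
        ring

/-- The effective dimension `∑ i, σ_i / (σ_i + l)` is of order `l ^ (-1 / b)`. -/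
lemma exists_effectiveDimension_le {b : ℝ} (hb : 1 < b) {σ : ℕ → ℝ} (hσ : ∀ i, 0 < σ i) {c : ℝ}
    (hc : 0 < c) (hdec : ∀ i : ℕ, σ i ≤ c * ((i : ℝ) + 1) ^ (-b)) :
    ∃ C : ℝ, 0 < C ∧ ∀ l : ℝ, 0 < l → ∀ s : Finset ℕ,
      ∑ i ∈ s, (σ i + l)⁻¹ * σ i ≤ C * l ^ (-(1 / b)) := by
  have hb0 : 0 < b := zero_lt_one.trans hb
  have hb1 : 0 < b - 1 := by linarith
  refine ⟨(1 + 1 / (b - 1)) * c ^ (1 / b), by positivity, fun l hl s => ?_⟩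
  have hL : 0 < (c / l) ^ (1 / b) := by positivity
  have h1 := sum_min_rpow_le hb hL s
  have e1 : (c / l) ^ (1 / b) = c ^ (1 / b) * l ^ (-(1 / b)) := by
    rw [Real.div_rpow hc.le hl.le, Real.rpow_neg hl.le]
    rfl
  rw [e1, ← mul_assoc, ← e1] at h1
  refine le_trans (Finset.sum_le_sum fun i _ => le_min ?_ ?_) h1
  · have := hσ i
    rw [inv_mul_le_iff₀ (by positivity)]
    linarith
  · have hi : (0 : ℝ) < (i : ℝ) + 1 := by positivity
    have := hσ i
    calc (σ i + l)⁻¹ * σ i ≤ l⁻¹ * (c * ((i : ℝ) + 1) ^ (-b)) := by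
          gcongr
          · linarith
          · exact hdec i
      _ = _ := by
          rw [Real.div_rpow hL.le hi.le, ← Real.rpow_mul (by positivity), one_div_mul_cancel hb0.ne',
            Real.rpow_one, Real.rpow_neg hi.le]
          ring

end EffectiveDimension

/-! ### Bounds for the regularizing function and its residual -/

section Regularization

/-- The regularizing function with the value at `0` set to `0`: its defining bounds concern positive
arguments only, and `g_l(Ŝ) V` does not depend on `g_l(0)` since `V` lies in the range of `Ŝ`. -/
def filterFun (g : ℝ → ℝ → ℝ) (l x : ℝ) : ℝ := if x = 0 then 0 else g l x

/-- The residual `1 - σ g_l(σ)`, with value `1` at `0`. -/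
def residual (g : ℝ → ℝ → ℝ) (l x : ℝ) : ℝ := 1 - filterFun g l x * x

lemma residual_zero (g : ℝ → ℝ → ℝ) (l : ℝ) : residual g l 0 = 1 := by
  simp [residual]

variable {a : ℝ} {g : ℝ → ℝ → ℝ}

lemma IsRegularizationFamily.exists_filterFun_le (hg : IsRegularizationFamily a g) :
    ∃ B : ℝ, 0 ≤ B ∧ ∀ l ∈ Set.Ioc 0 a, ∀ x ∈ Set.Icc 0 a, (x + l) * |filterFun g l x| ≤ B := by
  obtain ⟨a₁, h1, hb1⟩ := hg.bound_mul
  obtain ⟨a₂, h2, hb2⟩ := hg.bound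
  refine ⟨a₁ + a₂, by positivity, fun l hl x hx => ?_⟩
  rcases hx.1.eq_or_lt with rfl | hx0
  · simp only [filterFun, if_true, abs_zero, mul_zero]
    positivity
  · rw [filterFun, if_neg hx0.ne', add_mul]
    have k1 := hb1 l hl x ⟨hx0, hx.2⟩
    have k2 := hb2 l hl x ⟨hx0, hx.2⟩
    rw [abs_mul, abs_of_pos hx0] at k1
    rw [le_div_iff₀ hl.1, mul_comm] at k2
    exact add_le_add k1 k2

lemma QualifiesAt.exists_residual_le {p : ℝ} (hp : 0 ≤ p) (h : QualifiesAt a g p) :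
    ∃ B : ℝ, 0 ≤ B ∧ ∀ l ∈ Set.Ioc 0 a, ∀ x ∈ Set.Icc 0 a, |residual g l x| * x ^ p ≤ B * l ^ p := by
  obtain ⟨ω, hω⟩ := h
  refine ⟨max ω 1, le_max_of_le_right zero_le_one, fun l hl x hx => ?_⟩
  have hlp : 0 ≤ l ^ p := Real.rpow_nonneg hl.1.le p
  rcases hx.1.eq_or_lt with rfl | hx0
  · rw [residual_zero, abs_one, one_mul]
    rcases hp.eq_or_lt with rfl | hp0
    · simp
    · rw [Real.zero_rpow hp0.ne']
      positivity
  · rw [residual, filterFun, if_neg hx0.ne']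
    exact (hω l hl x ⟨hx0, hx.2⟩).trans (mul_le_mul_of_nonneg_right (le_max_left _ _) hlp)

lemma IsQualification.qualifiesAt {ν : ℝ≥0∞} (hν : IsQualification a g ν) {p : ℝ} (hp : 0 ≤ p)
    (h : ENNReal.ofReal p ≤ ν) : QualifiesAt a g p := by
  have := (hν p.toNNReal).2 h
  rwa [Real.coe_toNNReal p hp] at this

lemma IsQualification.exists_sqrt_residual_le {ν : ℝ≥0∞} (hν : IsQualification a g ν) {p : ℝ}
    (hp : 0 ≤ p) (h : ENNReal.ofReal (p + 1 / 2) ≤ ν) :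
    ∃ B : ℝ, 0 ≤ B ∧ ∀ l ∈ Set.Ioc 0 a, ∀ x ∈ Set.Icc 0 a,
      √(x + l) * |residual g l x| * x ^ p ≤ B * l ^ (p + 1 / 2) := by
  obtain ⟨B₁, h1, hB1⟩ := (hν.qualifiesAt hp ((ENNReal.ofReal_le_ofReal (by linarith)).trans
    h)).exists_residual_le hp
  obtain ⟨B₂, h2, hB2⟩ := (hν.qualifiesAt (by linarith) h).exists_residual_le (by linarith)
  refine ⟨B₂ + B₁, by positivity, fun l hl x hx => ?_⟩
  have hs : √(x + l) ≤ x ^ ((1 : ℝ) / 2) + l ^ ((1 : ℝ) / 2) := by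
    rw [← Real.sqrt_eq_rpow, ← Real.sqrt_eq_rpow]
    refine Real.sqrt_le_iff.2 ⟨by positivity, ?_⟩
    nlinarith [Real.sq_sqrt hx.1, Real.sq_sqrt hl.1.le, Real.sqrt_nonneg x, Real.sqrt_nonneg l,
      mul_nonneg (Real.sqrt_nonneg x) (Real.sqrt_nonneg l)]
  have hxp : 0 ≤ x ^ p := Real.rpow_nonneg hx.1 p
  calc _ ≤ (x ^ ((1 : ℝ) / 2) + l ^ ((1 : ℝ) / 2)) * |residual g l x| * x ^ p := by gcongr
    _ = |residual g l x| * x ^ (p + 1 / 2) + l ^ ((1 : ℝ) / 2) * (|residual g l x| * x ^ p) := by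
        rw [Real.rpow_add_of_nonneg hx.1 hp (by norm_num)]
        ring
    _ ≤ B₂ * l ^ (p + 1 / 2) + l ^ ((1 : ℝ) / 2) * (B₁ * l ^ p) := by
        have := Real.rpow_nonneg hl.1.le ((1 : ℝ) / 2)
        exact add_le_add (hB2 l hl x hx) (mul_le_mul_of_nonneg_left (hB1 l hl x hx) this)
    _ = _ := by
        rw [Real.rpow_add hl.1]
        ring

lemma IsQualification.exists_mul_residual_le {ν : ℝ≥0∞} (hν : IsQualification a g ν)
    (hν1 : 1 ≤ ν) :
    ∃ B : ℝ, 0 ≤ B ∧ ∀ l ∈ Set.Ioc 0 a, ∀ x ∈ Set.Icc 0 a,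
      (x + l) * |residual g l x| ≤ B * l := by
  obtain ⟨B₁, h1, hB1⟩ := (hν.qualifiesAt le_rfl (by simp)).exists_residual_le le_rfl
  obtain ⟨B₂, h2, hB2⟩ := (hν.qualifiesAt zero_le_one (by simpa using hν1)).exists_residual_le
    zero_le_one
  refine ⟨B₂ + B₁, by positivity, fun l hl x hx => ?_⟩
  have k1 := hB1 l hl x hx
  have k2 := hB2 l hl x hx
  simp only [Real.rpow_zero, Real.rpow_one, mul_one] at k1 k2
  calc _ = |residual g l x| * x + l * |residual g l x| := by ring
    _ ≤ B₂ * l + l * B₁ := by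
        have := hl.1
        gcongr
    _ = _ := by ring

end Regularization

/-! ### Pointwise consequences of the power space embedding -/

section Embedding

variable {𝕋 : Type*} [MeasurableSpace 𝕋] {ρ : Measure 𝕋} {ev : ℕ → ℝ} {ψ : ℕ → Lp ℝ 2 ρ} {α : ℝ}

/-- The embedding tested with finitely supported coefficient sequences. -/
lemma PowerEmbedding.exists_ae_finite (h : PowerEmbedding ev ψ α) :
    ∃ Z : ℝ, 0 < Z ∧ ∀ (s : Finset ℕ) (c : ℕ → ℝ), ∀ᵐ x ∂ρ,
      |∑ i ∈ s, c i * (ev i ^ α * ψ i x)| ≤ Z * √(∑ i ∈ s, c i ^ 2) := by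
  classical
  obtain ⟨Z, hZ, hemb⟩ := h
  refine ⟨Z, hZ, fun s c => ?_⟩
  set A : lp (fun _ : ℕ => ℝ) 2 := ∑ i ∈ s, lp.single 2 i (c i) with hA
  have hAi : ∀ i, A i = if i ∈ s then c i else 0 := fun i => by
    rw [hA, lp.coeFn_sum, Finset.sum_apply]
    simp [lp.single_apply, Pi.single_apply]
  have hAn : ‖A‖ = √(∑ i ∈ s, c i ^ 2) := by
    have h1 := lp.norm_sum_single (p := 2) (E := fun _ : ℕ => ℝ) (by norm_num) c s
    rw [eq_comm, Real.sqrt_eq_iff_mul_self_eq (Finset.sum_nonneg fun _ _ => sq_nonneg _)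
      (norm_nonneg _), ← sq]
    simpa [hA] using h1.symm
  set f : Lp ℝ 2 ρ := ∑ i ∈ s, (c i * ev i ^ α) • ψ i with hf
  have hsum : IsPowerSpaceElement ev ψ α A f := by
    have : f = ∑ i ∈ s, (A i * ev i ^ α) • ψ i :=
      Finset.sum_congr rfl fun i hi => by rw [hAi, if_pos hi]
    rw [this]
    refine hasSum_sum_of_ne_finset_zero fun i hi => ?_
    rw [hAi, if_neg hi, zero_mul, zero_smul]
  have h1 := hemb A f hsum
  rw [eLpNorm_exponent_top, hAn] at h1
  have h2 : ∀ᵐ x ∂ρ, f x = ∑ i ∈ s, c i * (ev i ^ α * ψ i x) := by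
    have h3 : ∀ i, ∀ᵐ x ∂ρ, ((c i * ev i ^ α) • ψ i : Lp ℝ 2 ρ) x =
        ((c i * ev i ^ α) • (ψ i : 𝕋 → ℝ)) x := fun i => Lp.coeFn_smul _ _
    filter_upwards [Lp.coeFn_finsetSum s fun i => (c i * ev i ^ α) • ψ i, ae_all_iff.2 h3]
      with x hx1 hx2
    rw [hf, hx1, Finset.sum_apply]
    refine Finset.sum_congr rfl fun i _ => ?_
    rw [hx2, Pi.smul_apply, smul_eq_mul, mul_assoc]
  filter_upwards [h2, ae_le_eLpNormEssSup (f := f) (μ := ρ)] with x hx1 hx2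
  rw [← hx1]
  have h4 := hx2.trans h1
  rw [Real.enorm_eq_ofReal_abs] at h4
  exact (ENNReal.ofReal_le_ofReal_iff (by positivity)).1 h4

/-- The embedding into `L_∞` bounds `∑ i, ev_i ^ (2 α) ψ_i(x) ^ 2` for almost every `x`: test it
with a countable dense set of coefficient sequences. -/
lemma PowerEmbedding.exists_ae_sum_sq_le (h : PowerEmbedding ev ψ α) :
    ∃ Z : ℝ, 0 < Z ∧ ∀ᵐ x ∂ρ, ∀ s : Finset ℕ, ∑ i ∈ s, (ev i ^ α * ψ i x) ^ 2 ≤ Z ^ 2 := by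
  obtain ⟨Z, hZ, hfin⟩ := h.exists_ae_finite
  refine ⟨Z, hZ, ?_⟩
  have h1 : ∀ᵐ x ∂ρ, ∀ (s : Finset ℕ) (n : ℕ),
      |∑ i ∈ s, TopologicalSpace.denseSeq (ℕ → ℝ) n i * (ev i ^ α * ψ i x)| ≤
        Z * √(∑ i ∈ s, TopologicalSpace.denseSeq (ℕ → ℝ) n i ^ 2) :=
    ae_all_iff.2 fun s => ae_all_iff.2 fun n => hfin s _
  filter_upwards [h1] with x hx s
  set u : ℕ → ℝ := fun i => ev i ^ α * ψ i x with hu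
  have hclosed : IsClosed {c : ℕ → ℝ | |∑ i ∈ s, c i * u i| ≤ Z * √(∑ i ∈ s, c i ^ 2)} :=
    isClosed_le (by fun_prop) (by fun_prop)
  have hall : ∀ c : ℕ → ℝ, |∑ i ∈ s, c i * u i| ≤ Z * √(∑ i ∈ s, c i ^ 2) := fun c =>
    (TopologicalSpace.denseRange_denseSeq (ℕ → ℝ)).induction_on
      (p := fun c => |∑ i ∈ s, c i * u i| ≤ Z * √(∑ i ∈ s, c i ^ 2)) c hclosed fun n => hx s n
  have h2 := hall u
  have e1 : ∑ i ∈ s, u i * u i = ∑ i ∈ s, u i ^ 2 := by simp only [sq]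
  have hnn : 0 ≤ ∑ i ∈ s, u i ^ 2 := Finset.sum_nonneg fun _ _ => sq_nonneg _
  rw [e1, abs_of_nonneg hnn] at h2
  nth_rewrite 1 [← Real.mul_self_sqrt hnn] at h2
  rcases (Real.sqrt_nonneg (∑ i ∈ s, u i ^ 2)).eq_or_lt with h0 | h0
  · rw [eq_comm, Real.sqrt_eq_zero hnn] at h0
    rw [h0]
    positivity
  · exact (Real.sqrt_le_left hZ.le).1 (le_of_mul_le_mul_right h2 h0)

end Embedding

/-! ### The empirical operator and its fluctuation -/

lemma tsum_ofReal_le_of_sum_le {x : ℕ → ℝ} {B : ℝ} (hx : ∀ i, 0 ≤ x i)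
    (h : ∀ s : Finset ℕ, ∑ i ∈ s, x i ≤ B) : ∑' i, ENNReal.ofReal (x i) ≤ ENNReal.ofReal B := by
  rw [ENNReal.tsum_eq_iSup_sum]
  refine iSup_le fun s => ?_
  rw [← ENNReal.ofReal_sum_of_nonneg fun i _ => hx i]
  exact ENNReal.ofReal_le_ofReal (h s)

lemma sum_le_of_tsum_ofReal_le {x : ℕ → ℝ} {B : ℝ} (hB : 0 ≤ B) (hx : ∀ i, 0 ≤ x i)
    (h : ∑' i, ENNReal.ofReal (x i) ≤ ENNReal.ofReal B) (s : Finset ℕ) : ∑ i ∈ s, x i ≤ B := by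
  have h1 := (ENNReal.sum_le_tsum (f := fun i => ENNReal.ofReal (x i)) s).trans h
  rw [← ENNReal.ofReal_sum_of_nonneg fun i _ => hx i] at h1
  exact (ENNReal.ofReal_le_ofReal_iff hB).1 h1

section Empirical

variable {𝕋 : Type*} {H : Type*} [NormedAddCommGroup H] [InnerProductSpace ℝ H] [CompleteSpace H]
  [RKHS ℝ H 𝕋 ℝ]

lemma empiricalOp_apply (D : Design) (τ : ℕ → ℕ → 𝕋) (f : H) :
    empiricalOp H D τ f = ∑ p : D.Index, (D.weight p *
      ⟪kernSec H (τ p.1 p.2), f⟫_ℝ) • kernSec H (τ p.1 p.2) := by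
  simp only [empiricalOp, Fintype.sum_sigma, smul_apply, sum_apply, Finset.smul_sum,
    InnerProductSpace.rankOne_apply, smul_smul, Design.weight, mul_assoc]

lemma empiricalVec_eq (D : Design) (τ : ℕ → ℕ → 𝕋) (y : ℕ → ℕ → ℝ) :
    empiricalVec H D τ y = ∑ p : D.Index, (D.weight p * y p.1 p.2) • kernSec H (τ p.1 p.2) := by
  simp only [empiricalVec, Fintype.sum_sigma, Finset.smul_sum, smul_smul, Design.weight, mul_assoc]

lemma inner_empiricalOp (D : Design) (τ : ℕ → ℕ → 𝕋) (f y : H) :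
    ⟪empiricalOp H D τ f, y⟫_ℝ =
      ∑ p : D.Index, D.weight p * (f (τ p.1 p.2) * y (τ p.1 p.2)) := by
  rw [empiricalOp_apply, sum_inner]
  refine Finset.sum_congr rfl fun p _ => ?_
  rw [inner_smul_left, real_inner_comm, inner_kernSec, real_inner_comm, inner_kernSec]
  simp only [RCLike.conj_to_real]
  ring

lemma empiricalOp_symm (D : Design) (τ : ℕ → ℕ → 𝕋) (f y : H) :
    ⟪empiricalOp H D τ f, y⟫_ℝ = ⟪f, empiricalOp H D τ y⟫_ℝ := by
  rw [inner_empiricalOp, real_inner_comm, inner_empiricalOp]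
  simp only [mul_comm]

lemma inner_empiricalVec_sub (D : Design) (τ : ℕ → ℕ → 𝕋) (y : ℕ → ℕ → ℝ) (f e : H) :
    ⟪empiricalVec H D τ y - empiricalOp H D τ f, e⟫_ℝ =
      ∑ p : D.Index, D.weight p * ((y p.1 p.2 - f (τ p.1 p.2)) * e (τ p.1 p.2)) := by
  rw [inner_sub_left, inner_empiricalOp, empiricalVec_eq, sum_inner, ← Finset.sum_sub_distrib]
  refine Finset.sum_congr rfl fun p _ => ?_
  rw [inner_smul_left, real_inner_comm, inner_kernSec]
  simp only [RCLike.conj_to_real]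
  ring

end Empirical

section Fluctuation

variable {𝕋 : Type*} {H : Type*} [NormedAddCommGroup H] [InnerProductSpace ℝ H] [CompleteSpace H]
  [RKHS ℝ H 𝕋 ℝ]
variable [TopologicalSpace 𝕋] [CompactSpace 𝕋] [MeasurableSpace 𝕋] [BorelSpace 𝕋]
variable {hk : Continuous fun p : 𝕋 × 𝕋 => kern H p.1 p.2} {ρ : Measure 𝕋} [IsFiniteMeasure ρ]
variable {ev : ℕ → ℝ} {ψ : ℕ → Lp ℝ 2 ρ}

lemma IsEigensystem.lintegral_eigFun_sq (heig : IsEigensystem (integralOp hk ρ) ev ψ) {a : ℝ}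
    (ha : 0 ≤ a) (hka : ∀ s : 𝕋, kern H s s ≤ a) [IsProbabilityMeasure ((ρ Set.univ)⁻¹ • ρ)]
    (i : ℕ) : ∫⁻ x, ‖eigFun hk ρ ev ψ i x‖ₑ ^ 2 ∂((ρ Set.univ)⁻¹ • ρ) =
      ENNReal.ofReal (ev i / ρ.real Set.univ) := by
  rw [← heig.integral_eigFun_sq i, lintegral_enorm_sq_eq]
  exact MemLp.of_bound (continuous_coe hk _).measurable.aestronglyMeasurable
    (√a * ‖(eigFun hk ρ ev ψ i : H)‖) (ae_of_all _ fun x => abs_apply_le ha hka _ x)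

/-- Bessel's inequality in the weighted coordinates: functionals `e ↦ ∫ g e` with `g` in `L²` are
bounded in the dual energy norm by the `L²` norm of `g`. -/
lemma IsEigensystem.sum_integral_mul_sq_le (heig : IsEigensystem (integralOp hk ρ) ev ψ) {l : ℝ}
    (hl : 0 ≤ l) {g : 𝕋 → ℝ} (hg : MemLp g 2 ρ) (s : Finset ℕ) :
    ∑ i ∈ s, (ev i / ρ.real Set.univ + l)⁻¹ *
        (∫ x, g x * eigFun hk ρ ev ψ i x ∂((ρ Set.univ)⁻¹ • ρ)) ^ 2 ≤
      ∫ x, g x ^ 2 ∂((ρ Set.univ)⁻¹ • ρ) := by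
  have hR : 0 < ρ.real Set.univ := by
    rw [measureReal_def]
    exact ENNReal.toReal_pos (by simpa using heig.measure_ne_zero) (measure_ne_top _ _)
  set R := ρ.real Set.univ with hRdef
  have e0 : (ρ Set.univ)⁻¹.toReal = R⁻¹ := ENNReal.toReal_inv _
  have e1 : ∀ i, ∫ x, g x * eigFun hk ρ ev ψ i x ∂((ρ Set.univ)⁻¹ • ρ) =
      R⁻¹ * (√(ev i) * ⟪ψ i, hg.toLp g⟫_ℝ) := by
    intro i
    rw [integral_smul_measure, e0, smul_eq_mul, L2.inner_def, ← integral_const_mul (√(ev i))]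
    congr 1
    refine integral_congr_ae ?_
    filter_upwards [heig.eigFun_ae_eq i, hg.coeFn_toLp] with x hx1 hx2
    rw [hx1, hx2]
    simp only [RCLike.inner_apply, RCLike.conj_to_real]
    ring
  have e2 : ∫ x, g x ^ 2 ∂((ρ Set.univ)⁻¹ • ρ) = R⁻¹ * ‖hg.toLp g‖ ^ 2 := by
    rw [integral_smul_measure, e0, smul_eq_mul, ← real_inner_self_eq_norm_sq, L2.inner_def]
    congr 1
    refine integral_congr_ae ?_
    filter_upwards [hg.coeFn_toLp] with x hx
    rw [hx]
    simp [sq]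
  have h1 : ∑ i ∈ s, ⟪ψ i, hg.toLp g⟫_ℝ ^ 2 ≤ ‖hg.toLp g‖ ^ 2 := by
    simpa using heig.orthonormal.sum_inner_products_le (s := s) (hg.toLp g)
  rw [e2]
  refine le_trans ?_ (mul_le_mul_of_nonneg_left h1 (inv_nonneg.2 hR.le))
  rw [Finset.mul_sum]
  refine Finset.sum_le_sum fun i _ => ?_
  have hev := heig.pos i
  rw [e1, mul_pow, mul_pow, Real.sq_sqrt hev.le]
  calc _ = ((ev i / R + l)⁻¹ * (ev i / R)) * (R⁻¹ * ⟪ψ i, hg.toLp g⟫_ℝ ^ 2) := by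
        ring
    _ ≤ 1 * (R⁻¹ * ⟪ψ i, hg.toLp g⟫_ℝ ^ 2) := by
        refine mul_le_mul_of_nonneg_right ?_ (by positivity)
        have : 0 < ev i / R := div_pos hev hR
        rw [inv_mul_le_iff₀ (by positivity)]
        linarith
    _ = _ := one_mul _

variable {S Ω : Type*} [MeasurableSpace S] [MeasurableSpace Ω]
variable {Q : Measure S} {η : Measure ℝ} {P : Measure Ω}
variable {ξ : ℕ → Ω → S} {t : ℕ → ℕ → Ω → 𝕋} {ε : ℕ → ℕ → Ω → ℝ}
variable [IsProbabilityMeasure P] [IsProbabilityMeasure Q] [IsProbabilityMeasure η]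
  [IsProbabilityMeasure ((ρ Set.univ)⁻¹ • ρ)]

/-- Second moment of a weighted Hilbert–Schmidt norm of `Ŝ - S`. The weights `c = 1` give the plain
Hilbert–Schmidt norm, the weights `(σ_i + l)⁻¹` the norm of `(S + l)^(-1/2) (Ŝ - S) (S + l)^(-1/2)`,
with `N` the effective dimension and `B` a bound for the leverage. -/
lemma IsSample.lintegral_empiricalOp_sub_le (h : IsSample Q ((ρ Set.univ)⁻¹ • ρ) η P ξ t ε)
    (heig : IsEigensystem (integralOp hk ρ) ev ψ) {a : ℝ} (ha : 0 ≤ a)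
    (hka : ∀ s : 𝕋, kern H s s ≤ a) (D : Design) {c : ℕ → ℝ} (hc : ∀ i, 0 < c i) {B N : ℝ}
    (hB0 : 0 ≤ B) (hB : ∀ᵐ x ∂ρ, ∀ s : Finset ℕ, ∑ i ∈ s, c i * eigFun hk ρ ev ψ i x ^ 2 ≤ B)
    (hN : ∀ s : Finset ℕ, ∑ i ∈ s, c i * (ev i / ρ.real Set.univ) ≤ N) :
    ∫⁻ ω, ∑' i, ∑' l, ENNReal.ofReal (c i * c l * ⟪(empiricalOp H D (fun i j => t i j ω)
        - covOp hk ρ) (eigFun hk ρ ev ψ i), eigFun hk ρ ev ψ l⟫_ℝ ^ 2) ∂P ≤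
      ENNReal.ofReal (2 * D.size⁻¹ * B * N) := by
  set e : ℕ → H := eigFun hk ρ ev ψ with he
  set π : Measure 𝕋 := (ρ Set.univ)⁻¹ • ρ with hπ
  have hem : ∀ i, Measurable (e i) := fun i => (continuous_coe hk (e i)).measurable
  have htm := h.measurable_point
  have hs : 0 ≤ D.size⁻¹ := inv_nonneg.2 (zero_le_one.trans D.one_le_size)
  have hform : ∀ ω i l, ⟪(empiricalOp H D (fun i j => t i j ω) - covOp hk ρ) (e i), e l⟫_ℝ =
      ∑ p : D.Index, D.weight p * (e i (t p.1 p.2 ω) * e l (t p.1 p.2 ω))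
        - ∫ x, e i x * e l x ∂π := by
    intro ω i l
    rw [sub_apply, inner_sub_left, inner_empiricalOp, inner_covOp_eq_integral]
  have hmeas : ∀ i l, Measurable fun ω => ENNReal.ofReal (c i * c l *
      ⟪(empiricalOp H D (fun i j => t i j ω) - covOp hk ρ) (e i), e l⟫_ℝ ^ 2) := by
    intro i l
    simp only [hform]
    fun_prop
  have hterm : ∀ i l, ∫⁻ ω, ENNReal.ofReal (c i * c l *
      ⟪(empiricalOp H D (fun i j => t i j ω) - covOp hk ρ) (e i), e l⟫_ℝ ^ 2) ∂P ≤
      2 * ENNReal.ofReal D.size⁻¹ * ∫⁻ x, (ENNReal.ofReal (c i) * ‖e i x‖ₑ ^ 2) *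
        (ENNReal.ofReal (c l) * ‖e l x‖ₑ ^ 2) ∂π := by
    intro i l
    set φ : S × 𝕋 × ℝ → ℝ := fun z => e i z.2.1 * e l z.2.1 with hφ
    have hφm : Measurable φ := by fun_prop
    have hφ2 : MemLp φ 2 (Q.prod (π.prod η)) :=
      MemLp.of_bound hφm.aestronglyMeasurable ((√a * ‖e i‖) * (√a * ‖e l‖))
        (ae_of_all _ fun z => by
          rw [norm_mul]
          exact mul_le_mul (abs_apply_le ha hka _ _) (abs_apply_le ha hka _ _) (abs_nonneg _)
            (by positivity))
    have hcm : ∀ x, curveMean π η φ x = ∫ y, e i y * e l y ∂π := by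
      intro x
      have := integral_fun_fst (μ := π) (ν := η) (f := fun y => e i y * e l y)
      rw [probReal_univ, one_smul] at this
      exact this
    have h1 := h.lintegral_weighted_sum_sq_le D hφm hφ2
    simp only [hcm, integral_const, probReal_univ, one_smul, sub_self, enorm_zero, ne_eq,
      OfNat.ofNat_ne_zero, not_false_eq_true, zero_pow, lintegral_zero, mul_zero, add_zero] at h1
    have h2 : ∫⁻ z, ‖φ z‖ₑ ^ 2 ∂(Q.prod (π.prod η)) = ∫⁻ x, ‖e i x * e l x‖ₑ ^ 2 ∂π := by
      have hmp : MeasurePreserving (fun z : S × 𝕋 × ℝ => z.2.1) (Q.prod (π.prod η)) π :=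
        measurePreserving_fst.comp measurePreserving_snd
      exact hmp.lintegral_comp (f := fun x => ‖e i x * e l x‖ₑ ^ 2) (by fun_prop)
    rw [h2] at h1
    have e1 : ∀ ω, ENNReal.ofReal (c i * c l *
        ⟪(empiricalOp H D (fun i j => t i j ω) - covOp hk ρ) (e i), e l⟫_ℝ ^ 2) =
        ENNReal.ofReal (c i * c l) * ‖∑ p : D.Index, D.weight p *
          (e i (t p.1 p.2 ω) * e l (t p.1 p.2 ω)) - ∫ x, e i x * e l x ∂π‖ₑ ^ 2 := by
      intro ω
      rw [hform, ENNReal.ofReal_mul (mul_nonneg (hc i).le (hc l).le), enorm_sq_eq_ofReal]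
    simp only [e1]
    rw [lintegral_const_mul' _ _ ENNReal.ofReal_ne_top]
    calc _ ≤ ENNReal.ofReal (c i * c l) *
          (2 * (ENNReal.ofReal D.size⁻¹ * ∫⁻ x, ‖e i x * e l x‖ₑ ^ 2 ∂π)) := by gcongr
      _ = 2 * ENNReal.ofReal D.size⁻¹ *
          ∫⁻ x, ENNReal.ofReal (c i * c l) * ‖e i x * e l x‖ₑ ^ 2 ∂π := by
          rw [lintegral_const_mul' _ _ ENNReal.ofReal_ne_top]
          ring
      _ = _ := by
          congr 1
          refine lintegral_congr fun x => ?_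
          rw [enorm_mul, mul_pow, ENNReal.ofReal_mul (hc i).le]
          ring
  rw [lintegral_tsum fun i => (Measurable.tsum fun l => hmeas i l).aemeasurable]
  simp only [lintegral_tsum fun l => (hmeas _ l).aemeasurable]
  have hBπ : ∀ᵐ x ∂π, ∑' i, ENNReal.ofReal (c i) * ‖e i x‖ₑ ^ 2 ≤ ENNReal.ofReal B := by
    have : ∀ᵐ x ∂π, ∀ s : Finset ℕ, ∑ i ∈ s, c i * e i x ^ 2 ≤ B := Measure.ae_smul_measure hB _
    filter_upwards [this] with x hx
    have h1 := tsum_ofReal_le_of_sum_le (fun i => mul_nonneg (hc i).le (sq_nonneg (e i x))) hx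
    simpa only [ENNReal.ofReal_mul (hc _).le, ← enorm_sq_eq_ofReal] using h1
  have hNπ : ∫⁻ x, ∑' l, ENNReal.ofReal (c l) * ‖e l x‖ₑ ^ 2 ∂π ≤ ENNReal.ofReal N := by
    rw [lintegral_tsum fun l => by fun_prop]
    have hev : ∀ l, 0 ≤ ev l / ρ.real Set.univ := fun l =>
      div_nonneg (heig.pos l).le measureReal_nonneg
    have h1 := tsum_ofReal_le_of_sum_le (fun l => mul_nonneg (hc l).le (hev l)) hN
    refine le_trans (le_of_eq (tsum_congr fun l => ?_)) h1
    rw [lintegral_const_mul' _ _ ENNReal.ofReal_ne_top, heig.lintegral_eigFun_sq ha hka,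
      ENNReal.ofReal_mul (hc l).le]
  calc _ ≤ ∑' i, ∑' l, 2 * ENNReal.ofReal D.size⁻¹ *
        ∫⁻ x, (ENNReal.ofReal (c i) * ‖e i x‖ₑ ^ 2) * (ENNReal.ofReal (c l) * ‖e l x‖ₑ ^ 2) ∂π :=
        ENNReal.tsum_le_tsum fun i => ENNReal.tsum_le_tsum fun l => hterm i l
    _ = 2 * ENNReal.ofReal D.size⁻¹ * ∫⁻ x, (∑' i, ENNReal.ofReal (c i) * ‖e i x‖ₑ ^ 2) *
          (∑' l, ENNReal.ofReal (c l) * ‖e l x‖ₑ ^ 2) ∂π := by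
        simp only [ENNReal.tsum_mul_left]
        congr 1
        simp only [← ENNReal.tsum_mul_right]
        rw [lintegral_tsum fun i => by fun_prop]
        refine tsum_congr fun i => ?_
        simp only [← ENNReal.tsum_mul_left]
        rw [lintegral_tsum fun l => by fun_prop]
    _ ≤ 2 * ENNReal.ofReal D.size⁻¹ * ∫⁻ x, ENNReal.ofReal B *
          (∑' l, ENNReal.ofReal (c l) * ‖e l x‖ₑ ^ 2) ∂π := by
        gcongr 2 * ENNReal.ofReal D.size⁻¹ * ?_
        refine lintegral_mono_ae ?_
        filter_upwards [hBπ] with x hx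
        gcongr
    _ ≤ 2 * ENNReal.ofReal D.size⁻¹ * (ENNReal.ofReal B * ENNReal.ofReal N) := by
        rw [lintegral_const_mul' _ _ ENNReal.ofReal_ne_top]
        gcongr
    _ = _ := by
        rw [ENNReal.ofReal_mul (by positivity), ENNReal.ofReal_mul (by positivity),
          ENNReal.ofReal_mul zero_le_two]
        simp [mul_assoc]

end Fluctuation

/-! ### The noise vector -/

lemma enorm_add_sub_sq_le (x y z : ℝ) :
    ‖x + y - z‖ₑ ^ 2 ≤ 3 * (‖x‖ₑ ^ 2 + ‖y‖ₑ ^ 2 + ‖z‖ₑ ^ 2) := by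
  simp only [enorm_sq_eq_ofReal]
  rw [← ENNReal.ofReal_add (sq_nonneg x) (sq_nonneg y), ← ENNReal.ofReal_add (by positivity)
    (sq_nonneg z), show (3 : ℝ≥0∞) = ENNReal.ofReal 3 by simp, ← ENNReal.ofReal_mul (by norm_num)]
  exact ENNReal.ofReal_le_ofReal
    (by nlinarith [sq_nonneg (x - y), sq_nonneg (x + z), sq_nonneg (y + z)])

lemma memLp_of_memLp_normalized {𝕋 : Type*} [MeasurableSpace 𝕋] {ρ : Measure 𝕋}
    [IsFiniteMeasure ρ] {g : 𝕋 → ℝ} (hg : Measurable g)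
    (h : ∫⁻ x, ‖g x‖ₑ ^ 2 ∂((ρ Set.univ)⁻¹ • ρ) < ∞) : MemLp g 2 ρ := by
  rw [memLp_two_iff_lintegral_lt_top hg.aestronglyMeasurable]
  rw [lintegral_smul_measure, smul_eq_mul] at h
  by_contra hcon
  rw [not_lt, top_le_iff] at hcon
  rw [hcon, ENNReal.mul_top (ENNReal.inv_ne_zero.2 (measure_ne_top _ _))] at h
  exact lt_irrefl _ h

section Curves

variable {𝕋 S : Type*} [MeasurableSpace 𝕋] [MeasurableSpace S]
variable {Q : Measure S} {π : Measure 𝕋} {η : Measure ℝ}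
variable {X : 𝕋 → S → ℝ} {M : ℝ≥0}

lemma memLp_section (hX : Measurable (Function.uncurry X))
    (hM : ∀ s, ∫⁻ x, ‖X s x‖ₑ ^ 2 ∂Q ≤ M) (s : 𝕋) : MemLp (X s) 2 Q := by
  have : Measurable (X s) := hX.comp measurable_prodMk_left
  exact (memLp_two_iff_lintegral_lt_top this.aestronglyMeasurable).2
    ((hM s).trans_lt ENNReal.coe_lt_top)

variable [IsProbabilityMeasure Q]

lemma measurable_meanFun (hX : Measurable (Function.uncurry X)) : Measurable (meanFun Q X) :=
  (hX.stronglyMeasurable.integral_prod_right (ν := Q)).measurable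

variable [IsProbabilityMeasure π]

lemma lintegral_sub_meanFun_le (hX : Measurable (Function.uncurry X))
    (hM : ∀ s, ∫⁻ x, ‖X s x‖ₑ ^ 2 ∂Q ≤ M) :
    ∫⁻ x, ∫⁻ s, ‖X s x - meanFun Q X s‖ₑ ^ 2 ∂π ∂Q ≤ M := by
  have hm := measurable_meanFun (Q := Q) hX
  have hXm : Measurable fun z : S × 𝕋 => X z.2 z.1 := hX.comp measurable_swap
  rw [lintegral_lintegral_swap (by
    exact ((hXm.sub (hm.comp measurable_snd)).enorm.pow_const 2).aemeasurable)]
  refine (lintegral_mono (g := fun _ => (M : ℝ≥0∞)) fun s => ?_).trans (by simp)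
  have h2 := memLp_section hX hM s
  have h1 : ∫⁻ x, ‖X s x - meanFun Q X s‖ₑ ^ 2 ∂Q = evariance (X s) Q := rfl
  rw [h1, ← h2.ofReal_variance_eq]
  refine le_trans ?_ (hM s)
  rw [lintegral_enorm_sq_eq h2]
  exact ENNReal.ofReal_le_ofReal (variance_le_expectation_sq h2.aestronglyMeasurable)

/-- One summand of the noise functional: the response at a point, centered by `f`, times the value
of a test function. -/
def obsFun (X : 𝕋 → S → ℝ) (f e : 𝕋 → ℝ) (z : S × 𝕋 × ℝ) : ℝ :=
  (X z.2.1 z.1 + z.2.2 - f z.2.1) * e z.2.1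

lemma measurable_obsFun (hX : Measurable (Function.uncurry X)) {f e : 𝕋 → ℝ} (hf : Measurable f)
    (he : Measurable e) : Measurable (obsFun X f e) := by
  have hXm : Measurable fun z : S × 𝕋 × ℝ => X z.2.1 z.1 :=
    hX.comp (measurable_snd.fst.prodMk measurable_fst)
  unfold obsFun
  fun_prop

variable [IsProbabilityMeasure η]

lemma lintegral_obsFun_sq_le (hX : Measurable (Function.uncurry X))
    (hM : ∀ s, ∫⁻ x, ‖X s x‖ₑ ^ 2 ∂Q ≤ M) (hη : MemLp (fun x : ℝ => x) 2 η) {f e : 𝕋 → ℝ}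
    (hf : Measurable f) (he : Measurable e) {B : ℝ} (hB : ∀ᵐ s ∂π, |f s| ≤ B) :
    ∫⁻ z, ‖obsFun X f e z‖ₑ ^ 2 ∂(Q.prod (π.prod η)) ≤
      ENNReal.ofReal (3 * (M + ∫ x, x ^ 2 ∂η + B ^ 2)) * ∫⁻ s, ‖e s‖ₑ ^ 2 ∂π := by
  have hm := measurable_obsFun hX hf he
  rw [lintegral_prod_symm _ (hm.enorm.pow_const 2).aemeasurable,
    lintegral_prod _ (hm.enorm.pow_const 2).lintegral_prod_left'.aemeasurable,
    ← lintegral_const_mul' _ _ ENNReal.ofReal_ne_top]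
  refine lintegral_mono_ae ?_
  filter_upwards [hB] with s hs
  have hv : 0 ≤ ∫ x, x ^ 2 ∂η := integral_nonneg fun _ => sq_nonneg _
  have hfs : ‖f s‖ₑ ^ 2 ≤ ENNReal.ofReal (B ^ 2) := by
    rw [enorm_sq_eq_ofReal]
    exact ENNReal.ofReal_le_ofReal (sq_le_sq' (abs_le.1 hs).1 (abs_le.1 hs).2)
  have hXs : Measurable (X s) := hX.comp measurable_prodMk_left
  have h1 : ∀ y : ℝ, ∫⁻ x, ‖obsFun X f e (x, s, y)‖ₑ ^ 2 ∂Q ≤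
      3 * (M + ‖y‖ₑ ^ 2 + ENNReal.ofReal (B ^ 2)) * ‖e s‖ₑ ^ 2 := by
    intro y
    calc _ ≤ ∫⁻ x, 3 * (‖X s x‖ₑ ^ 2 + ‖y‖ₑ ^ 2 + ENNReal.ofReal (B ^ 2)) * ‖e s‖ₑ ^ 2 ∂Q := by
          refine lintegral_mono fun x => ?_
          simp only [obsFun, enorm_mul, mul_pow]
          gcongr
          refine (enorm_add_sub_sq_le _ _ _).trans ?_
          gcongr
      _ = 3 * (∫⁻ x, ‖X s x‖ₑ ^ 2 ∂Q + ‖y‖ₑ ^ 2 + ENNReal.ofReal (B ^ 2)) * ‖e s‖ₑ ^ 2 := by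
          rw [lintegral_mul_const' _ _ (by simp), lintegral_const_mul' _ _ (by simp),
            lintegral_add_right _ measurable_const, lintegral_add_right _ measurable_const]
          simp
      _ ≤ _ := by
          gcongr
          exact hM s
  calc _ ≤ ∫⁻ y, 3 * (M + ‖y‖ₑ ^ 2 + ENNReal.ofReal (B ^ 2)) * ‖e s‖ₑ ^ 2 ∂η := lintegral_mono h1
    _ = 3 * (M + ∫⁻ y, ‖y‖ₑ ^ 2 ∂η + ENNReal.ofReal (B ^ 2)) * ‖e s‖ₑ ^ 2 := by
        rw [lintegral_mul_const' _ _ (by simp), lintegral_const_mul' _ _ (by simp),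
            lintegral_add_right _ measurable_const, lintegral_add_left measurable_const]
        simp
    _ = _ := by
        rw [lintegral_enorm_sq_eq hη, ENNReal.ofReal_mul (by norm_num),
          ENNReal.ofReal_add (by positivity) (by positivity), ENNReal.ofReal_add (by positivity) hv]
        simp

/-- The mean of an observation given its curve, and its overall mean; the errors drop out. -/
lemma curveMean_obsFun (hX : Measurable (Function.uncurry X))
    (hM : ∀ s, ∫⁻ x, ‖X s x‖ₑ ^ 2 ∂Q ≤ M) (hη : MemLp (fun x : ℝ => x) 2 η)
    (hη0 : ∫ x, x ∂η = 0) {f e : 𝕋 → ℝ} (hf : Measurable f) (he : Measurable e) {B B' : ℝ}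
    (hB : ∀ s, |f s| ≤ B) (hB' : ∀ s, |e s| ≤ B') :
    ∫ x, curveMean π η (obsFun X f e) x ∂Q = ∫ s, (meanFun Q X s - f s) * e s ∂π ∧
      ∀ᵐ x ∂Q, curveMean π η (obsFun X f e) x - ∫ y, curveMean π η (obsFun X f e) y ∂Q =
        ∫ s, (X s x - meanFun Q X s) * e s ∂π := by
  have hXm : Measurable fun z : S × 𝕋 => X z.2 z.1 := hX.comp measurable_swap
  have hm := measurable_meanFun (Q := Q) hX
  have hX2 : MemLp (fun z : S × 𝕋 => X z.2 z.1) 2 (Q.prod π) := by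
    rw [memLp_two_iff_lintegral_lt_top hXm.aestronglyMeasurable,
      lintegral_prod_symm _ (hXm.enorm.pow_const 2).aemeasurable]
    refine lt_of_le_of_lt (lintegral_mono (g := fun _ => (M : ℝ≥0∞)) fun s => hM s) ?_
    simp
  have hint : Integrable (fun z : S × 𝕋 => X z.2 z.1 * e z.2) (Q.prod π) :=
    (hX2.integrable one_le_two).mul_bdd (he.comp measurable_snd).aestronglyMeasurable
      (ae_of_all _ fun z => hB' z.2)
  have hfe : Integrable (fun s => f s * e s) π :=
    Integrable.of_bound (hf.mul he).aestronglyMeasurable (B * B') (ae_of_all _ fun s => by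
      rw [norm_mul]
      exact mul_le_mul (hB s) (hB' s) (abs_nonneg _) ((abs_nonneg _).trans (hB s)))
  have hei : Integrable e π := Integrable.of_bound he.aestronglyMeasurable B' (ae_of_all _ hB')
  have hye : Integrable (fun u : 𝕋 × ℝ => e u.1 * u.2) (π.prod η) :=
    hei.mul_prod (hη.integrable one_le_two)
  have hcm : ∀ᵐ x ∂Q, Integrable (fun s => X s x * e s) π ∧
      curveMean π η (obsFun X f e) x = ∫ s, X s x * e s ∂π - ∫ s, f s * e s ∂π := by
    filter_upwards [hint.prod_right_ae] with x hx
    refine ⟨hx, ?_⟩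
    have e1 : ∀ u : 𝕋 × ℝ, obsFun X f e (x, u) =
        (X u.1 x * e u.1 + e u.1 * u.2) - f u.1 * e u.1 := fun u => by
      simp only [obsFun]
      ring
    simp only [curveMean, e1]
    have i1 : Integrable (fun u : 𝕋 × ℝ => X u.1 x * e u.1) (π.prod η) := hx.comp_fst η
    have i2 : Integrable (fun u : 𝕋 × ℝ => f u.1 * e u.1) (π.prod η) := hfe.comp_fst η
    have i3 : Integrable (fun u : 𝕋 × ℝ => X u.1 x * e u.1 + e u.1 * u.2) (π.prod η) := i1.add hye
    rw [integral_sub i3 i2, integral_add i1 hye, integral_prod_mul e fun y => y, hη0,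
      mul_zero, add_zero]
    have k1 := integral_fun_fst (μ := π) (ν := η) (f := fun s => X s x * e s)
    have k2 := integral_fun_fst (μ := π) (ν := η) (f := fun s => f s * e s)
    rw [probReal_univ, one_smul] at k1 k2
    rw [k1, k2]
  have hμe : Integrable (fun s => meanFun Q X s * e s) π := by
    have := hint.swap.integral_prod_left
    simpa [meanFun, integral_mul_const] using this
  have hswap : ∫ x, ∫ s, X s x * e s ∂π ∂Q = ∫ s, meanFun Q X s * e s ∂π := by
    rw [integral_integral_swap hint]
    simp only [integral_mul_const, meanFun]
  have hmean : ∫ x, curveMean π η (obsFun X f e) x ∂Q =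
      ∫ s, meanFun Q X s * e s ∂π - ∫ s, f s * e s ∂π := by
    rw [integral_congr_ae (hcm.mono fun x hx => hx.2), integral_sub hint.integral_prod_left
      (integrable_const _), hswap]
    simp
  refine ⟨?_, ?_⟩
  · rw [hmean, ← integral_sub hμe hfe]
    simp only [sub_mul]
  · filter_upwards [hcm] with x hx
    rw [hx.2, hmean, sub_sub_sub_cancel_right, ← integral_sub hx.1 hμe]
    simp only [sub_mul]

end Curves

section Noise

variable {𝕋 : Type*} {H : Type*} [NormedAddCommGroup H] [InnerProductSpace ℝ H] [CompleteSpace H]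
  [RKHS ℝ H 𝕋 ℝ]
variable [TopologicalSpace 𝕋] [CompactSpace 𝕋] [MeasurableSpace 𝕋] [BorelSpace 𝕋]
variable {hk : Continuous fun p : 𝕋 × 𝕋 => kern H p.1 p.2} {ρ : Measure 𝕋} [IsFiniteMeasure ρ]
variable {ev : ℕ → ℝ} {ψ : ℕ → Lp ℝ 2 ρ}
variable {S Ω : Type*} [MeasurableSpace S] [MeasurableSpace Ω]
variable {Q : Measure S} {η : Measure ℝ} {P : Measure Ω}
variable {ξ : ℕ → Ω → S} {t : ℕ → ℕ → Ω → 𝕋} {ε : ℕ → ℕ → Ω → ℝ}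
variable [IsProbabilityMeasure P] [IsProbabilityMeasure Q] [IsProbabilityMeasure η]
  [IsProbabilityMeasure ((ρ Set.univ)⁻¹ • ρ)]

/-- Fluctuation of the noise vector `V - Ŝ f` around its mean in the dual energy norm. -/
lemma IsSample.lintegral_noise_le (h : IsSample Q ((ρ Set.univ)⁻¹ • ρ) η P ξ t ε)
    (heig : IsEigensystem (integralOp hk ρ) ev ψ) {a : ℝ} (ha : 0 ≤ a)
    (hka : ∀ s : 𝕋, kern H s s ≤ a) (D : Design) {l : ℝ} (hl : 0 < l) {N : ℝ}
    (hN : ∀ s : Finset ℕ, ∑ i ∈ s, (ev i / ρ.real Set.univ + l)⁻¹ * (ev i / ρ.real Set.univ) ≤ N)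
    {X : 𝕋 → S → ℝ} (hX : Measurable (Function.uncurry X)) {M : ℝ≥0}
    (hM : ∀ s, ∫⁻ x, ‖X s x‖ₑ ^ 2 ∂Q ≤ M) (hη : MemLp (fun x : ℝ => x) 2 η)
    (hη0 : ∫ x, x ∂η = 0) {f : H} {B : ℝ} (hB : ∀ᵐ s ∂ρ, |f s| ≤ B) :
    ∫⁻ ω, ∑' i, ENNReal.ofReal ((ev i / ρ.real Set.univ + l)⁻¹ *
        (⟪empiricalVec H D (fun i j => t i j ω) (response X ξ t ε ω)
          - empiricalOp H D (fun i j => t i j ω) f, eigFun hk ρ ev ψ i⟫_ℝ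
          - ∫ s, (meanFun Q X s - f s) * eigFun hk ρ ev ψ i s ∂((ρ Set.univ)⁻¹ • ρ)) ^ 2) ∂P ≤
      ENNReal.ofReal (2 * (D.size⁻¹ * (3 * (M + ∫ x, x ^ 2 ∂η + B ^ 2) * N)
        + (D.n : ℝ)⁻¹ * M)) := by
  set e : ℕ → H := eigFun hk ρ ev ψ with he
  set π : Measure 𝕋 := (ρ Set.univ)⁻¹ • ρ with hπ
  set K : ℝ := 3 * (M + ∫ x, x ^ 2 ∂η + B ^ 2) with hK
  have hv : 0 ≤ ∫ x, x ^ 2 ∂η := integral_nonneg fun _ => sq_nonneg _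
  have hK0 : 0 ≤ K := by positivity
  have hN0 : 0 ≤ N := by simpa using hN ∅
  have hem : ∀ i, Measurable (e i) := fun i => (continuous_coe hk (e i)).measurable
  have hfm : Measurable f := (continuous_coe hk f).measurable
  have hσ : ∀ i, 0 ≤ ev i / ρ.real Set.univ := fun i =>
    div_nonneg (heig.pos i).le measureReal_nonneg
  set c : ℕ → ℝ := fun i => (ev i / ρ.real Set.univ + l)⁻¹ with hcdef
  have hc : ∀ i, 0 ≤ c i := fun i => by have := hσ i; positivity
  have hs : 0 ≤ D.size⁻¹ := inv_nonneg.2 (zero_le_one.trans D.one_le_size)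
  have hBπ : ∀ᵐ s ∂π, |f s| ≤ B := Measure.ae_smul_measure hB _
  set φ : ℕ → S × 𝕋 × ℝ → ℝ := fun i => obsFun X f (e i) with hφ
  have hφm : ∀ i, Measurable (φ i) := fun i => measurable_obsFun hX hfm (hem i)
  have hφsq : ∀ i, ∫⁻ z, ‖φ i z‖ₑ ^ 2 ∂(Q.prod (π.prod η)) ≤
      ENNReal.ofReal K * ENNReal.ofReal (ev i / ρ.real Set.univ) := fun i => by
    rw [← heig.lintegral_eigFun_sq ha hka i]
    exact lintegral_obsFun_sq_le hX hM hη hfm (hem i) hBπ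
  have hφ2 : ∀ i, MemLp (φ i) 2 (Q.prod (π.prod η)) := fun i => by
    rw [memLp_two_iff_lintegral_lt_top (hφm i).aestronglyMeasurable]
    exact (hφsq i).trans_lt (ENNReal.mul_lt_top ENNReal.ofReal_lt_top ENNReal.ofReal_lt_top)
  have hcm := fun i => curveMean_obsFun (π := π) hX hM hη hη0 hfm (hem i)
    (abs_apply_le ha hka f) (abs_apply_le ha hka (e i))
  have hform : ∀ ω i, ⟪empiricalVec H D (fun i j => t i j ω) (response X ξ t ε ω)
          - empiricalOp H D (fun i j => t i j ω) f, e i⟫_ℝ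
          - ∫ s, (meanFun Q X s - f s) * e i s ∂π =
      ∑ p : D.Index, D.weight p * φ i (ξ p.1 ω, (t p.1 p.2 ω, ε p.1 p.2 ω))
        - ∫ x, curveMean π η (φ i) x ∂Q := by
    intro ω i
    rw [inner_empiricalVec_sub, (hcm i).1]
    rfl
  simp only [hform]
  have hmeas : ∀ i, Measurable fun ω => ENNReal.ofReal (c i *
      (∑ p : D.Index, D.weight p * φ i (ξ p.1 ω, (t p.1 p.2 ω, ε p.1 p.2 ω))
        - ∫ x, curveMean π η (φ i) x ∂Q) ^ 2) := by
    intro i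
    have := h.measurable_path
    have := h.measurable_point
    have := h.measurable_error
    fun_prop
  rw [lintegral_tsum fun i => (hmeas i).aemeasurable]
  have hterm : ∀ i, ∫⁻ ω, ENNReal.ofReal (c i *
      (∑ p : D.Index, D.weight p * φ i (ξ p.1 ω, (t p.1 p.2 ω, ε p.1 p.2 ω))
        - ∫ x, curveMean π η (φ i) x ∂Q) ^ 2) ∂P ≤
      2 * ENNReal.ofReal D.size⁻¹ * ENNReal.ofReal K *
          ENNReal.ofReal (c i * (ev i / ρ.real Set.univ)) +
        2 * ENNReal.ofReal (D.n : ℝ)⁻¹ * ∫⁻ x, ENNReal.ofReal (c i) *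
          ‖∫ s, (X s x - meanFun Q X s) * e i s ∂π‖ₑ ^ 2 ∂Q := by
    intro i
    simp only [ENNReal.ofReal_mul (hc i), ← enorm_sq_eq_ofReal]
    rw [lintegral_const_mul' _ _ ENNReal.ofReal_ne_top,
      lintegral_const_mul' _ _ ENNReal.ofReal_ne_top]
    have h1 := h.lintegral_weighted_sum_sq_le D (hφm i) (hφ2 i)
    have h2 : ∫⁻ x, ‖curveMean π η (φ i) x - ∫ y, curveMean π η (φ i) y ∂Q‖ₑ ^ 2 ∂Q =
        ∫⁻ x, ‖∫ s, (X s x - meanFun Q X s) * e i s ∂π‖ₑ ^ 2 ∂Q :=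
      lintegral_congr_ae ((hcm i).2.mono fun x hx => by
        simp only [hφ]
        rw [hx])
    rw [h2] at h1
    calc _ ≤ ENNReal.ofReal (c i) * (2 * (ENNReal.ofReal D.size⁻¹ *
          (ENNReal.ofReal K * ENNReal.ofReal (ev i / ρ.real Set.univ)) +
          ENNReal.ofReal (D.n : ℝ)⁻¹ *
            ∫⁻ x, ‖∫ s, (X s x - meanFun Q X s) * e i s ∂π‖ₑ ^ 2 ∂Q)) := by
          gcongr
          refine h1.trans ?_
          gcongr
          exact hφsq i
      _ = _ := by ring
  have hμm := measurable_meanFun (Q := Q) hX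
  have hXm : Measurable fun z : S × 𝕋 => X z.2 z.1 := hX.comp measurable_swap
  have hbias : ∑' i, ∫⁻ x, ENNReal.ofReal (c i) *
      ‖∫ s, (X s x - meanFun Q X s) * e i s ∂π‖ₑ ^ 2 ∂Q ≤ M := by
    have hm2 : ∀ i, Measurable fun x => ∫ s, (X s x - meanFun Q X s) * e i s ∂π := fun i => by
      have : Measurable fun z : S × 𝕋 => (X z.2 z.1 - meanFun Q X z.2) * e i z.2 := by fun_prop
      exact (this.stronglyMeasurable.integral_prod_right' (ν := π)).measurable
    rw [← lintegral_tsum fun i => (((hm2 i).enorm.pow_const 2).const_mul _).aemeasurable]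
    refine le_trans (lintegral_mono_ae ?_) (lintegral_sub_meanFun_le (π := π) hX hM)
    have hfin : ∫⁻ x, ∫⁻ s, ‖X s x - meanFun Q X s‖ₑ ^ 2 ∂π ∂Q ≠ ∞ :=
      ((lintegral_sub_meanFun_le hX hM).trans_lt ENNReal.coe_lt_top).ne
    have hm3 : Measurable fun x => ∫⁻ s, ‖X s x - meanFun Q X s‖ₑ ^ 2 ∂π := by
      have : Measurable fun z : S × 𝕋 => ‖X z.2 z.1 - meanFun Q X z.2‖ₑ ^ 2 := by fun_prop
      exact this.lintegral_prod_right'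
    filter_upwards [ae_lt_top hm3 hfin] with x hx
    have hgm : Measurable fun s => X s x - meanFun Q X s :=
      (hXm.comp (measurable_prodMk_left (x := x))).sub hμm
    have hg := memLp_of_memLp_normalized hgm hx
    have hgπ : MemLp (fun s => X s x - meanFun Q X s) 2 π :=
      (memLp_two_iff_lintegral_lt_top hgm.aestronglyMeasurable).2 hx
    have h1 := tsum_ofReal_le_of_sum_le (fun i => mul_nonneg (hc i) (sq_nonneg _))
      (heig.sum_integral_mul_sq_le hl.le hg)
    rw [← lintegral_enorm_sq_eq hgπ] at h1
    simpa only [ENNReal.ofReal_mul (hc _), ← enorm_sq_eq_ofReal] using h1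
  calc _ ≤ ∑' i, (2 * ENNReal.ofReal D.size⁻¹ * ENNReal.ofReal K *
          ENNReal.ofReal (c i * (ev i / ρ.real Set.univ)) +
        2 * ENNReal.ofReal (D.n : ℝ)⁻¹ * ∫⁻ x, ENNReal.ofReal (c i) *
          ‖∫ s, (X s x - meanFun Q X s) * e i s ∂π‖ₑ ^ 2 ∂Q) := ENNReal.tsum_le_tsum hterm
    _ ≤ 2 * ENNReal.ofReal D.size⁻¹ * ENNReal.ofReal K * ENNReal.ofReal N +
        2 * ENNReal.ofReal (D.n : ℝ)⁻¹ * M := by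
        rw [ENNReal.tsum_add, ENNReal.tsum_mul_left, ENNReal.tsum_mul_left]
        gcongr
        exact tsum_ofReal_le_of_sum_le (fun i => mul_nonneg (hc i) (hσ i)) hN
    _ = _ := by
        have hn := D.n_pos'
        rw [ENNReal.ofReal_mul zero_le_two, ENNReal.ofReal_add (by positivity) (by positivity),
          ENNReal.ofReal_mul hs, ENNReal.ofReal_mul hK0, ENNReal.ofReal_mul (by positivity)]
        simp
        ring

end Noise

/-! ### Spectral truncations of the target -/

section Truncation

variable {𝕋 : Type*} {H : Type*} [NormedAddCommGroup H] [InnerProductSpace ℝ H] [CompleteSpace H]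
  [RKHS ℝ H 𝕋 ℝ]
variable [TopologicalSpace 𝕋] [CompactSpace 𝕋] [MeasurableSpace 𝕋] [BorelSpace 𝕋]

/-- The spectral truncation `∑ i ∈ F, σ_i ^ (r - 1/2) h_i e_i` of a target with smoothness `r`,
where `σ_i = ev_i / ρ(T)` are the eigenvalues of the covariance operator. It is an element of the
RKHS even if the target is not. -/
def truncation (hk : Continuous fun p : 𝕋 × 𝕋 => kern H p.1 p.2) (ρ : Measure 𝕋)
    [IsFiniteMeasure ρ] (ev : ℕ → ℝ) (ψ : ℕ → Lp ℝ 2 ρ) (r : ℝ) (h : ℕ → ℝ) (F : Finset ℕ) : H :=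
  ∑ i ∈ F, ((ev i / ρ.real Set.univ) ^ (r - 1 / 2) * h i) • eigFun hk ρ ev ψ i

variable {hk : Continuous fun p : 𝕋 × 𝕋 => kern H p.1 p.2} {ρ : Measure 𝕋} [IsFiniteMeasure ρ]
variable {ev : ℕ → ℝ} {ψ : ℕ → Lp ℝ 2 ρ}

lemma IsEigensystem.measureReal_pos (heig : IsEigensystem (integralOp hk ρ) ev ψ) :
    0 < ρ.real Set.univ := by
  rw [measureReal_def]
  exact ENNReal.toReal_pos (by simpa using heig.measure_ne_zero) (measure_ne_top _ _)

lemma IsEigensystem.div_pos (heig : IsEigensystem (integralOp hk ρ) ev ψ) (i : ℕ) :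
    0 < ev i / ρ.real Set.univ :=
  _root_.div_pos (heig.pos i) heig.measureReal_pos

lemma IsEigensystem.div_le (heig : IsEigensystem (integralOp hk ρ) ev ψ) {a : ℝ} (ha : 0 ≤ a)
    (hka : ∀ s : 𝕋, kern H s s ≤ a) [IsProbabilityMeasure ((ρ Set.univ)⁻¹ • ρ)] (i : ℕ) :
    ev i / ρ.real Set.univ ≤ a := by
  have h1 := (covOp hk ρ).le_of_opNorm_le (norm_covOp_le hk ρ ha hka) (eigFun hk ρ ev ψ i)
  rwa [heig.covOp_eigFun, norm_smul, heig.orthonormal_eigFun.1, mul_one, mul_one,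
    Real.norm_of_nonneg (heig.div_pos i).le] at h1

lemma sqrt_mul_rpow_eq {R x y r : ℝ} (hR : 0 < R) (hx : 0 < x) (hy : y = x / R) :
    y ^ (r - 1 / 2) * √x = √R * y ^ r := by
  have hy0 : 0 < y := hy ▸ div_pos hx hR
  have hxy : x = R * y := by rw [hy]; field_simp
  rw [hxy, Real.sqrt_mul hR.le, Real.sqrt_eq_rpow y, mul_left_comm, ← Real.rpow_add hy0]
  congr 2
  ring

lemma IsEigensystem.inclusion_truncation (heig : IsEigensystem (integralOp hk ρ) ev ψ) (r : ℝ)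
    (h : ℕ → ℝ) (F : Finset ℕ) :
    inclusion hk ρ (truncation hk ρ ev ψ r h F) =
      ∑ i ∈ F, (√(ρ.real Set.univ) * (ev i / ρ.real Set.univ) ^ r * h i) • ψ i := by
  rw [truncation, map_sum]
  refine Finset.sum_congr rfl fun i _ => ?_
  rw [map_smul, heig.inclusion_eigFun, smul_smul,
    ← sqrt_mul_rpow_eq heig.measureReal_pos (heig.pos i) rfl]
  congr 1
  ring

/-- Truncation at level `l` costs `l ^ r` in `L²`. -/
lemma IsEigensystem.norm_sub_truncation_sq_le (heig : IsEigensystem (integralOp hk ρ) ev ψ)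
    {r : ℝ} (hr : 0 ≤ r) {h : ℕ → ℝ} {Ch : ℝ} (hh : ∀ s : Finset ℕ, ∑ i ∈ s, h i ^ 2 ≤ Ch)
    {m : Lp ℝ 2 ρ}
    (hm : HasSum (fun i => (√(ρ.real Set.univ) * (ev i / ρ.real Set.univ) ^ r * h i) • ψ i) m)
    {l : ℝ} {F : Finset ℕ} (hF : ∀ i ∉ F, ev i / ρ.real Set.univ ≤ l) :
    ‖m - inclusion hk ρ (truncation hk ρ ev ψ r h F)‖ ^ 2 ≤
      ρ.real Set.univ * (l ^ r) ^ 2 * Ch := by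
  classical
  rw [heig.inclusion_truncation]
  have hR := heig.measureReal_pos
  set R := ρ.real Set.univ
  have hlim := ((hm.sub_const (∑ i ∈ F, (√R * (ev i / R) ^ r * h i) • ψ i)).norm).pow 2
  refine le_of_tendsto hlim ((eventually_ge_atTop F).mono fun s hs => ?_)
  rw [← Finset.sum_sdiff hs, add_sub_cancel_right, norm_sum_smul_sq heig.orthonormal]
  calc _ ≤ ∑ i ∈ s \ F, R * (l ^ r) ^ 2 * h i ^ 2 := by
        refine Finset.sum_le_sum fun i hi => ?_
        have hi' := hF i (Finset.mem_sdiff.1 hi).2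
        have hσ := heig.div_pos i
        rw [mul_pow, mul_pow, Real.sq_sqrt hR.le]
        gcongr
    _ ≤ _ := by
        rw [← Finset.mul_sum]
        exact mul_le_mul_of_nonneg_left (hh _) (by positivity)

/-- For smoothness `r ≤ 1` the truncation at level `l` is bounded by `l ^ (r - 1)` in the dual
energy norm. -/
lemma IsEigensystem.inner_truncation_sq_le (heig : IsEigensystem (integralOp hk ρ) ev ψ)
    {r : ℝ} (hr : r ≤ 1) {h : ℕ → ℝ} {Ch : ℝ} (hh : ∀ s : Finset ℕ, ∑ i ∈ s, h i ^ 2 ≤ Ch)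
    {l : ℝ} (hl : 0 < l) {F : Finset ℕ} (hF : ∀ i ∈ F, l < ev i / ρ.real Set.univ) (y : H) :
    ⟪truncation hk ρ ev ψ r h F, y⟫_ℝ ^ 2 ≤
      (l ^ (r - 1)) ^ 2 * Ch * (⟪covOp hk ρ y, y⟫_ℝ + l * ‖y‖ ^ 2) := by
  set σ : ℕ → ℝ := fun i => ev i / ρ.real Set.univ with hσdef
  have hσ : ∀ i, 0 < σ i := heig.div_pos
  have hen := heig.sum_energy_le hl.le y F
  have hCh : 0 ≤ Ch := by simpa using hh ∅
  have e1 : ⟪truncation hk ρ ev ψ r h F, y⟫_ℝ =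
      ∑ i ∈ F, (σ i ^ (r - 1 / 2) * h i) * ⟪eigFun hk ρ ev ψ i, y⟫_ℝ := by
    simp [truncation, sum_inner, inner_smul_left, hσdef]
  have hcs := sum_mul_sq_le_weighted F (c := fun i => (σ i + l)⁻¹)
    (fun i => inv_pos.2 (add_pos (hσ i) hl)) (fun i => σ i ^ (r - 1 / 2) * h i)
    (fun i => ⟪eigFun hk ρ ev ψ i, y⟫_ℝ)
  simp only [inv_inv] at hcs
  rw [e1]
  refine hcs.trans (mul_le_mul ?_ hen (Finset.sum_nonneg fun i _ =>
    mul_nonneg (add_pos (hσ i) hl).le (sq_nonneg _)) (by positivity))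
  calc _ ≤ ∑ i ∈ F, (l ^ (r - 1)) ^ 2 * h i ^ 2 := by
        refine Finset.sum_le_sum fun i hi => ?_
        rw [mul_pow, ← mul_assoc]
        refine mul_le_mul_of_nonneg_right ?_ (sq_nonneg _)
        calc (σ i + l)⁻¹ * (σ i ^ (r - 1 / 2)) ^ 2 ≤ (σ i)⁻¹ * (σ i ^ (r - 1 / 2)) ^ 2 := by
              have := hσ i
              gcongr
              linarith
          _ = (σ i ^ (r - 1)) ^ 2 := by
              rw [← Real.rpow_natCast, ← Real.rpow_mul (hσ i).le, ← Real.rpow_natCast,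
                ← Real.rpow_mul (hσ i).le, ← Real.rpow_neg_one, ← Real.rpow_add (hσ i)]
              congr 1
              push_cast
              ring
          _ ≤ (l ^ (r - 1)) ^ 2 := by
              have h1 : σ i ^ (r - 1) ≤ l ^ (r - 1) :=
                Real.rpow_le_rpow_of_nonpos hl (hF i hi).le (by linarith)
              have := Real.rpow_nonneg (hσ i).le (r - 1)
              gcongr
    _ ≤ _ := by
        rw [← Finset.mul_sum]
        exact mul_le_mul_of_nonneg_left (hh F) (by positivity)

lemma IsEigensystem.abs_truncation_le (heig : IsEigensystem (integralOp hk ρ) ev ψ) {a : ℝ}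
    (ha : 0 ≤ a) (hka : ∀ s : 𝕋, kern H s s ≤ a) [IsProbabilityMeasure ((ρ Set.univ)⁻¹ • ρ)]
    {r : ℝ} (hr : 1 / 2 ≤ r) {h : ℕ → ℝ} {Ch : ℝ} (hh : ∀ s : Finset ℕ, ∑ i ∈ s, h i ^ 2 ≤ Ch)
    (F : Finset ℕ) (x : 𝕋) :
    |(truncation hk ρ ev ψ r h F : H) x| ≤ √a * (a ^ (r - 1 / 2) * √Ch) := by
  refine (abs_apply_le ha hka _ x).trans ?_
  gcongr
  have h1 : ‖truncation hk ρ ev ψ r h F‖ ≤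
      a ^ (r - 1 / 2) * ‖∑ i ∈ F, h i • eigFun hk ρ ev ψ i‖ := by
    refine norm_sum_smul_le heig.orthonormal_eigFun F (by positivity) fun i => ?_
    rw [abs_mul, abs_of_nonneg (Real.rpow_nonneg (heig.div_pos i).le _)]
    refine mul_le_mul_of_nonneg_right ?_ (abs_nonneg _)
    exact Real.rpow_le_rpow (heig.div_pos i).le (heig.div_le ha hka i) (by linarith)
  refine h1.trans ?_
  gcongr
  refine Real.le_sqrt_of_sq_le ?_
  rw [norm_sum_smul_sq heig.orthonormal_eigFun]
  exact hh F

lemma IsEigensystem.exists_ae_abs_truncation_le (heig : IsEigensystem (integralOp hk ρ) ev ψ)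
    {r : ℝ} (hemb : PowerEmbedding ev ψ r) {h : ℕ → ℝ} {Ch : ℝ}
    (hh : ∀ s : Finset ℕ, ∑ i ∈ s, h i ^ 2 ≤ Ch) :
    ∃ B : ℝ, ∀ F : Finset ℕ, ∀ᵐ x ∂ρ, |(truncation hk ρ ev ψ r h F : H) x| ≤ B := by
  obtain ⟨Z, hZ, hZb⟩ := hemb.exists_ae_finite
  have hR := heig.measureReal_pos
  set R := ρ.real Set.univ with hRdef
  refine ⟨√R * (R ^ r)⁻¹ * (Z * √Ch), fun F => ?_⟩
  filter_upwards [hZb F h, ae_all_iff.2 heig.eigFun_ae_eq] with x hx1 hx2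
  have e1 : (truncation hk ρ ev ψ r h F : H) x =
      √R * (R ^ r)⁻¹ * ∑ i ∈ F, h i * (ev i ^ r * ψ i x) := by
    have h0 : (truncation hk ρ ev ψ r h F : H) x =
        ∑ i ∈ F, ((ev i / R) ^ (r - 1 / 2) * h i) * (eigFun hk ρ ev ψ i : H) x := by
      rw [← inner_kernSec, truncation, sum_inner]
      refine Finset.sum_congr rfl fun i _ => ?_
      rw [inner_smul_left, inner_kernSec]
      rfl
    rw [h0, Finset.mul_sum]
    refine Finset.sum_congr rfl fun i _ => ?_
    have h1 := sqrt_mul_rpow_eq (r := r) hR (heig.pos i) rfl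
    rw [Real.div_rpow (heig.pos i).le hR.le r] at h1
    rw [hx2 i]
    linear_combination (h i * ψ i x) * h1
  rw [e1, abs_mul, abs_of_nonneg (by positivity)]
  gcongr
  exact hx1.trans (by gcongr; exact hh F)

/-- The trivial bound for the regularized evaluation functional. -/
lemma IsEigensystem.sum_inv_mul_eigFun_sq_le (heig : IsEigensystem (integralOp hk ρ) ev ψ) {a : ℝ}
    (hka : ∀ s : 𝕋, kern H s s ≤ a) {l : ℝ} (hl : 0 < l) (x : 𝕋) (s : Finset ℕ) :
    ∑ i ∈ s, (ev i / ρ.real Set.univ + l)⁻¹ * eigFun hk ρ ev ψ i x ^ 2 ≤ a * l ^ (-1 : ℝ) := by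
  rw [Real.rpow_neg_one, mul_comm a]
  calc _ ≤ ∑ i ∈ s, l⁻¹ * eigFun hk ρ ev ψ i x ^ 2 := by
        refine Finset.sum_le_sum fun i _ => mul_le_mul_of_nonneg_right ?_ (sq_nonneg _)
        have := heig.div_pos i
        gcongr
        linarith
    _ ≤ _ := by
        rw [← Finset.mul_sum]
        have := (heig.sum_eigFun_sq_le s x).trans (hka x)
        gcongr

/-- The embedding of the power space improves the order `l ^ (-1)` of the regularized evaluation
functional to `l ^ (-2 α)`. -/
lemma IsEigensystem.exists_ae_sum_inv_mul_eigFun_sq_le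
    (heig : IsEigensystem (integralOp hk ρ) ev ψ) {α : ℝ} (hα : 0 < α) (hα2 : α ≤ 1 / 2)
    (hemb : PowerEmbedding ev ψ α) :
    ∃ B : ℝ, 0 ≤ B ∧ ∀ l : ℝ, 0 < l → ∀ᵐ x ∂ρ, ∀ s : Finset ℕ,
      ∑ i ∈ s, (ev i / ρ.real Set.univ + l)⁻¹ * (eigFun hk ρ ev ψ i : H) x ^ 2 ≤
        B * l ^ (-(2 * α)) := by
  obtain ⟨Z, hZ, hZb⟩ := hemb.exists_ae_sum_sq_le
  have hR := heig.measureReal_pos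
  set R := ρ.real Set.univ with hRdef
  refine ⟨R * ((R ^ α)⁻¹) ^ 2 * Z ^ 2, by positivity, fun l hl => ?_⟩
  filter_upwards [hZb, ae_all_iff.2 heig.eigFun_ae_eq] with x hx1 hx2 s
  calc _ ≤ ∑ i ∈ s, R * ((R ^ α)⁻¹) ^ 2 * l ^ (-(2 * α)) * (ev i ^ α * ψ i x) ^ 2 := by
        refine Finset.sum_le_sum fun i _ => ?_
        have hev := heig.pos i
        have hσ : 0 < ev i / R := heig.div_pos i
        set y := ev i / R with hy
        have e0 : ev i = R * y := by rw [hy]; field_simp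
        have e1 : ev i ^ α = R ^ α * y ^ α := by rw [e0, Real.mul_rpow hR.le hσ.le]
        have e2 : (y + l)⁻¹ * y ≤ l ^ (-(2 * α)) * (y ^ α) ^ 2 := by
          have h1 : y = (y ^ α) ^ 2 * y ^ (1 - 2 * α) := by
            rw [← Real.rpow_natCast, ← Real.rpow_mul hσ.le, ← Real.rpow_add hσ]
            push_cast
            rw [show α * 2 + (1 - 2 * α) = 1 by ring, Real.rpow_one]
          have hyl : 0 < y + l := by positivity
          have h2 : y ^ (1 - 2 * α) ≤ (y + l) ^ (1 - 2 * α) :=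
            Real.rpow_le_rpow hσ.le (by linarith) (by linarith)
          have h3 : (y + l)⁻¹ * (y + l) ^ (1 - 2 * α) = (y + l) ^ (-(2 * α)) := by
            rw [← Real.rpow_neg_one, ← Real.rpow_add hyl]
            congr 1
            ring
          have h4 : (y + l) ^ (-(2 * α)) ≤ l ^ (-(2 * α)) :=
            Real.rpow_le_rpow_of_nonpos hl (by linarith) (by linarith)
          calc (y + l)⁻¹ * y = (y ^ α) ^ 2 * ((y + l)⁻¹ * y ^ (1 - 2 * α)) := by
                nth_rewrite 2 [h1]
                ring
            _ ≤ (y ^ α) ^ 2 * l ^ (-(2 * α)) := by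
                refine mul_le_mul_of_nonneg_left ?_ (sq_nonneg _)
                exact (mul_le_mul_of_nonneg_left h2 (inv_nonneg.2 hyl.le)).trans
                  (h3.le.trans h4)
            _ = _ := mul_comm _ _
        have hRα : R ^ α ≠ 0 := (Real.rpow_pos_of_pos hR α).ne'
        rw [hx2 i, mul_pow, Real.sq_sqrt hev.le, e1]
        calc (y + l)⁻¹ * (ev i * ψ i x ^ 2) = R * ψ i x ^ 2 * ((y + l)⁻¹ * y) := by
              rw [e0]; ring
          _ ≤ R * ψ i x ^ 2 * (l ^ (-(2 * α)) * (y ^ α) ^ 2) := by gcongr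
          _ = _ := by field_simp
    _ ≤ _ := by
        rw [← Finset.mul_sum]
        have hl2 := Real.rpow_nonneg hl.le (-(2 * α))
        calc _ ≤ R * ((R ^ α)⁻¹) ^ 2 * l ^ (-(2 * α)) * Z ^ 2 :=
              mul_le_mul_of_nonneg_left (hx1 s) (by positivity)
          _ = _ := by ring

end Truncation

/-! ### The estimation error on a good event -/

section ErrorBound

variable {E : Type*} [NormedAddCommGroup E] [InnerProductSpace ℝ E]

lemma opNorm_le_of_inner_sq_le {Δ : E →L[ℝ] E} {δ : ℝ} (hδ : 0 ≤ δ)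
    (h : ∀ f y, ⟪Δ f, y⟫_ℝ ^ 2 ≤ δ ^ 2 * ‖f‖ ^ 2 * ‖y‖ ^ 2) : ‖Δ‖ ≤ δ := by
  refine Δ.opNorm_le_bound hδ fun f => ?_
  have h1 := h f (Δ f)
  rw [real_inner_self_eq_norm_sq] at h1
  rcases eq_or_lt_of_le (norm_nonneg (Δ f)) with h0 | h0
  · rw [← h0]; positivity
  · have h2 : ‖Δ f‖ ^ 2 ≤ (δ * ‖f‖) ^ 2 := by
      have h3 : 0 < ‖Δ f‖ ^ 2 := by positivity
      refine le_of_mul_le_mul_right ?_ h3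
      calc ‖Δ f‖ ^ 2 * ‖Δ f‖ ^ 2 = (‖Δ f‖ ^ 2) ^ 2 := by ring
        _ ≤ _ := h1
        _ = (δ * ‖f‖) ^ 2 * ‖Δ f‖ ^ 2 := by ring
    exact (sq_le_sq₀ (norm_nonneg _) (by positivity)).1 h2

/-- If `A - S` is small relative to `S + κ l`, then `S + l ≤ 2 κ (A + l)`. -/
lemma energy_le_of_relative {A S : E →L[ℝ] E} (hA0 : ∀ f, 0 ≤ ⟪A f, f⟫_ℝ)
    (hS0 : ∀ f, 0 ≤ ⟪S f, f⟫_ℝ) {l κ : ℝ} (hl : 0 ≤ l) (hκ : 1 ≤ κ)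
    (h : ∀ f, ⟪(A - S) f, f⟫_ℝ ^ 2 ≤ 1 / 4 * (⟪S f, f⟫_ℝ + κ * l * ‖f‖ ^ 2) ^ 2) (f : E) :
    ⟪S f, f⟫_ℝ + l * ‖f‖ ^ 2 ≤ 2 * κ * (⟪A f, f⟫_ℝ + l * ‖f‖ ^ 2) := by
  have hG : 0 ≤ ⟪S f, f⟫_ℝ + κ * l * ‖f‖ ^ 2 := by
    have := hS0 f
    positivity
  have h1 : |⟪(A - S) f, f⟫_ℝ| ≤ (⟪S f, f⟫_ℝ + κ * l * ‖f‖ ^ 2) / 2 := by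
    refine abs_le_of_sq_le_sq ?_ (by positivity)
    calc _ ≤ _ := h f
      _ = _ := by ring
  have h2 : ⟪(A - S) f, f⟫_ℝ = ⟪A f, f⟫_ℝ - ⟪S f, f⟫_ℝ := by
    rw [_root_.sub_apply, inner_sub_left]
  rw [h2] at h1
  have h3 := (abs_le.1 h1).1
  have h4 : ⟪A f, f⟫_ℝ ≤ κ * ⟪A f, f⟫_ℝ := le_mul_of_one_le_left (hA0 f) hκ
  have h5 : l * ‖f‖ ^ 2 ≤ κ * (l * ‖f‖ ^ 2) := le_mul_of_one_le_left (by positivity) hκ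
  linarith

/-- The decomposition `g(A) V - f₀ = g(A) (V - A f₀) - (1 - A g(A)) f₀`, measured in the energy
of `A + l` and transferred to that of `S`. -/
lemma inner_estimator_sub_le [CompleteSpace E] {d : ℕ} {v : Fin d → E} {s : Fin d → ℝ}
    (hv : Orthonormal ℝ v) {a : ℝ} (hs : ∀ p, s p ∈ Set.Ioc 0 a) {A S : E →L[ℝ] E}
    (hA : ∀ f, A f = ∑ p, (s p * ⟪v p, f⟫_ℝ) • v p) {l c : ℝ} (hl : 0 < l) (hla : l ≤ a)
    (hc : 0 ≤ c)
    (hcmp : ∀ f, ⟪S f, f⟫_ℝ + l * ‖f‖ ^ 2 ≤ c * (⟪A f, f⟫_ℝ + l * ‖f‖ ^ 2)) {V f₀ : E}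
    (hV : V ∈ Submodule.span ℝ (Set.range v)) {M : ℝ} (hM : 0 ≤ M)
    (hw : ∀ f, ⟪V - A f₀, f⟫_ℝ ^ 2 ≤ M ^ 2 * (⟪S f, f⟫_ℝ + l * ‖f‖ ^ 2)) {g : ℝ → ℝ → ℝ} {B : ℝ}
    (hB : 0 ≤ B) (hgB : ∀ x ∈ Set.Icc 0 a, (x + l) * |filterFun g l x| ≤ B) {R : ℝ}
    (hR : ‖finCalc v s (fun x => √(x + l) * residual g l x) f₀‖ ≤ R) :
    ⟪S (specApply (g l) A V - f₀), specApply (g l) A V - f₀⟫_ℝ ≤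
      c * (√c * M * B + R) ^ 2 := by
  have hs0 : ∀ p, 0 ≤ s p := fun p => (hs p).1.le
  have hest : specApply (g l) A V = finCalc v s (filterFun g l) V := by
    rw [specApply_eq_finCalc hv hA _ hV]
    refine finCalc_congr_of_mem_span hv (fun p => ?_) hV
    simp [filterFun, (hs p).1.ne']
  set y := specApply (g l) A V - f₀ with hy
  have hdec : y = finCalc v s (filterFun g l) (V - A f₀) - finCalc v s (residual g l) f₀ := by
    have h1 : finCalc v s (residual g l) f₀ = f₀ - finCalc v s (filterFun g l) (A f₀) := by
      rw [hA, ← finCalc_id, finCalc_finCalc hv]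
      have := finCalc_sub (v := v) (s := s) (fun _ => (1 : ℝ)) (fun x => filterFun g l x * x) f₀
      rw [finCalc_const, one_smul] at this
      exact this
    rw [h1, map_sub, hy, hest]
    abel
  have hnorm : ‖finCalc v s (fun x => √(x + l)) y‖ ≤ √c * M * B + R := by
    rw [hdec, map_sub, finCalc_finCalc hv, finCalc_finCalc hv]
    refine (norm_sub_le _ _).trans (add_le_add ?_ hR)
    refine norm_finCalc_sqrt_mul_le hv hs0 hA hl (by positivity) hB (fun f => ?_) ?_ fun p => ?_
    · calc _ ≤ M ^ 2 * (⟪S f, f⟫_ℝ + l * ‖f‖ ^ 2) := hw f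
        _ ≤ M ^ 2 * (c * (⟪A f, f⟫_ℝ + l * ‖f‖ ^ 2)) := by gcongr; exact hcmp f
        _ = _ := by rw [mul_pow, Real.sq_sqrt hc]; ring
    · simpa using hgB 0 ⟨le_rfl, hl.le.trans hla⟩
    · exact hgB (s p) ⟨hs0 p, (hs p).2⟩
  calc ⟪S y, y⟫_ℝ ≤ ⟪S y, y⟫_ℝ + l * ‖y‖ ^ 2 := by
        have : 0 ≤ l * ‖y‖ ^ 2 := by positivity
        linarith
    _ ≤ c * (⟪A y, y⟫_ℝ + l * ‖y‖ ^ 2) := hcmp y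
    _ = c * ‖finCalc v s (fun x => √(x + l)) y‖ ^ 2 := by
        rw [norm_finCalc_sqrt_sq hv hs0 hA hl.le]
    _ ≤ _ := by gcongr

end ErrorBound

section GoodEvent

variable {𝕋 : Type*} {H : Type*} [NormedAddCommGroup H] [InnerProductSpace ℝ H] [CompleteSpace H]
  [RKHS ℝ H 𝕋 ℝ]
lemma empiricalOp_mem {M : Submodule ℝ H} (D : Design) {τ : ℕ → ℕ → 𝕋}
    (h : ∀ p : D.Index, kernSec H (τ p.1 p.2) ∈ M) (f : H) : empiricalOp H D τ f ∈ M := by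
  rw [empiricalOp_apply]
  exact Submodule.sum_mem _ fun p _ => Submodule.smul_mem _ _ (h p)

lemma empiricalVec_mem {M : Submodule ℝ H} (D : Design) {τ : ℕ → ℕ → 𝕋}
    (h : ∀ p : D.Index, kernSec H (τ p.1 p.2) ∈ M) (y : ℕ → ℕ → ℝ) : empiricalVec H D τ y ∈ M := by
  rw [empiricalVec_eq]
  exact Submodule.sum_mem _ fun p _ => Submodule.smul_mem _ _ (h p)

lemma inner_empiricalOp_nonneg (D : Design) (τ : ℕ → ℕ → 𝕋) (f : H) :
    0 ≤ ⟪empiricalOp H D τ f, f⟫_ℝ := by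
  rw [inner_empiricalOp]
  exact Finset.sum_nonneg fun p _ => mul_nonneg (D.weight_pos p).le (mul_self_nonneg _)

variable [TopologicalSpace 𝕋] [CompactSpace 𝕋] [MeasurableSpace 𝕋] [BorelSpace 𝕋]
variable {hk : Continuous fun p : 𝕋 × 𝕋 => kern H p.1 p.2} {ρ : Measure 𝕋} [IsFiniteMeasure ρ]
variable {ev : ℕ → ℝ} {ψ : ℕ → Lp ℝ 2 ρ}

lemma inner_covOp_nonneg (f : H) : 0 ≤ ⟪covOp hk ρ f, f⟫_ℝ := by
  rw [inner_covOp, real_inner_self_eq_norm_sq]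
  positivity

/-- A weighted Hilbert–Schmidt bound for `Ŝ - S` makes it small relative to `S + κ l`, hence
`S + l ≤ 2 κ (Ŝ + l)`. -/
lemma IsEigensystem.energy_le (heig : IsEigensystem (integralOp hk ρ) ev ψ) (D : Design)
    {τ : ℕ → ℕ → 𝕋} (hmem : ∀ p : D.Index, kernSec H (τ p.1 p.2) ∈
      (Submodule.span ℝ (Set.range (eigFun hk ρ ev ψ))).topologicalClosure) {l κ : ℝ} (hl : 0 < l)
    (hκ : 1 ≤ κ)
    (hq : ∀ s s' : Finset ℕ, ∑ i ∈ s, ∑ j ∈ s', (ev i / ρ.real Set.univ + κ * l)⁻¹ *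
      (ev j / ρ.real Set.univ + κ * l)⁻¹ * ⟪(empiricalOp H D τ - covOp hk ρ) (eigFun hk ρ ev ψ i),
        eigFun hk ρ ev ψ j⟫_ℝ ^ 2 ≤ 1 / 4) (f : H) :
    ⟪covOp hk ρ f, f⟫_ℝ + l * ‖f‖ ^ 2 ≤
      2 * κ * (⟪empiricalOp H D τ f, f⟫_ℝ + l * ‖f‖ ^ 2) := by
  have hκl : 0 < κ * l := by positivity
  refine energy_le_of_relative (inner_empiricalOp_nonneg D τ) inner_covOp_nonneg hl.le hκ
    (fun f => ?_) f
  have hf : ∀ s : Finset ℕ, ∑ i ∈ s, ((ev i / ρ.real Set.univ + κ * l)⁻¹)⁻¹ *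
      ⟪eigFun hk ρ ev ψ i, f⟫_ℝ ^ 2 ≤ ⟪covOp hk ρ f, f⟫_ℝ + κ * l * ‖f‖ ^ 2 := fun s => by
    simpa only [inv_inv] using heig.sum_energy_le hκl.le f s
  refine (inner_apply_sq_le_of_coordinates heig.orthonormal_eigFun (fun f y => ?_) (fun f => ?_)
    (fun i => inv_pos.2 (add_pos (heig.div_pos i) hκl)) hq hf hf).trans_eq (by ring)
  · simp only [_root_.sub_apply, inner_sub_left, inner_sub_right, empiricalOp_symm,
      covOp_symm]
  · exact Submodule.sub_mem _ (empiricalOp_mem D hmem f) (heig.covOp_mem f)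

lemma IsEigensystem.norm_empiricalOp_sub_le (heig : IsEigensystem (integralOp hk ρ) ev ψ)
    (D : Design) {τ : ℕ → ℕ → 𝕋} (hmem : ∀ p : D.Index, kernSec H (τ p.1 p.2) ∈
      (Submodule.span ℝ (Set.range (eigFun hk ρ ev ψ))).topologicalClosure) {δ : ℝ} (hδ : 0 ≤ δ)
    (hq : ∀ s s' : Finset ℕ, ∑ i ∈ s, ∑ j ∈ s', 1 * 1 *
      ⟪(empiricalOp H D τ - covOp hk ρ) (eigFun hk ρ ev ψ i), eigFun hk ρ ev ψ j⟫_ℝ ^ 2 ≤ δ ^ 2) :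
    ‖empiricalOp H D τ - covOp hk ρ‖ ≤ δ := by
  have hf : ∀ (f : H) (s : Finset ℕ), ∑ i ∈ s, ((1 : ℝ))⁻¹ *
      ⟪eigFun hk ρ ev ψ i, f⟫_ℝ ^ 2 ≤ ‖f‖ ^ 2 := fun f s => by
    simpa using heig.orthonormal_eigFun.sum_inner_products_le f (s := s)
  refine opNorm_le_of_inner_sq_le hδ fun f y => ?_
  refine inner_apply_sq_le_of_coordinates (c := fun _ => 1) heig.orthonormal_eigFun
    (fun f y => ?_) (fun f => ?_) (fun i => one_pos) hq (hf f) (hf y)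
  · simp only [_root_.sub_apply, inner_sub_left, inner_sub_right, empiricalOp_symm,
      covOp_symm]
  · exact Submodule.sub_mem _ (empiricalOp_mem D hmem f) (heig.covOp_mem f)

/-- The energy-dual bound for `V - Ŝ f₀`: its coordinates split into the noise and the systematic
part `∫ (m - f₀) e_i`. -/
lemma IsEigensystem.inner_empiricalVec_sub_sq_le (heig : IsEigensystem (integralOp hk ρ) ev ψ)
    (D : Design) {τ : ℕ → ℕ → 𝕋} (hmem : ∀ p : D.Index, kernSec H (τ p.1 p.2) ∈
      (Submodule.span ℝ (Set.range (eigFun hk ρ ev ψ))).topologicalClosure) (y : ℕ → ℕ → ℝ)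
    {l : ℝ} (hl : 0 < l) {f₀ : H} {m : 𝕋 → ℝ} (hm : MemLp (fun x => m x - f₀ x) 2 ρ) {q I : ℝ}
    (hq : ∀ s : Finset ℕ, ∑ i ∈ s, (ev i / ρ.real Set.univ + l)⁻¹ *
      (⟪empiricalVec H D τ y - empiricalOp H D τ f₀, eigFun hk ρ ev ψ i⟫_ℝ
        - ∫ x, (m x - f₀ x) * (eigFun hk ρ ev ψ i : H) x ∂((ρ Set.univ)⁻¹ • ρ)) ^ 2 ≤ q)
    (hI : ∫ x, (m x - f₀ x) ^ 2 ∂((ρ Set.univ)⁻¹ • ρ) ≤ I) (f : H) :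
    ⟪empiricalVec H D τ y - empiricalOp H D τ f₀, f⟫_ℝ ^ 2 ≤
      (2 * q + 2 * I) * (⟪covOp hk ρ f, f⟫_ℝ + l * ‖f‖ ^ 2) := by
  have hc : ∀ i, 0 < (ev i / ρ.real Set.univ + l)⁻¹ := fun i =>
    inv_pos.2 (add_pos (heig.div_pos i) hl)
  refine inner_sq_le_of_coordinates (c := fun i => (ev i / ρ.real Set.univ + l)⁻¹)
    heig.orthonormal_eigFun
    (Submodule.sub_mem _ (empiricalVec_mem D hmem y) (empiricalOp_mem D hmem f₀)) hc (fun s => ?_)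
    (fun s => by simpa only [inv_inv] using heig.sum_energy_le hl.le f s)
  have h1 := heig.sum_integral_mul_sq_le hl.le hm s
  calc _ ≤ ∑ i ∈ s, (2 * ((ev i / ρ.real Set.univ + l)⁻¹ *
      (⟪empiricalVec H D τ y - empiricalOp H D τ f₀, eigFun hk ρ ev ψ i⟫_ℝ
        - ∫ x, (m x - f₀ x) * (eigFun hk ρ ev ψ i : H) x ∂((ρ Set.univ)⁻¹ • ρ)) ^ 2) +
      2 * ((ev i / ρ.real Set.univ + l)⁻¹ *
        (∫ x, (m x - f₀ x) * (eigFun hk ρ ev ψ i : H) x ∂((ρ Set.univ)⁻¹ • ρ)) ^ 2)) := by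
        refine Finset.sum_le_sum fun i _ => ?_
        rw [real_inner_comm]
        generalize ⟪empiricalVec H D τ y - empiricalOp H D τ f₀, eigFun hk ρ ev ψ i⟫_ℝ = u
        generalize ∫ x, (m x - f₀ x) * (eigFun hk ρ ev ψ i : H) x ∂((ρ Set.univ)⁻¹ • ρ) = z
        have h2 : u ^ 2 ≤ 2 * (u - z) ^ 2 + 2 * z ^ 2 := by nlinarith [sq_nonneg (u - 2 * z)]
        calc _ ≤ (ev i / ρ.real Set.univ + l)⁻¹ * (2 * (u - z) ^ 2 + 2 * z ^ 2) :=
              mul_le_mul_of_nonneg_left h2 (hc i).le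
          _ = _ := by ring
    _ ≤ _ := by
        rw [Finset.sum_add_distrib, ← Finset.mul_sum, ← Finset.mul_sum]
        linarith [hq s]

/-- The estimation error relative to a target `f₀ ∈ H` on the good event. -/
lemma IsEigensystem.norm_inclusion_estimator_sub_le
    (heig : IsEigensystem (integralOp hk ρ) ev ψ) {a : ℝ} (hka : ∀ s : 𝕋, kern H s s ≤ a)
    (D : Design) (τ : ℕ → ℕ → 𝕋) (y : ℕ → ℕ → ℝ) {l c : ℝ} (hl : 0 < l) (hla : l ≤ a)
    (hc : 0 ≤ c)
    (hcmp : ∀ f : H, ⟪covOp hk ρ f, f⟫_ℝ + l * ‖f‖ ^ 2 ≤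
      c * (⟪empiricalOp H D τ f, f⟫_ℝ + l * ‖f‖ ^ 2)) {f₀ : H} {M : ℝ} (hM : 0 ≤ M)
    (hw : ∀ f, ⟪empiricalVec H D τ y - empiricalOp H D τ f₀, f⟫_ℝ ^ 2 ≤
      M ^ 2 * (⟪covOp hk ρ f, f⟫_ℝ + l * ‖f‖ ^ 2)) {g : ℝ → ℝ → ℝ} {B : ℝ}
    (hB : 0 ≤ B) (hgB : ∀ x ∈ Set.Icc 0 a, (x + l) * |filterFun g l x| ≤ B) {R : ℝ} (hR0 : 0 ≤ R)
    (hR : ∀ {d : ℕ} {v : Fin d → H} {s : Fin d → ℝ}, Orthonormal ℝ v →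
      (∀ p, s p ∈ Set.Ioc 0 a) → (∀ f, empiricalOp H D τ f = ∑ p, (s p * ⟪v p, f⟫_ℝ) • v p) →
      ‖finCalc v s (fun x => √(x + l) * residual g l x) f₀‖ ≤ R) :
    ‖inclusion hk ρ (meanEstimator H g l D τ y) - inclusion hk ρ f₀‖ ≤
      √(ρ.real Set.univ) * (√c * (√c * M * B + R)) := by
  obtain ⟨d, v, s, hv, hs, hA, hspan⟩ := exists_eigendecomposition D.weight D.weight_pos
    D.sum_weight (fun p : D.Index => kernSec H (τ p.1 p.2))
    (fun p => (norm_kernSec_sq _).trans_le (hka _)) (empiricalOp_apply D τ)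
  have h1 := inner_estimator_sub_le hv hs hA hl hla hc hcmp (empiricalVec_mem D hspan y) hM hw hB
    hgB (hR hv hs hA)
  have hpos := heig.measureReal_pos
  rw [inner_covOp, real_inner_self_eq_norm_sq, inv_mul_le_iff₀ hpos] at h1
  rw [← map_sub]
  refine (sq_le_sq₀ (norm_nonneg _) (by positivity)).1 (h1.trans_eq ?_)
  rw [mul_pow, mul_pow √c, Real.sq_sqrt hpos.le, Real.sq_sqrt hc]

/-- The approximation error `(1 - Ŝ g(Ŝ)) f_F` of a spectrally truncated source element, in the
energy of `Ŝ + l`: of order `l ^ r` up to the qualification. -/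
lemma IsEigensystem.exists_residual_truncation_le (heig : IsEigensystem (integralOp hk ρ) ev ψ)
    {a : ℝ} (ha : 0 < a) (hka : ∀ s : 𝕋, kern H s s ≤ a)
    [IsProbabilityMeasure ((ρ Set.univ)⁻¹ • ρ)] {g : ℝ → ℝ → ℝ} {ν : ℝ≥0∞}
    (hν : IsQualification a g ν) (hν1 : 1 ≤ ν) {r : ℝ} (hrν : ENNReal.ofReal r ≤ ν) {h : ℕ → ℝ}
    {Ch : ℝ} (hh : ∀ s : Finset ℕ, ∑ i ∈ s, h i ^ 2 ≤ Ch) {c K : ℝ} (hc : 0 ≤ c) (hK : 0 ≤ K) :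
    ∃ C : ℝ, 0 ≤ C ∧ ∀ {l : ℝ}, 0 < l → l ≤ a → ∀ {F : Finset ℕ},
      (∀ i ∈ F, l < ev i / ρ.real Set.univ) → ∀ {A : H →L[ℝ] H},
      (∀ f : H, ⟪covOp hk ρ f, f⟫_ℝ + l * ‖f‖ ^ 2 ≤ c * (⟪A f, f⟫_ℝ + l * ‖f‖ ^ 2)) →
      ∀ {δ : ℝ}, 0 < δ → ‖A - covOp hk ρ‖ ≤ δ → δ ≤ K * l ^ r →
      ∀ {d : ℕ} {v : Fin d → H} {s : Fin d → ℝ}, Orthonormal ℝ v →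
      (∀ p, s p ∈ Set.Ioc 0 a) → (∀ f, A f = ∑ p, (s p * ⟪v p, f⟫_ℝ) • v p) →
      ‖finCalc v s (fun x => √(x + l) * residual g l x) (truncation hk ρ ev ψ r h F)‖ ≤
        C * l ^ r := by
  have hCh : 0 ≤ Ch := by simpa using hh ∅
  rcases le_total r 1 with hr1 | hr1
  -- For `r ≤ 1` the target is of order `l ^ (r - 1)` in the dual energy norm, and qualification `1`
  -- contributes the missing factor `l`.
  · obtain ⟨B, hB, hgB⟩ := hν.exists_mul_residual_le hν1
    refine ⟨√c * √Ch * B, by positivity, ?_⟩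
    intro l hl hla F hF A hcmp δ _ _ _ d v s hv hs hA
    have hs0 : ∀ p, 0 ≤ s p := fun p => (hs p).1.le
    refine (norm_finCalc_sqrt_mul_le hv hs0 hA hl (M := √c * (l ^ (r - 1) * √Ch)) (B := B * l)
      (by positivity) (by positivity) (fun f => ?_) ?_ fun p => ?_).trans_eq ?_
    · calc _ ≤ (l ^ (r - 1)) ^ 2 * Ch * (⟪covOp hk ρ f, f⟫_ℝ + l * ‖f‖ ^ 2) :=
            heig.inner_truncation_sq_le hr1 hh hl hF f
        _ ≤ (l ^ (r - 1)) ^ 2 * Ch * (c * (⟪A f, f⟫_ℝ + l * ‖f‖ ^ 2)) := by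
            gcongr; exact hcmp f
        _ = _ := by rw [mul_pow, mul_pow, Real.sq_sqrt hc, Real.sq_sqrt hCh]; ring
    · simpa using hgB l ⟨hl, hla⟩ 0 ⟨le_rfl, ha.le⟩
    · exact hgB l ⟨hl, hla⟩ (s p) ⟨hs0 p, (hs p).2⟩
    · rw [Real.rpow_sub hl, Real.rpow_one]
      field_simp
  · -- For `r > 1` the exponent `r - 1/2` is split into its integer part `k` and a remainder `θ`.
    set k : ℕ := ⌊r - 1 / 2⌋₊ with hkdef
    set θ : ℝ := r - 1 / 2 - k with hθdef
    have hk1 : (k : ℝ) ≤ r - 1 / 2 := Nat.floor_le (by linarith)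
    have hk2 : r - 1 / 2 < k + 1 := Nat.lt_floor_add_one _
    have hθ : θ ∈ Set.Ico (0 : ℝ) 1 := ⟨by linarith, by linarith⟩
    have hkθ : (k : ℝ) + θ = r - 1 / 2 := by rw [hθdef]; ring
    have hq : ∀ p : ℝ, 0 ≤ p → p ≤ r - 1 / 2 → ∃ B : ℝ, 0 ≤ B ∧ ∀ l ∈ Set.Ioc 0 a,
        ∀ x ∈ Set.Icc 0 a, √(x + l) * |residual g l x| * x ^ p ≤ B * l ^ (p + 1 / 2) :=
      fun p hp hpr => hν.exists_sqrt_residual_le hp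
        ((ENNReal.ofReal_le_ofReal (by linarith)).trans hrν)
    obtain ⟨B₀, hB₀, hg₀⟩ := hq 0 le_rfl (by linarith)
    obtain ⟨B₁, hB₁, hg₁⟩ := hq k (by positivity) hk1
    obtain ⟨B₂, hB₂, hg₂⟩ := hq (k + θ) (by rw [hkθ]; linarith) hkθ.le
    obtain ⟨C, hC, hmain⟩ := exists_norm_residual_le (E := H) ha k hθ
      (show 0 ≤ B₀ + B₁ + B₂ by positivity)
    refine ⟨C * (a ^ ((1 : ℝ) / 2) * K + (K * a ^ (r - 1)) ^ θ + 1) * √Ch, by positivity, ?_⟩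
    intro l hl hla F hF A hcmp δ hδ hAδ hδK d v s hv hs hA
    have hsum : ∀ F : Finset ℕ, ‖∑ i ∈ F, h i • eigFun hk ρ ev ψ i‖ ≤ √Ch := fun F => by
      refine Real.le_sqrt_of_sq_le ?_
      rw [norm_sum_smul_sq heig.orthonormal_eigFun]
      exact hh F
    have h1 := hmain hv hs hA (norm_covOp_le hk ρ ha.le hka) heig.orthonormal_eigFun
      (fun i => (heig.div_pos i).le) (heig.div_le ha.le hka) heig.covOp_eigFun hδ hAδ hl.le
      (ρ := residual g l) (by
        rintro p (rfl | rfl | rfl) x hx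
        · exact (hg₀ l ⟨hl, hla⟩ x hx).trans (by gcongr; linarith)
        · exact (hg₁ l ⟨hl, hla⟩ x hx).trans (by gcongr; linarith)
        · exact (hg₂ l ⟨hl, hla⟩ x hx).trans (by gcongr; linarith)) F h
    have hδl : δ ≤ K * a ^ (r - 1) * l := by
      refine hδK.trans ?_
      have h2 : l ^ r = l ^ (r - 1) * l := by
        rw [Real.rpow_sub hl, Real.rpow_one]; field_simp
      rw [h2, mul_assoc]
      gcongr
    have hlr : 0 < l ^ r := by positivity
    have e1 : l ^ ((1 : ℝ) / 2) * δ ≤ a ^ ((1 : ℝ) / 2) * K * l ^ r := by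
      rw [mul_assoc]; gcongr
    have e2 : l ^ ((k : ℝ) + 1 / 2) * δ ^ θ ≤ (K * a ^ (r - 1)) ^ θ * l ^ r := by
      have h3 : δ ^ θ ≤ (K * a ^ (r - 1)) ^ θ * l ^ θ := by
        rw [← Real.mul_rpow (by positivity) hl.le]
        exact Real.rpow_le_rpow hδ.le hδl hθ.1
      calc _ ≤ l ^ ((k : ℝ) + 1 / 2) * ((K * a ^ (r - 1)) ^ θ * l ^ θ) := by gcongr
        _ = (K * a ^ (r - 1)) ^ θ * (l ^ ((k : ℝ) + 1 / 2) * l ^ θ) := by ring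
        _ = _ := by
          rw [← Real.rpow_add hl]
          congr 2
          linarith
    have e3 : l ^ ((k : ℝ) + θ + 1 / 2) = 1 * l ^ r := by
      rw [one_mul]; congr 1; linarith
    have htr : truncation hk ρ ev ψ r h F = ∑ i ∈ F,
        ((ev i / ρ.real Set.univ) ^ ((k : ℝ) + θ) * h i) • eigFun hk ρ ev ψ i := by
      rw [hkθ]; rfl
    rw [htr]
    refine h1.trans ?_
    calc _ ≤ C * (a ^ ((1 : ℝ) / 2) * K * l ^ r + (K * a ^ (r - 1)) ^ θ * l ^ r + 1 * l ^ r) *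
          √Ch := by
          rw [e3]
          gcongr
          exact hsum F
      _ = _ := by ring

end GoodEvent

/-! ### Rates -/

section Rates

variable {b r : ℝ}

lemma tuning_pos (D : Design) : 0 < tuning b r D :=
  Real.rpow_pos_of_pos (zero_lt_one.trans_le D.one_le_size) _

lemma tuning_le_one (hb : 0 < b) (hr : 0 ≤ r) (D : Design) : tuning b r D ≤ 1 :=
  Real.rpow_le_one_of_one_le_of_nonpos D.one_le_size (neg_nonpos.2 (by positivity))

/-- The choice of `l` balances the squared bias `l ^ (2 r)` against the variance
`l ^ (-1 / b) / (m n)`. -/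
lemma tuning_rpow_add (hb : 0 < b) (hr : 0 ≤ r) (D : Design) :
    tuning b r D ^ (2 * r + 1 / b) = D.size⁻¹ := by
  rw [tuning, ← Real.rpow_mul (zero_le_one.trans D.one_le_size), ← Real.rpow_neg_one]
  congr 1
  have : 0 < 1 + 2 * r * b := by positivity
  field_simp
  ring

lemma tuning_rpow (D : Design) :
    tuning b r D ^ r = D.size ^ (-(r * b / (1 + 2 * r * b))) := by
  rw [tuning, ← Real.rpow_mul (zero_le_one.trans D.one_le_size)]
  congr 1
  ring

lemma rate_eq (D : Design) : rate b r D = 1 / √(D.n : ℝ) + tuning b r D ^ r := by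
  rw [rate, tuning_rpow]

lemma inv_size_mul_tuning (hb : 0 < b) (hr : 0 ≤ r) (D : Design) :
    D.size⁻¹ * tuning b r D ^ (-(1 / b)) = (tuning b r D ^ r) ^ 2 := by
  rw [← tuning_rpow_add hb hr, ← Real.rpow_add (tuning_pos D), ← Real.rpow_natCast,
    ← Real.rpow_mul (tuning_pos D).le]
  congr 1
  push_cast
  ring

lemma inv_size_le_tuning (hb : 0 < b) (hr : 0 ≤ r) (D : Design) :
    D.size⁻¹ ≤ (tuning b r D ^ r) ^ 2 := by
  rw [← inv_size_mul_tuning hb hr]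
  refine le_mul_of_one_le_right (inv_nonneg.2 (zero_le_one.trans D.one_le_size)) ?_
  exact Real.one_le_rpow_of_pos_of_le_one_of_nonpos (tuning_pos D) (tuning_le_one hb hr D)
    (neg_nonpos.2 (by positivity))

lemma inv_size_mul_tuning_le_one (hb : 0 < b) (hr : 0 ≤ r) {τ : ℝ} (hτ : τ ≤ 2 * r)
    (D : Design) : D.size⁻¹ * (tuning b r D ^ (-τ) * tuning b r D ^ (-(1 / b))) ≤ 1 := by
  rw [mul_left_comm, inv_size_mul_tuning hb hr, ← Real.rpow_natCast,
    ← Real.rpow_mul (tuning_pos D).le, ← Real.rpow_add (tuning_pos D)]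
  refine Real.rpow_le_one (tuning_pos D).le (tuning_le_one hb hr D) ?_
  push_cast
  linarith

lemma rate_pos (D : Design) : 0 < rate b r D := by
  have h1 := Real.rpow_pos_of_pos (tuning_pos (b := b) (r := r) D) r
  rw [rate_eq]
  positivity

lemma tuning_rpow_le_rate (D : Design) : tuning b r D ^ r ≤ rate b r D := by
  rw [rate_eq]
  exact le_add_of_nonneg_left (by positivity)

lemma inv_n_le_rate_sq (D : Design) : (D.n : ℝ)⁻¹ ≤ rate b r D ^ 2 := by
  have h1 : (1 / √(D.n : ℝ)) ^ 2 = (D.n : ℝ)⁻¹ := by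
    rw [div_pow, Real.sq_sqrt (Nat.cast_nonneg _), one_pow, one_div]
  rw [← h1]
  refine pow_le_pow_left₀ (by positivity) ?_ 2
  rw [rate_eq]
  have h2 := Real.rpow_pos_of_pos (tuning_pos (b := b) (r := r) D) r
  exact le_add_of_nonneg_right h2.le

end Rates

/-! ### The probabilistic bound -/

/-- Markov's inequality. -/
lemma measure_lt_le_of_lintegral_le {Ω : Type*} [MeasurableSpace Ω] {P : Measure Ω}
    {Φ : Ω → ℝ≥0∞} (hΦ : Measurable Φ) {E p q : ℝ} (h : ∫⁻ ω, Φ ω ∂P ≤ ENNReal.ofReal E)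
    (hq : 0 < q) (hE : E ≤ p * q) : P {ω | ENNReal.ofReal q < Φ ω} ≤ ENNReal.ofReal p := by
  have hq' : ENNReal.ofReal q ≠ 0 := by simpa using hq
  calc P {ω | ENNReal.ofReal q < Φ ω}
      ≤ P {ω | ENNReal.ofReal q ≤ Φ ω} := by
        refine measure_mono fun ω hω => ?_
        rw [Set.mem_ofPred_eq] at hω ⊢
        exact hω.le
    _ ≤ (∫⁻ ω, Φ ω ∂P) / ENNReal.ofReal q :=
        meas_ge_le_lintegral_div hΦ.aemeasurable hq' ENNReal.ofReal_ne_top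
    _ ≤ ENNReal.ofReal E / ENNReal.ofReal q := by gcongr
    _ = ENNReal.ofReal (E / q) := (ENNReal.ofReal_div_of_pos hq).symm
    _ ≤ _ := ENNReal.ofReal_le_ofReal ((div_le_iff₀ hq).2 hE)

/-- Finite partial double sums are bounded by the double series. -/
lemma sum_sum_le_of_tsum_ofReal_le {x : ℕ → ℕ → ℝ} {B : ℝ} (hB : 0 ≤ B) (hx : ∀ i j, 0 ≤ x i j)
    (h : ∑' i, ∑' j, ENNReal.ofReal (x i j) ≤ ENNReal.ofReal B) (s s' : Finset ℕ) :
    ∑ i ∈ s, ∑ j ∈ s', x i j ≤ B := by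
  rw [← ENNReal.ofReal_le_ofReal_iff hB]
  refine le_trans ?_ h
  rw [ENNReal.ofReal_sum_of_nonneg fun i _ => Finset.sum_nonneg fun j _ => hx i j]
  refine (Finset.sum_le_sum fun i _ => ?_).trans (ENNReal.sum_le_tsum s)
  rw [ENNReal.ofReal_sum_of_nonneg fun j _ => hx i j]
  exact ENNReal.sum_le_tsum s'

section Points

variable {𝕋 : Type*} {H : Type*} [NormedAddCommGroup H] [InnerProductSpace ℝ H] [CompleteSpace H]
  [RKHS ℝ H 𝕋 ℝ]
variable [TopologicalSpace 𝕋] [MeasurableSpace 𝕋] [BorelSpace 𝕋]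
variable {S Ω : Type*} [MeasurableSpace S] [MeasurableSpace Ω]
variable {Q : Measure S} {η : Measure ℝ} {P : Measure Ω}
variable {ξ : ℕ → Ω → S} {t : ℕ → ℕ → Ω → 𝕋} {ε : ℕ → ℕ → Ω → ℝ}

lemma IsSample.measurable_apply_point {π : Measure 𝕋} (h : IsSample Q π η P ξ t ε)
    (hk : Continuous fun p : 𝕋 × 𝕋 => kern H p.1 p.2) (f : H) (i j : ℕ) :
    Measurable fun ω => f (t i j ω) :=
  (continuous_coe hk f).measurable.comp (h.measurable_point i j)

lemma IsSample.measurable_inner_empiricalVec_sub {π : Measure 𝕋} (h : IsSample Q π η P ξ t ε)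
    (hk : Continuous fun p : 𝕋 × 𝕋 => kern H p.1 p.2) {X : 𝕋 → S → ℝ}
    (hX : Measurable (Function.uncurry X)) (D : Design) (f y : H) : Measurable fun ω =>
      ⟪empiricalVec H D (fun i j => t i j ω) (response X ξ t ε ω)
        - empiricalOp H D (fun i j => t i j ω) f, y⟫_ℝ := by
  simp only [inner_empiricalVec_sub]
  refine Finset.measurable_fun_sum _ fun p _ => Measurable.const_mul (Measurable.mul
    (Measurable.sub (Measurable.add ?_ (h.measurable_error _ _))
      (h.measurable_apply_point hk f _ _)) (h.measurable_apply_point hk y _ _)) _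
  exact hX.comp ((h.measurable_point _ _).prodMk (h.measurable_path _))

end Points

section Core

variable {𝕋 : Type*} {H : Type*} [NormedAddCommGroup H] [InnerProductSpace ℝ H] [CompleteSpace H]
  [RKHS ℝ H 𝕋 ℝ]
variable [TopologicalSpace 𝕋] [CompactSpace 𝕋] [MeasurableSpace 𝕋] [BorelSpace 𝕋]
variable {hk : Continuous fun p : 𝕋 × 𝕋 => kern H p.1 p.2} {ρ : Measure 𝕋} [IsFiniteMeasure ρ]
variable {ev : ℕ → ℝ} {ψ : ℕ → Lp ℝ 2 ρ}

lemma IsEigensystem.sum_div_le (heig : IsEigensystem (integralOp hk ρ) ev ψ) {a : ℝ}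
    (hka : ∀ s : 𝕋, kern H s s ≤ a) [IsProbabilityMeasure ((ρ Set.univ)⁻¹ • ρ)] (s : Finset ℕ) :
    ∑ i ∈ s, ev i / ρ.real Set.univ ≤ a := by
  have hint : ∀ i ∈ s, Integrable (fun x => (eigFun hk ρ ev ψ i : H) x ^ 2)
      ((ρ Set.univ)⁻¹ • ρ) := fun i _ =>
    ((continuous_coe hk _).pow 2).integrable_of_hasCompactSupport
      (HasCompactSupport.of_compactSpace _)
  calc ∑ i ∈ s, ev i / ρ.real Set.univ
      = ∑ i ∈ s, ∫ x, (eigFun hk ρ ev ψ i : H) x ^ 2 ∂((ρ Set.univ)⁻¹ • ρ) :=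
        Finset.sum_congr rfl fun i _ => (heig.integral_eigFun_sq i).symm
    _ = ∫ x, ∑ i ∈ s, (eigFun hk ρ ev ψ i : H) x ^ 2 ∂((ρ Set.univ)⁻¹ • ρ) :=
        (integral_finsetSum s hint).symm
    _ ≤ ∫ _, a ∂((ρ Set.univ)⁻¹ • ρ) :=
        integral_mono (integrable_finsetSum s hint) (integrable_const a) fun x =>
          (heig.sum_eigFun_sq_le s x).trans (hka x)
    _ = a := by simp

/-- The eigenvalues above a positive level form a finite set. -/
lemma IsEigensystem.exists_finset_level (heig : IsEigensystem (integralOp hk ρ) ev ψ) {a : ℝ}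
    (hka : ∀ s : 𝕋, kern H s s ≤ a) [IsProbabilityMeasure ((ρ Set.univ)⁻¹ • ρ)] {l : ℝ}
    (hl : 0 < l) : ∃ F : Finset ℕ, (∀ i ∉ F, ev i / ρ.real Set.univ ≤ l) ∧
      ∀ i ∈ F, l < ev i / ρ.real Set.univ := by
  have hs : Summable fun i => ev i / ρ.real Set.univ :=
    summable_of_sum_le (fun i => (heig.div_pos i).le) (heig.sum_div_le hka)
  have h1 : ∀ᶠ i in cofinite, ev i / ρ.real Set.univ < l :=
    hs.tendsto_cofinite_zero.eventually_lt_const hl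
  have h2 : {i | l < ev i / ρ.real Set.univ}.Finite :=
    (Filter.eventually_cofinite.1 h1).subset fun i hi => not_lt.2 (le_of_lt hi)
  exact ⟨h2.toFinset, fun i hi => by simpa using hi, fun i hi => by simpa using hi⟩

lemma integral_sub_sq_eq {m : Lp ℝ 2 ρ} {μ : 𝕋 → ℝ} (hm : m =ᵐ[ρ] μ) (f : H) :
    ∫ x, (μ x - f x) ^ 2 ∂((ρ Set.univ)⁻¹ • ρ) =
      (ρ.real Set.univ)⁻¹ * ‖m - inclusion hk ρ f‖ ^ 2 := by
  rw [integral_smul_measure, ENNReal.toReal_inv, ← measureReal_def, smul_eq_mul,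
    ← real_inner_self_eq_norm_sq, L2.inner_def]
  congr 1
  refine integral_congr_ae ?_
  filter_upwards [hm, inclusion_ae_eq hk ρ f, Lp.coeFn_sub m (inclusion hk ρ f)] with x h1 h2 h3
  rw [h3, Pi.sub_apply, h1, h2]
  simp [sq]

lemma eLpNorm_sub_eq {m : Lp ℝ 2 ρ} {μ : 𝕋 → ℝ} (hm : m =ᵐ[ρ] μ) (f : H) :
    eLpNorm (fun x => f x - μ x) 2 ρ = ENNReal.ofReal ‖inclusion hk ρ f - m‖ := by
  rw [ofReal_norm, Lp.enorm_def]
  refine eLpNorm_congr_ae ?_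
  filter_upwards [hm, inclusion_ae_eq hk ρ f, Lp.coeFn_sub (inclusion hk ρ f) m] with x h1 h2 h3
  rw [h3, Pi.sub_apply, h1, h2]

variable {S Ω : Type*} [MeasurableSpace S] [MeasurableSpace Ω]
variable {Q : Measure S} {η : Measure ℝ} {P : Measure Ω}
variable {ξ : ℕ → Ω → S} {t : ℕ → ℕ → Ω → 𝕋} {ε : ℕ → ℕ → Ω → ℝ}

lemma IsSample.measurable_inner_empiricalOp_sub {π : Measure 𝕋} (h : IsSample Q π η P ξ t ε)
    (hk : Continuous fun p : 𝕋 × 𝕋 => kern H p.1 p.2) (ρ : Measure 𝕋) [IsFiniteMeasure ρ]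
    (D : Design) (f y : H) : Measurable fun ω =>
      ⟪(empiricalOp H D (fun i j => t i j ω) - covOp hk ρ) f, y⟫_ℝ := by
  simp only [_root_.sub_apply, inner_sub_left, inner_empiricalOp]
  exact (Finset.measurable_fun_sum _ fun p _ => ((h.measurable_apply_point hk f _ _).mul
    (h.measurable_apply_point hk y _ _)).const_mul _).sub_const _

lemma IsSample.ae_kernSec_mem [HereditarilyLindelofSpace 𝕋]
    (h : IsSample Q ((ρ Set.univ)⁻¹ • ρ) η P ξ t ε)
    (heig : IsEigensystem (integralOp hk ρ) ev ψ) (D : Design) :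
    ∀ᵐ ω ∂P, ∀ p : D.Index, kernSec H (t p.1 p.2 ω) ∈
      (Submodule.span ℝ (Set.range (eigFun hk ρ ev ψ))).topologicalClosure := by
  rw [ae_all_iff]
  intro p
  refine ae_of_ae_map (p := fun x => kernSec H x ∈
    (Submodule.span ℝ (Set.range (eigFun hk ρ ev ψ))).topologicalClosure)
    (h.measurable_point p.1 p.2).aemeasurable ?_
  rw [h.law_point]
  exact Measure.ae_smul_measure heig.ae_kernSec_mem _

variable [IsProbabilityMeasure P] [IsProbabilityMeasure Q] [IsProbabilityMeasure η]
  [IsProbabilityMeasure ((ρ Set.univ)⁻¹ • ρ)]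

/-- On an event of probability at least `1 - 2 p`, the empirical covariance operator dominates the
covariance operator up to the factor `2 κ`, and is within `√(2 a² / (m n p))` of it. -/
lemma IsSample.exists_energy_le [HereditarilyLindelofSpace 𝕋]
    (h : IsSample Q ((ρ Set.univ)⁻¹ • ρ) η P ξ t ε)
    (heig : IsEigensystem (integralOp hk ρ) ev ψ) {a : ℝ} (ha : 0 < a)
    (hka : ∀ s : 𝕋, kern H s s ≤ a) {b : ℝ} (hb : 0 < b) {r : ℝ} (hr : 0 ≤ r) {N : ℝ} (hN0 : 0 < N)
    (hN : ∀ l : ℝ, 0 < l → ∀ s : Finset ℕ, ∑ i ∈ s, (ev i / ρ.real Set.univ + l)⁻¹ *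
      (ev i / ρ.real Set.univ) ≤ N * l ^ (-(1 / b))) {τ : ℝ} (hτ : 0 ≤ τ) (hτr : τ ≤ 2 * r) {B : ℝ}
    (hB0 : 0 ≤ B) (hB : ∀ l : ℝ, 0 < l → ∀ᵐ x ∂ρ, ∀ s : Finset ℕ,
      ∑ i ∈ s, (ev i / ρ.real Set.univ + l)⁻¹ * (eigFun hk ρ ev ψ i : H) x ^ 2 ≤ B * l ^ (-τ))
    {p : ℝ} (hp : 0 < p) :
    ∃ κ : ℝ, 1 ≤ κ ∧ ∀ D : Design, ∃ bad : Set Ω, P bad ≤ ENNReal.ofReal (2 * p) ∧ ∀ ω ∉ bad,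
      (∀ q : D.Index, kernSec H (t q.1 q.2 ω) ∈
        (Submodule.span ℝ (Set.range (eigFun hk ρ ev ψ))).topologicalClosure) ∧
      (∀ f : H, ⟪covOp hk ρ f, f⟫_ℝ + tuning b r D * ‖f‖ ^ 2 ≤ 2 * κ *
        (⟪empiricalOp H D (fun i j => t i j ω) f, f⟫_ℝ + tuning b r D * ‖f‖ ^ 2)) ∧
      ‖empiricalOp H D (fun i j => t i j ω) - covOp hk ρ‖ ≤ √(2 * a ^ 2 / p * D.size⁻¹) := by
  -- Enlarging the regularization by `κ` makes the relative fluctuation as small as desired: its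
  -- second moment decays like `κ ^ (-1 / b)`.
  set κ : ℝ := max 1 ((8 * B * N / p) ^ b) with hκdef
  have hκ1 : 1 ≤ κ := le_max_left _ _
  have hκ0 : 0 < κ := zero_lt_one.trans_le hκ1
  have hκb : 8 * B * N / p ≤ κ ^ (1 / b) := by
    calc 8 * B * N / p = ((8 * B * N / p) ^ b) ^ (1 / b) := by
          rw [← Real.rpow_mul (by positivity), mul_one_div_cancel hb.ne', Real.rpow_one]
      _ ≤ κ ^ (1 / b) := Real.rpow_le_rpow (by positivity) (le_max_right _ _) (by positivity)
  refine ⟨κ, hκ1, fun D => ?_⟩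
  set l := tuning b r D with hldef
  have hl : 0 < l := tuning_pos D
  have hκl : 0 < κ * l := by positivity
  have hsz : 0 < D.size := zero_lt_one.trans_le D.one_le_size
  have hsz' : 0 < D.size⁻¹ := inv_pos.2 hsz
  have hc : ∀ i, 0 < (ev i / ρ.real Set.univ + κ * l)⁻¹ := fun i =>
    inv_pos.2 (add_pos (heig.div_pos i) hκl)
  set Δ : Ω → H →L[ℝ] H := fun ω => empiricalOp H D (fun i j => t i j ω) - covOp hk ρ with hΔ
  set Φ₁ : Ω → ℝ≥0∞ := fun ω => ∑' i, ∑' j, ENNReal.ofReal ((ev i / ρ.real Set.univ + κ * l)⁻¹ *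
    (ev j / ρ.real Set.univ + κ * l)⁻¹ *
      ⟪Δ ω (eigFun hk ρ ev ψ i), eigFun hk ρ ev ψ j⟫_ℝ ^ 2) with hΦ₁
  set Φ₂ : Ω → ℝ≥0∞ := fun ω => ∑' i, ∑' j, ENNReal.ofReal (1 * 1 *
      ⟪Δ ω (eigFun hk ρ ev ψ i), eigFun hk ρ ev ψ j⟫_ℝ ^ 2) with hΦ₂
  have hm : ∀ i j, Measurable fun ω => ⟪Δ ω (eigFun hk ρ ev ψ i), eigFun hk ρ ev ψ j⟫_ℝ :=
    fun i j => h.measurable_inner_empiricalOp_sub hk ρ D _ _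
  have hm₁ : Measurable Φ₁ := Measurable.tsum fun i => Measurable.tsum fun j =>
    (((hm i j).pow_const 2).const_mul _).ennreal_ofReal
  have hm₂ : Measurable Φ₂ := Measurable.tsum fun i => Measurable.tsum fun j =>
    (((hm i j).pow_const 2).const_mul _).ennreal_ofReal
  have hE₁ : ∫⁻ ω, Φ₁ ω ∂P ≤ ENNReal.ofReal (2 * D.size⁻¹ * (B * (κ * l) ^ (-τ)) *
      (N * (κ * l) ^ (-(1 / b)))) :=
    h.lintegral_empiricalOp_sub_le heig ha.le hka D hc (by positivity) (hB _ hκl) (hN _ hκl)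
  have hE₂ : ∫⁻ ω, Φ₂ ω ∂P ≤ ENNReal.ofReal (2 * D.size⁻¹ * a * a) :=
    h.lintegral_empiricalOp_sub_le heig ha.le hka D (c := fun _ => 1) (fun _ => one_pos) ha.le
      (ae_of_all _ fun x s => by
        simp only [one_mul]
        exact (heig.sum_eigFun_sq_le s x).trans (hka x))
      (fun s => by
        simp only [one_mul]
        exact heig.sum_div_le hka s)
  have hP₁ : P {ω | ENNReal.ofReal (1 / 4) < Φ₁ ω} ≤ ENNReal.ofReal p := by
    refine measure_lt_le_of_lintegral_le hm₁ hE₁ (by norm_num) ?_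
    have h1 : (κ * l) ^ (-τ) ≤ l ^ (-τ) :=
      Real.rpow_le_rpow_of_nonpos hl (le_mul_of_one_le_left hl.le hκ1) (neg_nonpos.2 hτ)
    have h2 : (κ * l) ^ (-(1 / b)) = (κ ^ (1 / b))⁻¹ * l ^ (-(1 / b)) := by
      rw [Real.mul_rpow hκ0.le hl.le, Real.rpow_neg hκ0.le]
    have h3 := inv_size_mul_tuning_le_one hb hr hτr D
    rw [← hldef] at h3
    have h4 : 0 < κ ^ (1 / b) := by positivity
    calc _ ≤ 2 * D.size⁻¹ * (B * l ^ (-τ)) * (N * ((κ ^ (1 / b))⁻¹ * l ^ (-(1 / b)))) := by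
          rw [h2]; gcongr
      _ = 2 * B * N * (κ ^ (1 / b))⁻¹ * (D.size⁻¹ * (l ^ (-τ) * l ^ (-(1 / b)))) := by ring
      _ ≤ 2 * B * N * (κ ^ (1 / b))⁻¹ * 1 := by gcongr
      _ ≤ p * (1 / 4) := by
          rw [mul_one, ← div_eq_mul_inv, div_le_iff₀ h4]
          rw [div_le_iff₀ hp] at hκb
          linarith
  have hq2 : 0 < 2 * a ^ 2 / p * D.size⁻¹ := by positivity
  have hP₂ : P {ω | ENNReal.ofReal (2 * a ^ 2 / p * D.size⁻¹) < Φ₂ ω} ≤ ENNReal.ofReal p := by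
    refine measure_lt_le_of_lintegral_le hm₂ hE₂ hq2 (le_of_eq ?_)
    field_simp
  refine ⟨{ω | ¬ ∀ q : D.Index, kernSec H (t q.1 q.2 ω) ∈
      (Submodule.span ℝ (Set.range (eigFun hk ρ ev ψ))).topologicalClosure} ∪
    ({ω | ENNReal.ofReal (1 / 4) < Φ₁ ω} ∪ {ω | ENNReal.ofReal (2 * a ^ 2 / p * D.size⁻¹) < Φ₂ ω}),
    ?_, fun ω hω => ?_⟩
  · refine (measure_union_le _ _).trans ?_
    have e1 : ENNReal.ofReal (2 * p) = ENNReal.ofReal p + ENNReal.ofReal p := by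
      rw [two_mul, ENNReal.ofReal_add hp.le hp.le]
    rw [show P {ω | ¬ ∀ q : D.Index, _} = 0 from h.ae_kernSec_mem heig D, zero_add, e1]
    exact (measure_union_le _ _).trans (add_le_add hP₁ hP₂)
  · simp only [Set.mem_union, Set.mem_ofPred_eq, not_or, not_not, not_lt] at hω
    obtain ⟨hmem, h1, h2⟩ := hω
    refine ⟨hmem, heig.energy_le D (τ := fun i j => t i j ω) hmem hl hκ1 ?_, heig.norm_empiricalOp_sub_le D
      (τ := fun i j => t i j ω) hmem
      (Real.sqrt_nonneg _) ?_⟩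
    · exact sum_sum_le_of_tsum_ofReal_le (x := fun i j => (ev i / ρ.real Set.univ + κ * l)⁻¹ *
        (ev j / ρ.real Set.univ + κ * l)⁻¹ *
          ⟪Δ ω (eigFun hk ρ ev ψ i), eigFun hk ρ ev ψ j⟫_ℝ ^ 2) (by norm_num)
        (fun i j => mul_nonneg (mul_nonneg (hc i).le (hc j).le) (sq_nonneg _)) h1
    · rw [Real.sq_sqrt hq2.le]
      exact sum_sum_le_of_tsum_ofReal_le (x := fun i j => 1 * 1 *
        ⟪Δ ω (eigFun hk ρ ev ψ i), eigFun hk ρ ev ψ j⟫_ℝ ^ 2) hq2.le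
        (fun i j => mul_nonneg (by norm_num) (sq_nonneg _)) h2

/-- On an event of probability at least `1 - p`, the residual `V - Ŝ f` of the normal equations at
a bounded target `f` is of the order of the rate in the dual of the energy norm. -/
lemma IsSample.exists_noise_le
    (h : IsSample Q ((ρ Set.univ)⁻¹ • ρ) η P ξ t ε)
    (heig : IsEigensystem (integralOp hk ρ) ev ψ) {a : ℝ} (ha : 0 < a)
    (hka : ∀ s : 𝕋, kern H s s ≤ a) {b : ℝ} (hb : 0 < b) {r : ℝ} (hr : 0 ≤ r) {N : ℝ} (hN0 : 0 < N)
    (hN : ∀ l : ℝ, 0 < l → ∀ s : Finset ℕ, ∑ i ∈ s, (ev i / ρ.real Set.univ + l)⁻¹ *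
      (ev i / ρ.real Set.univ) ≤ N * l ^ (-(1 / b)))
    {X : 𝕋 → S → ℝ} (hX : Measurable (Function.uncurry X)) {M : ℝ≥0}
    (hM : ∀ s, ∫⁻ x, ‖X s x‖ₑ ^ 2 ∂Q ≤ M) (hη : MemLp (fun x : ℝ => x) 2 η)
    (hη0 : ∫ x, x ∂η = 0) {m : Lp ℝ 2 ρ} (hm : m =ᵐ[ρ] meanFun Q X) (B Ch : ℝ) (hCh : 0 ≤ Ch)
    {p : ℝ} (hp : 0 < p) :
    ∃ K : ℝ, 0 ≤ K ∧ ∀ (D : Design) (f : H), (∀ᵐ s ∂ρ, |f s| ≤ B) →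
      ‖m - inclusion hk ρ f‖ ^ 2 ≤ ρ.real Set.univ * (tuning b r D ^ r) ^ 2 * Ch →
      ∃ bad : Set Ω, P bad ≤ ENNReal.ofReal p ∧ ∀ ω ∉ bad,
      (∀ q : D.Index, kernSec H (t q.1 q.2 ω) ∈
        (Submodule.span ℝ (Set.range (eigFun hk ρ ev ψ))).topologicalClosure) →
      ∀ y : H, ⟪empiricalVec H D (fun i j => t i j ω) (response X ξ t ε ω)
          - empiricalOp H D (fun i j => t i j ω) f, y⟫_ℝ ^ 2 ≤
        (K * rate b r D) ^ 2 * (⟪covOp hk ρ y, y⟫_ℝ + tuning b r D * ‖y‖ ^ 2) := by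
  set C : ℝ := 2 * (3 * (M + ∫ x, x ^ 2 ∂η + B ^ 2) * N + M) + 1 with hCdef
  have hη2 : 0 ≤ ∫ x, x ^ 2 ∂η := integral_nonneg fun x => sq_nonneg x
  have hC : 0 < C := by positivity
  refine ⟨√(2 * (C / p) + 2 * Ch), Real.sqrt_nonneg _, fun D f hf happ => ?_⟩
  set l := tuning b r D with hldef
  have hl : 0 < l := tuning_pos D
  have hρ := rate_pos (b := b) (r := r) D
  set Φ : Ω → ℝ≥0∞ := fun ω => ∑' i, ENNReal.ofReal ((ev i / ρ.real Set.univ + l)⁻¹ *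
        (⟪empiricalVec H D (fun i j => t i j ω) (response X ξ t ε ω)
          - empiricalOp H D (fun i j => t i j ω) f, eigFun hk ρ ev ψ i⟫_ℝ
          - ∫ s, (meanFun Q X s - f s) * (eigFun hk ρ ev ψ i : H) s
            ∂((ρ Set.univ)⁻¹ • ρ)) ^ 2) with hΦ
  have hmeas : Measurable Φ := Measurable.tsum fun i =>
    ((((h.measurable_inner_empiricalVec_sub hk hX D f _).sub_const _).pow_const 2).const_mul
      _).ennreal_ofReal
  have hE : ∫⁻ ω, Φ ω ∂P ≤ ENNReal.ofReal (C * rate b r D ^ 2) := by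
    refine (h.lintegral_noise_le heig ha.le hka D hl (hN l hl) hX hM hη hη0 hf).trans
      (ENNReal.ofReal_le_ofReal ?_)
    have h1 : D.size⁻¹ * l ^ (-(1 / b)) ≤ rate b r D ^ 2 := by
      rw [inv_size_mul_tuning hb hr]
      exact pow_le_pow_left₀ (by positivity) (tuning_rpow_le_rate D) 2
    have h2 := inv_n_le_rate_sq (b := b) (r := r) D
    calc _ = 2 * (3 * (M + ∫ x, x ^ 2 ∂η + B ^ 2) * N * (D.size⁻¹ * l ^ (-(1 / b)))
          + M * (D.n : ℝ)⁻¹) := by ring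
      _ ≤ 2 * (3 * (M + ∫ x, x ^ 2 ∂η + B ^ 2) * N * rate b r D ^ 2 + M * rate b r D ^ 2) := by
          gcongr
      _ ≤ _ := by
          rw [hCdef]
          nlinarith [sq_nonneg (rate b r D)]
  have hq : 0 < C / p * rate b r D ^ 2 := by positivity
  refine ⟨{ω | ENNReal.ofReal (C / p * rate b r D ^ 2) < Φ ω},
    measure_lt_le_of_lintegral_le hmeas hE hq (le_of_eq (by field_simp)), fun ω hω hmem y => ?_⟩
  rw [Set.mem_ofPred_eq, not_lt] at hω
  have hmf : MemLp (fun x => meanFun Q X x - f x) 2 ρ := by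
    refine (Lp.memLp (m - inclusion hk ρ f)).ae_eq ?_
    filter_upwards [hm, inclusion_ae_eq hk ρ f, Lp.coeFn_sub m (inclusion hk ρ f)] with x h1 h2 h3
    rw [h3, Pi.sub_apply, h1, h2]
  have hI : ∫ x, (meanFun Q X x - f x) ^ 2 ∂((ρ Set.univ)⁻¹ • ρ) ≤ Ch * rate b r D ^ 2 := by
    rw [integral_sub_sq_eq (hk := hk) hm, inv_mul_le_iff₀ heig.measureReal_pos]
    refine happ.trans ?_
    have h1 : (l ^ r) ^ 2 ≤ rate b r D ^ 2 :=
      pow_le_pow_left₀ (by positivity) (tuning_rpow_le_rate D) 2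
    have h2 := heig.measureReal_pos
    calc ρ.real Set.univ * (l ^ r) ^ 2 * Ch ≤ ρ.real Set.univ * rate b r D ^ 2 * Ch := by gcongr
      _ = _ := by ring
  have hfin : (√(2 * (C / p) + 2 * Ch) * rate b r D) ^ 2 =
      2 * (C / p * rate b r D ^ 2) + 2 * (Ch * rate b r D ^ 2) := by
    rw [mul_pow, Real.sq_sqrt (by positivity)]
    ring
  rw [hfin]
  refine heig.inner_empiricalVec_sub_sq_le D (τ := fun i j => t i j ω) hmem _ hl hmf (fun s => ?_) hI y
  exact sum_le_of_tsum_ofReal_le (x := fun i => (ev i / ρ.real Set.univ + l)⁻¹ *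
    (⟪empiricalVec H D (fun i j => t i j ω) (response X ξ t ε ω)
      - empiricalOp H D (fun i j => t i j ω) f, eigFun hk ρ ev ψ i⟫_ℝ
      - ∫ s, (meanFun Q X s - f s) * (eigFun hk ρ ev ψ i : H) s
        ∂((ρ Set.univ)⁻¹ • ρ)) ^ 2) hq.le (fun i => mul_nonneg
    (inv_nonneg.2 (add_pos (heig.div_pos i) hl).le) (sq_nonneg _)) hω s

/-- The rate for a target of smoothness `r` not exceeding the qualification, given a polynomial
bound of exponent `τ ≤ 2 r` for the leverage `∑ e_i(x)² / (σ_i + l)` and a uniform bound for the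
spectral truncations of the target. -/
theorem boundedInProb_of_source [HereditarilyLindelofSpace 𝕋]
    (h : IsSample Q ((ρ Set.univ)⁻¹ • ρ) η P ξ t ε)
    (heig : IsEigensystem (integralOp hk ρ) ev ψ) {a : ℝ} (ha : 0 < a)
    (hka : ∀ s : 𝕋, kern H s s ≤ a) {b : ℝ} (hb : 1 < b) (hdecay : PolyDecay ev b)
    {g : ℝ → ℝ → ℝ} (hg : IsRegularizationFamily a g) {ν : ℝ≥0∞} (hν : IsQualification a g ν)
    (hν1 : 1 ≤ ν) {r : ℝ} (hr : 0 ≤ r) (hrν : ENNReal.ofReal r ≤ ν)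
    {X : 𝕋 → S → ℝ} (hX : Measurable (Function.uncurry X)) {M : ℝ≥0}
    (hM : ∀ s, ∫⁻ x, ‖X s x‖ₑ ^ 2 ∂Q ≤ M) (hη : MemLp (fun x : ℝ => x) 2 η)
    (hη0 : ∫ x, x ∂η = 0) {m : Lp ℝ 2 ρ} (hm : m =ᵐ[ρ] meanFun Q X) {c : ℕ → ℝ} {Ch : ℝ}
    (hc : ∀ s : Finset ℕ, ∑ i ∈ s, c i ^ 2 ≤ Ch)
    (hsrc : HasSum (fun i => (√(ρ.real Set.univ) * (ev i / ρ.real Set.univ) ^ r * c i) • ψ i) m)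
    {τ : ℝ} (hτ : 0 ≤ τ) (hτr : τ ≤ 2 * r) {B : ℝ}
    (hB0 : 0 ≤ B) (hB : ∀ l : ℝ, 0 < l → ∀ᵐ x ∂ρ, ∀ s : Finset ℕ,
      ∑ i ∈ s, (ev i / ρ.real Set.univ + l)⁻¹ * (eigFun hk ρ ev ψ i : H) x ^ 2 ≤ B * l ^ (-τ))
    {B' : ℝ} (hB' : ∀ F : Finset ℕ, ∀ᵐ x ∂ρ, |(truncation hk ρ ev ψ r c F : H) x| ≤ B') :
    BoundedInProb P {D : Design | tuning b r D ≤ a}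
      (fun D ω => eLpNorm (fun s => meanEstimator H g (tuning b r D) D (fun i j => t i j ω)
        (response X ξ t ε ω) s - meanFun Q X s) 2 ρ) (rate b r) := by
  intro δ _ hδ1
  have hb0 : 0 < b := zero_lt_one.trans hb
  have hCh : 0 ≤ Ch := by simpa using hc ∅
  have hR := heig.measureReal_pos
  obtain ⟨_, Cd, _, hCd, hdec⟩ := hdecay
  obtain ⟨N, hN0, hN⟩ := exists_effectiveDimension_le hb heig.div_pos
    (c := Cd / ρ.real Set.univ) (by positivity) (fun i => by
      rw [div_mul_eq_mul_div]
      gcongr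
      exact (hdec i).2)
  -- The probability `1 - δ` is split evenly over the three bad events.
  set p : ℝ := (1 - δ) / 3 with hpdef
  have hp : 0 < p := by rw [hpdef]; linarith
  obtain ⟨κ, hκ, hop⟩ := h.exists_energy_le heig ha hka hb0 hr hN0 hN hτ hτr hB0 hB hp
  obtain ⟨Kn, hKn, hnoise⟩ := h.exists_noise_le heig ha hka hb0 hr hN0 hN hX hM hη hη0 hm B' Ch
    hCh hp
  obtain ⟨Bg, hBg, hgB⟩ := hg.exists_filterFun_le
  obtain ⟨Kr, hKr, hres⟩ := heig.exists_residual_truncation_le ha hka hν hν1 hrν hc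
    (c := 2 * κ) (K := √(2 * a ^ 2 / p)) (by positivity) (Real.sqrt_nonneg _)
  refine ⟨√(ρ.real Set.univ) * (√(2 * κ) * (√(2 * κ) * Kn * Bg + Kr)) +
    √(ρ.real Set.univ) * √Ch + 1, by positivity, fun D hD => ?_⟩
  set l := tuning b r D with hldef
  have hl : 0 < l := tuning_pos D
  have hla : l ≤ a := hD
  have hrate := rate_pos (b := b) (r := r) D
  have hlr : l ^ r ≤ rate b r D := tuning_rpow_le_rate D
  obtain ⟨F, hF, hF'⟩ := heig.exists_finset_level hka hl
  have happ := heig.norm_sub_truncation_sq_le hr hc hsrc hF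
  obtain ⟨bad₁, hbad₁, hgood₁⟩ := hop D
  obtain ⟨bad₂, hbad₂, hgood₂⟩ := hnoise D _ (hB' F) happ
  have hsz : 0 < D.size⁻¹ := inv_pos.2 (zero_lt_one.trans_le D.one_le_size)
  refine le_trans (measure_mono (t := bad₁ ∪ bad₂) fun ω hω => ?_) ?_
  swap
  · calc P (bad₁ ∪ bad₂) ≤ ENNReal.ofReal (2 * p) + ENNReal.ofReal p :=
          (measure_union_le _ _).trans (add_le_add hbad₁ hbad₂)
      _ = ENNReal.ofReal (1 - δ) := by
          rw [← ENNReal.ofReal_add (by positivity) hp.le]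
          congr 1
          rw [hpdef]; ring
  by_contra hgood
  rw [Set.mem_union, not_or] at hgood
  rw [Set.mem_ofPred_eq, ← not_le] at hω
  obtain ⟨hmem, hcmp, hop'⟩ := hgood₁ ω hgood.1
  refine hω ?_
  beta_reduce
  rw [eLpNorm_sub_eq (hk := hk) hm]
  refine ENNReal.ofReal_le_ofReal ?_
  have hest := heig.norm_inclusion_estimator_sub_le hka D (fun i j => t i j ω)
    (response X ξ t ε ω) hl hla (by positivity) hcmp (by positivity)
    (hgood₂ ω hgood.2 hmem) hBg (hgB l ⟨hl, hla⟩) (R := Kr * l ^ r) (by positivity)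
    (fun hv hs hA => hres hl hla hF' hcmp (by positivity) hop' (by
      rw [Real.sqrt_mul (by positivity)]
      gcongr
      exact Real.sqrt_le_iff.2 ⟨by positivity, inv_size_le_tuning hb0 hr D⟩) hv hs hA)
  have happ' : ‖inclusion hk ρ (truncation hk ρ ev ψ r c F) - m‖ ≤
      √(ρ.real Set.univ) * √Ch * l ^ r := by
    rw [norm_sub_rev]
    refine (sq_le_sq₀ (norm_nonneg _) (by positivity)).1 (happ.trans_eq ?_)
    rw [mul_pow, mul_pow, Real.sq_sqrt hR.le, Real.sq_sqrt hCh]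
    ring
  calc _ ≤ ‖inclusion hk ρ (meanEstimator H g l D (fun i j => t i j ω) (response X ξ t ε ω)) -
        inclusion hk ρ (truncation hk ρ ev ψ r c F)‖ +
        ‖inclusion hk ρ (truncation hk ρ ev ψ r c F) - m‖ := norm_sub_le_norm_sub_add_norm_sub _ _ _
    _ ≤ √(ρ.real Set.univ) * (√(2 * κ) * (√(2 * κ) * (Kn * rate b r D) * Bg + Kr * rate b r D)) +
        √(ρ.real Set.univ) * √Ch * rate b r D :=
        add_le_add (hest.trans (by gcongr)) (happ'.trans (by gcongr))
    _ ≤ _ := by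
        have : (0 : ℝ) ≤ rate b r D := hrate.le
        linarith

end Core

/-! ### The source condition -/

section Source

variable {𝕋 : Type*} {H : Type*} [NormedAddCommGroup H] [InnerProductSpace ℝ H] [CompleteSpace H]
  [RKHS ℝ H 𝕋 ℝ]
variable [TopologicalSpace 𝕋] [CompactSpace 𝕋] [MeasurableSpace 𝕋] [BorelSpace 𝕋]
variable {hk : Continuous fun p : 𝕋 × 𝕋 => kern H p.1 p.2} {ρ : Measure 𝕋} [IsFiniteMeasure ρ]
variable {ev : ℕ → ℝ} {ψ : ℕ → Lp ℝ 2 ρ}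

/-- A target of smoothness `α` has every smaller smoothness `r`, also with respect to the
normalized eigenvalues `ev_i / ρ(T)`. -/
lemma IsEigensystem.exists_source_coefficients (heig : IsEigensystem (integralOp hk ρ) ev ψ)
    {a : ℝ} (ha : 0 ≤ a) (hka : ∀ s : 𝕋, kern H s s ≤ a)
    [IsProbabilityMeasure ((ρ Set.univ)⁻¹ • ρ)] {α r : ℝ} (hr : r ≤ α) {h f : Lp ℝ 2 ρ}
    (hf : IsPowerImage ev ψ α h f) :
    ∃ (c : ℕ → ℝ) (Ch : ℝ), (∀ s : Finset ℕ, ∑ i ∈ s, c i ^ 2 ≤ Ch) ∧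
      HasSum (fun i => (√(ρ.real Set.univ) * (ev i / ρ.real Set.univ) ^ r * c i) • ψ i) f := by
  have hR := heig.measureReal_pos
  set R := ρ.real Set.univ with hRdef
  refine ⟨fun i => R ^ (r - 1 / 2) * ev i ^ (α - r) * ⟪ψ i, h⟫_ℝ,
    (R ^ (r - 1 / 2) * (a * R) ^ (α - r)) ^ 2 * ‖h‖ ^ 2, fun s => ?_, ?_⟩
  · have h1 : ∑ i ∈ s, ⟪ψ i, h⟫_ℝ ^ 2 ≤ ‖h‖ ^ 2 := by
      simpa using heig.orthonormal.sum_inner_products_le h (s := s)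
    refine le_trans ?_ (mul_le_mul_of_nonneg_left h1 (sq_nonneg _))
    rw [Finset.mul_sum]
    refine Finset.sum_le_sum fun i _ => ?_
    rw [mul_pow]
    have h2 : ev i ≤ a * R := (div_le_iff₀ hR).1 (heig.div_le ha hka i)
    have h3 : 0 ≤ α - r := sub_nonneg.2 hr
    have h4 := (heig.pos i).le
    gcongr
  · refine HasSum.congr_fun (f := fun i => (ev i ^ α * ⟪ψ i, h⟫_ℝ) • ψ i) hf fun i => ?_
    congr 1
    beta_reduce
    have h1 := heig.pos i
    rw [Real.div_rpow h1.le hR.le, Real.rpow_sub hR, Real.rpow_sub h1, Real.sqrt_eq_rpow]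
    field_simp

end Source

end

end FDA

theorem mainTheorem1
    -- the compact domain, the measure defining `L²(T)`, the RKHS with its continuous kernel
    (T : Set ℝ) [CompactSpace T] (ρ : Measure T) [IsFiniteMeasure ρ]
    {H : Type*} [NormedAddCommGroup H] [InnerProductSpace ℝ H] [CompleteSpace H] [RKHS ℝ H T ℝ]
    (hk : Continuous fun p : T × T => FDA.kern H p.1 p.2)
    -- eigenpairs of the integral operator, polynomial decay
    (ev : ℕ → ℝ) (ψ : ℕ → Lp ℝ 2 ρ) (heig : FDA.IsEigensystem (FDA.integralOp hk ρ) ev ψ)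
    (b : ℝ) (hb : 1 < b) (hdecay : FDA.PolyDecay ev b)
    -- the regularization family on an interval `[0, a]` and its qualification
    (a : ℝ) (ha : 0 < a) (hka : ∀ s : T, FDA.kern H s s ≤ a)
    (g : ℝ → ℝ → ℝ) (hg : FDA.IsRegularizationFamily a g)
    (ν : ℝ≥0∞) (hν : FDA.IsQualification a g ν) (hν1 : 1 ≤ ν)
    -- the process on its probability space, with the moment conditions
    {S : Type*} [MeasurableSpace S] (Q : Measure S) [IsProbabilityMeasure Q]
    (X : T → S → ℝ) (hX : Measurable (Function.uncurry X)) (hmom : FDA.MomentConditions ρ Q X)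
    -- the error law: zero mean and finite variance
    (η : Measure ℝ) [IsProbabilityMeasure η] (hη : MemLp (fun x : ℝ => x) 2 η)
    (hη0 : ∫ x, x ∂η = 0)
    -- the observation model, the sampling points having law `ρ / ρ(T)`
    {Ω : Type*} [MeasurableSpace Ω] (P : Measure Ω) [IsProbabilityMeasure P]
    (ξ : ℕ → Ω → S) (t : ℕ → ℕ → Ω → T) (ε : ℕ → ℕ → Ω → ℝ)
    (hsample : FDA.IsSample Q ((ρ Set.univ)⁻¹ • ρ) η P ξ t ε)
    -- the source condition
    (α : ℝ) (hα : 0 < α)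
    (hsrc : ∃ h f : Lp ℝ 2 ρ, FDA.IsPowerImage ev ψ α h f ∧ f =ᵐ[ρ] FDA.meanFun Q X)
    -- `r = min {α, ν}`
    (r : ℝ) (hr : r = (min (ENNReal.ofReal α) ν).toReal) :
    (1 / 2 ≤ α →
      FDA.BoundedInProb P {D : FDA.Design | FDA.tuning b r D ≤ a}
        (fun D ω => eLpNorm (fun s : T =>
          FDA.meanEstimator H g (FDA.tuning b r D) D (fun i j => t i j ω)
            (FDA.response X ξ t ε ω) s - FDA.meanFun Q X s) 2 ρ)
        (FDA.rate b r)) ∧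
    (α ≤ 1 / 2 → FDA.PowerEmbedding ev ψ α →
      FDA.BoundedInProb P {D : FDA.Design | FDA.tuning b r D ≤ a}
        (fun D ω => eLpNorm (fun s : T =>
          FDA.meanEstimator H g (FDA.tuning b r D) D (fun i j => t i j ω)
            (FDA.response X ξ t ε ω) s - FDA.meanFun Q X s) 2 ρ)
        (FDA.rate b α)) := by
  -- Makes the normalized measure a probability measure: `ρ ≠ 0` as `L²(ρ)` has unit vectors.
  have : NeZero ρ := ⟨heig.measure_ne_zero⟩
  obtain ⟨M, hM⟩ := hmom.second
  obtain ⟨h, f, hf, hfm⟩ := hsrc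
  have hmin : min (ENNReal.ofReal α) ν ≠ ∞ := (min_lt_of_left_lt ENNReal.ofReal_lt_top).ne
  have hr' : ENNReal.ofReal r = min (ENNReal.ofReal α) ν := by rw [hr, ENNReal.ofReal_toReal hmin]
  have hrν : ENNReal.ofReal r ≤ ν := hr' ▸ min_le_right _ _
  have hrα : r ≤ α := (ENNReal.ofReal_le_ofReal_iff hα.le).1 (hr' ▸ min_le_left _ _)
  have hr0 : 0 ≤ r := hr ▸ ENNReal.toReal_nonneg
  obtain ⟨c, Ch, hc, hsum⟩ := heig.exists_source_coefficients ha.le hka hrα hf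
  refine ⟨fun hα2 => ?_, fun hα2 hemb => ?_⟩
  -- Here the target lies in the RKHS; the kernel bound gives leverage exponent `1 ≤ 2 r`.
  · have hr2 : 1 / 2 ≤ r := by
      rw [← ENNReal.ofReal_le_ofReal_iff hr0, hr', le_min_iff]
      refine ⟨ENNReal.ofReal_le_ofReal hα2, le_trans ?_ hν1⟩
      rw [ENNReal.ofReal_le_one]
      norm_num
    exact FDA.boundedInProb_of_source hsample heig ha hka hb hdecay hg hν hν1 hr0 hrν hX hM hη hη0
      hfm hc hsum zero_le_one (by linarith) ha.le
      (fun l hl => ae_of_all _ fun x s => heig.sum_inv_mul_eigFun_sq_le hka hl x s)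
      (fun F => ae_of_all _ fun x => heig.abs_truncation_le ha.le hka hr2 hc F x)
  -- The embedding gives leverage exponent `2 α` and bounds the truncations uniformly.
  · have hαr : r = α := by
      have h1 : ENNReal.ofReal α ≤ ν := by
        refine le_trans ?_ hν1
        rw [ENNReal.ofReal_le_one]
        linarith
      rw [hr, min_eq_left h1, ENNReal.toReal_ofReal hα.le]
    subst hαr
    obtain ⟨B, hB0, hB⟩ := heig.exists_ae_sum_inv_mul_eigFun_sq_le hα hα2 hemb
    obtain ⟨B', hB'⟩ := heig.exists_ae_abs_truncation_le hemb hc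
    exact FDA.boundedInProb_of_source hsample heig ha hka hb hdecay hg hν hν1 hr0 hrν hX hM hη hη0
      hfm hc hsum (by positivity) le_rfl hB0 hB hB'
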